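/- Let $p>1$, $a<x<b$, and let $y_i=m(x_i)+\varepsilon_i$, $i=1,2,\dots$, where: - the errors $\varepsilon_i$ are i.i.d., not a.s. zero, with $E[|\varepsilon_1|^{p-1}\operatorname{sign}(\varepsilon_1)]=0$, $E|\varepsilon_1|^{(p-1)(2+\delta)}<\infty$ for some $\delta>0$, and $E|\varepsilon_1|^{p-2}<\infty$; - the design points $x_i$ are i.i.d. and independent of the errors, with a density $f$ that vanishes outside $(a,b)$, has a bounded first derivative on $(a,b)$, and satisfies $f(x)>0$; - $K$ is a symmetric, nonnegative, square integrable kernel supported on $[-1,1]$ with $\int K=1$, and $K_h(u)=h^{-1}K(u/h)$; - the bandwidths $h=h_n>0$ satisfy $h\to0$, $nh\to\infty$ and $nh^5\to0$ as $n\to\infty$. Write $\mu_j(K)=\int u^jK(u)\,du$, $R(K)=\int K(u)^2du$, $\mu_2(K^2)=\int u^2K(u)^2du$. A sequence $T_n$ is called asymptotically normal with mean $c_n$ and variance $v_n$ if $(T_n-c_n)/\sqrt{v_n}$ converges in distribution to $N(0,1)$; a remainder $o(\cdot)$ in $c_n$ or $v_n$ means that this holds for every deterministic sequence of that order. Then: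 (i) Suppose that $m$ has two continuous derivatives on $(a,b)$ and that $E|\varepsilon_1-t|^{p-2}=E|\varepsilon_1|^{p-2}+O(t)$ as $t\to0$. If $\hat m(x)$ is a local constant $L_p$-norm estimator, i.e. a (measurable) minimizer of $\beta_0\mapsto\sum_{i=1}^n|y_i-\beta_0|^pK_h(x_i-x)$, then $\hat m(x)$ is asymptotically normal with mean $$m(x)+\mu_2(K)h^2\Big(\frac{m'(x)f'(x)}{f(x)}+\frac{m''(x)}2\Big)+o(h^2)$$ and variance $$\frac{R(K)\,E|\varepsilon_1|^{2p-2}}{nh(p-1)^2\,(E|\varepsilon_1|^{p-2})^2f(x)}+o\Big(\frac1{nh}\Big).$$ (ii) Suppose that $m$ has three continuous derivatives on $(a,b)$, and let $(\hat m(x),\widehat{m'}(x))$ be a local linear $L_p$-norm estimator, i.e. a (measurable) minimizer of $(\beta_0,\beta_1)\mapsto\sum_{i=1}^n|y_i-\beta_0-\beta_1(x_i-x)|^pK_h(x_i-x)$. Then (a) $\hat m(x)$ is asymptotically normal with mean $m(x)+\frac12\mu_2(K)h^2m''(x)+o(h^2)$ and variance $$\frac{R(K)\,E|\varepsilon_1|^{2p-2}}{nhf(x)(p-1)^2(E|\varepsilon_1|^{p-2})^2}+o\Big(\frac1{nh}\Big);$$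 (b) $\widehat{m'}(x)$ is asymptotically normal with mean $m'(x)+\dfrac{\mu_4(K)h^2m'''(x)}{3!\,\mu_2(K)}+o(h^2)$ and variance $$\frac{\mu_2(K^2)\,E|\varepsilon_1|^{2p-2}}{nh^3f(x)\,\mu_2(K)^2(p-1)^2(E|\varepsilon_1|^{p-2})^2}+o\Big(\frac1{nh^3}\Big).$$ (iii) In the situation of (ii), $\hat m(x)$ and $\widehat{m'}(x)$ are asymptotically independent: the pair formed by the two, standardized with the means and variances in (a) and (b), converges in distribution to a pair of independent $N(0,1)$ variables. -/

import Mathlib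

open MeasureTheory ProbabilityTheory Filter Topology Asymptotics Set

/-- The rescaled kernel `K_h(u) = h⁻¹ K(u / h)`, so that `K = K_1`. -/
noncomputable def scaledKernel (K : ℝ → ℝ) (h u : ℝ) : ℝ := h⁻¹ * K (u / h)

/-- `μ_j(K) = ∫ u^j K(u) du`. -/
noncomputable def kernelMoment (K : ℝ → ℝ) (j : ℕ) : ℝ := ∫ u, u ^ j * K u

/-- `R(K) = ∫ K(u)² du`. -/
noncomputable def kernelRoughness (K : ℝ → ℝ) : ℝ := ∫ u, K u ^ 2

/-- `μ_j(K²) = ∫ u^j K(u)² du`. -/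
noncomputable def kernelSqMoment (K : ℝ → ℝ) (j : ℕ) : ℝ := ∫ u, u ^ j * K u ^ 2

/-- A symmetric, nonnegative, square integrable kernel of total mass one, supported on `[-1, 1]`;
its rescaling `K_h` is then supported on `[-h, h]`. -/
structure IsSmoothingKernel (K : ℝ → ℝ) : Prop where
  measurable : Measurable K
  nonneg : ∀ u, 0 ≤ K u
  symm : ∀ u, K (-u) = K u
  support : ∀ u, 1 < |u| → K u = 0
  sq_integrable : MemLp K 2 volume
  integral_eq_one : ∫ u, K u = 1

/-- A function supported on the interval `(a, b)` which is nonnegative and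
has a bounded first derivative on `(a, b)`. -/
structure IsDesignDensity (a b : ℝ) (f : ℝ → ℝ) : Prop where
  nonneg : ∀ z, 0 ≤ f z
  support : ∀ z, z ∉ Ioo a b → f z = 0
  differentiable : ∀ z ∈ Ioo a b, DifferentiableAt ℝ f z
  bounded_deriv : ∃ C : ℝ, ∀ z ∈ Ioo a b, |deriv f z| ≤ C

/-- A bandwidth sequence: `h → 0`, `n h → ∞` and `n h⁵ = o(1)`. -/
structure IsBandwidth (h : ℕ → ℝ) : Prop where
  pos : ∀ n, 0 < h n
  tendsto_zero : Tendsto h atTop (𝓝 0)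
  mul_tendsto_top : Tendsto (fun n : ℕ => (n : ℝ) * h n) atTop atTop
  mul_pow_tendsto_zero : Tendsto (fun n : ℕ => (n : ℝ) * h n ^ 5) atTop (𝓝 0)

section Errors

variable {Ω : Type*} [MeasurableSpace Ω]

/-- `E|Z|^q` as an extended nonnegative number. For `q < 0` the integrand is `∞` where `Z = 0`. -/
noncomputable def eAbsMoment (P : Measure Ω) (Z : Ω → ℝ) (q : ℝ) : ENNReal :=
  ∫⁻ ω, ‖Z ω‖ₑ ^ q ∂P

/-- `E|Z|^q` as a real number. -/
noncomputable def absMoment (P : Measure Ω) (Z : Ω → ℝ) (q : ℝ) : ℝ :=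
  (eAbsMoment P Z q).toReal

/-- Independent random design points with density `f`. -/
structure IsRandomDesign (P : Measure Ω) (X : ℕ → Ω → ℝ) (f : ℝ → ℝ) : Prop where
  measurable : ∀ i, Measurable (X i)
  indep : iIndepFun X P
  law : ∀ i, P.map (X i) = volume.withDensity (fun z => ENNReal.ofReal (f z))

/-- Independent and identically distributed errors, not almost surely zero, with
`E[|ε|^(p-1) sign ε] = 0`, `E|ε|^((p-1)(2+δ)) < ∞` for some `δ > 0`, and `E|ε|^(p-2) < ∞`. -/
structure IsErrorSequence (P : Measure Ω) (ε : ℕ → Ω → ℝ) (p : ℝ) : Prop where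
  measurable : ∀ i, Measurable (ε i)
  indep : iIndepFun ε P
  identDistrib : ∀ i, IdentDistrib (ε i) (ε 0) P P
  score_mean : ∫ ω, |ε 0 ω| ^ (p - 1) * Real.sign (ε 0 ω) ∂P = 0
  moment : ∃ δ : ℝ, 0 < δ ∧ eAbsMoment P (ε 0) ((p - 1) * (2 + δ)) < ⊤
  neg_moment : eAbsMoment P (ε 0) (p - 2) < ⊤
  nondegenerate : ¬ ∀ᵐ ω ∂P, ε 0 ω = 0

/-- The local constant objective `β₀ ↦ ∑_{i<n} |y_i - β₀|^p K_h(x_i - x)`. -/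
noncomputable def locConstObjective (p : ℝ) (K : ℝ → ℝ) (h x : ℝ) (n : ℕ) (xs ys : ℕ → ℝ)
    (β₀ : ℝ) : ℝ :=
  ∑ i ∈ Finset.range n, |ys i - β₀| ^ p * scaledKernel K h (xs i - x)

/-- The local linear objective
`(β₀, β₁) ↦ ∑_{i<n} |y_i - β₀ - β₁ (x_i - x)|^p K_h(x_i - x)`. -/
noncomputable def locLinObjective (p : ℝ) (K : ℝ → ℝ) (h x : ℝ) (n : ℕ) (xs ys : ℕ → ℝ)
    (β : ℝ × ℝ) : ℝ :=
  ∑ i ∈ Finset.range n,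
    |ys i - β.1 - β.2 * (xs i - x)| ^ p * scaledKernel K h (xs i - x)

/-- `T n` is, for every sample size `n`, a (measurable) random variable that almost surely
minimizes the local constant objective. -/
structure IsLocConstEstimator (P : Measure Ω) (p : ℝ) (K : ℝ → ℝ) (h : ℕ → ℝ) (x : ℝ)
    (X Y : ℕ → Ω → ℝ) (T : ℕ → Ω → ℝ) : Prop where
  aemeasurable : ∀ n, AEMeasurable (T n) P
  minimizes : ∀ n, ∀ᵐ ω ∂P, ∀ β₀ : ℝ,
    locConstObjective p K (h n) x n (fun i => X i ω) (fun i => Y i ω) (T n ω) ≤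
      locConstObjective p K (h n) x n (fun i => X i ω) (fun i => Y i ω) β₀

/-- `(T n, S n)` is, for every sample size `n`, a (measurable) random vector that almost surely
minimizes the local linear objective; `T` estimates `m(x)` and `S` estimates `m'(x)`. -/
structure IsLocLinEstimator (P : Measure Ω) (p : ℝ) (K : ℝ → ℝ) (h : ℕ → ℝ) (x : ℝ)
    (X Y : ℕ → Ω → ℝ) (T S : ℕ → Ω → ℝ) : Prop where
  aemeasurable_fst : ∀ n, AEMeasurable (T n) P
  aemeasurable_snd : ∀ n, AEMeasurable (S n) P
  minimizes : ∀ n, ∀ᵐ ω ∂P, ∀ β : ℝ × ℝ,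
    locLinObjective p K (h n) x n (fun i => X i ω) (fun i => Y i ω) (T n ω, S n ω) ≤
      locLinObjective p K (h n) x n (fun i => X i ω) (fun i => Y i ω) β

/-- The standardized sequence `(T_n - c_n) / √v_n`. -/
noncomputable def standardized (T : ℕ → Ω → ℝ) (c v : ℕ → ℝ) (n : ℕ) (ω : Ω) : ℝ :=
  (T n ω - c n) / √(v n)

/-- `T_n` is asymptotically normal with mean `c_n` and variance `v_n`:
`(T_n - c_n) / √v_n` converges in distribution to `N(0, 1)`. -/
def IsAsymptoticallyNormal (P : Measure Ω) [IsProbabilityMeasure P]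
    (T : ℕ → Ω → ℝ) (c v : ℕ → ℝ) : Prop :=
  TendstoInDistribution (standardized T c v) atTop id (fun _ => P) (gaussianReal 0 1)

/-- `T_n` and `S_n`, standardized by `(c_n, v_n)` and `(d_n, w_n)` respectively, are jointly
asymptotically normal and asymptotically independent: the standardized pair converges in
distribution to a pair of independent `N(0, 1)` random variables. -/
def AreAsymptoticallyIndepNormal (P : Measure Ω) [IsProbabilityMeasure P]
    (T : ℕ → Ω → ℝ) (c v : ℕ → ℝ) (S : ℕ → Ω → ℝ) (d w : ℕ → ℝ) : Prop :=
  TendstoInDistribution (fun n ω => (standardized T c v n ω, standardized S d w n ω))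
    atTop id (fun _ => P) ((gaussianReal 0 1).prod (gaussianReal 0 1))

end Errors

/-! Write ψ for `score p`. A minimizer solves a score equation: the kernel-weighted sum of
ψ(residual) against each regressor vanishes. With u = (X - x)/h and r = √(nh), a residual is ε +
δ(u) - r⁻¹ ⟨θ, z(u)⟩, where z is 1 or (1, u), θ is the normalized estimation error, and δ is the
error of the local polynomial approximation of m. Linearizing ψ at ε turns the equation into W - Dθ
+ o(1) = 0 in probability, uniformly on bounded sets of θ, with W = r⁻¹ ∑ K z ψ(ε) and D = f(x)
(p-1) E|ε|^(p-2) ∫ K z zᵀ. The matrix D is diagonal because K is even.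

This uniform linearization controls the actual root because ψ is increasing: a root outside a large
ball would force the wrong sign of the score on the sphere
(`abs_mul_sub_le_of_scoreEquation_eq_zero`). Hence Dθ = W + o(1), which is
`IsLocalSample.tendstoZeroInProb_estimator`. For p < 2 the derivative of ψ is singular at 0;
`exists_abs_score_sub_le` bounds the linearization error by a modulus that is dominated by |ε|^(p-2)
+ 1 and tends to 0, so the error is small in mean.

Since nh⁵ → 0, terms of order h² are negligible against the standard deviation, so the coefficient
of h² in the centering does not affect the limit; it remains to exclude larger bias. In the local
linear case δ = O(h²) and a first moment bound suffices (`tendstoZeroInProb_bias`). In the local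
constant case δ = m'(x) h u + O(h²). Its fluctuations vanish in L², and the order h part of its mean
is a multiple of ∫ u K(u) du = 0, by the expansion E ψ(ε + t) = (p-1) E|ε|^(p-2) t + O(t²)
(`tendstoZeroInProb_bias_of_linear`).

Finally W is a sum of i.i.d. exactly centered terms, and characteristic functions give its normal
limit (`IsLocalSample.tendsto_charFun_sum`). The weights K and uK are orthogonal in L², whence
asymptotic independence; Slutsky's lemma transfers the limit to the standardized estimators. -/

/-- The score function `|u|^(p-2) u`, which is `1/p` times the derivative of `|u|^p`. -/
noncomputable def score (p u : ℝ) : ℝ := |u| ^ (p - 2) * u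

/-- A bound for the relative error in the linearization of `score p` at `e`. -/
noncomputable def scoreModulus (p e η : ℝ) : ℝ :=
  (if p = 2 then 0 else |e| ^ (p - 2) * min 1 (η / |e|)) + if 2 < p then η ^ (p - 2) else 0

/-- Mean value inequality for g minus its tangent on [-|y|, |y|], where the derivative is at most
C|y|. It serves for the power function, for the regression function and for the mean score. -/
lemma abs_sub_linear_le_of_hasDerivAt {g g' : ℝ → ℝ} {x r C : ℝ} (hC : 0 ≤ C)
    (hg : ∀ s, |s| ≤ r → HasDerivAt g (g' s) (x + s))
    (hg' : ∀ s, |s| ≤ r → |g' s - g' 0| ≤ C * |s|) {y : ℝ} (hy : |y| ≤ r) :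
    |g (x + y) - g x - g' 0 * y| ≤ C * y ^ 2 := by
  have hder : ∀ s ∈ Icc (-|y|) |y|, HasDerivWithinAt (fun s => g (x + s) - g' 0 * s)
      (g' s - g' 0 * 1) (Icc (-|y|) |y|) s := fun s hs =>
    (((hg s ((abs_le.2 hs).trans hy)).comp_const_add x s).sub
      ((hasDerivAt_id s).const_mul _)).hasDerivWithinAt
  have := (convex_Icc (-|y|) |y|).norm_image_sub_le_of_norm_hasDerivWithin_le
    (C := C * |y|) (x := 0) (y := y) hder (fun s hs => by
      have hs' := abs_le.2 hs
      rw [mul_one]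
      exact (hg' s (hs'.trans hy)).trans (mul_le_mul_of_nonneg_left hs' hC))
      (mem_Icc.2 (by simp)) (mem_Icc.2 (abs_le.1 le_rfl))
  rw [Real.norm_eq_abs, Real.norm_eq_abs] at this
  simp only [add_zero, mul_zero, sub_zero] at this
  calc _ = |g (x + y) - g' 0 * y - g x| := by ring_nf
    _ ≤ _ := this
    _ = _ := by rw [← sq_abs y]; ring

/-! ### Calculus of the score: monotonicity, linearization, first order condition -/

section Score

variable {p : ℝ}

/-- The exponent p - 1 is positive, so this form makes continuity and monotonicity visible even for
p < 2, where the factor |u|^(p-2) is singular at 0. -/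
lemma score_eq_max (hp : 1 < p) (u : ℝ) :
    score p u = (max u 0) ^ (p - 1) - (max (-u) 0) ^ (p - 1) := by
  have hp' : p - 1 ≠ 0 := by linarith
  rcases lt_trichotomy u 0 with h | h | h
  · rw [max_eq_right h.le, max_eq_left (by linarith), Real.zero_rpow hp', score, abs_of_neg h,
      show p - 1 = (p - 2) + 1 by ring, Real.rpow_add_one (by linarith)]
    ring
  · simp [h, score, Real.zero_rpow hp']
  · rw [max_eq_left h.le, max_eq_right (by linarith), Real.zero_rpow hp', score, abs_of_pos h,
      show p - 1 = (p - 2) + 1 by ring, Real.rpow_add_one (by linarith)]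
    ring

lemma continuous_score (hp : 1 < p) : Continuous (score p) := by
  rw [funext (score_eq_max hp)]
  have h : 0 ≤ p - 1 := by linarith
  exact ((continuous_id.max continuous_const).rpow_const fun _ => Or.inr h).sub
    ((continuous_neg.max continuous_const).rpow_const fun _ => Or.inr h)

lemma monotone_score (hp : 1 < p) : Monotone (score p) := by
  intro a b hab
  rw [score_eq_max hp, score_eq_max hp]
  have h : 0 ≤ p - 1 := by linarith
  have h1 : (max a 0) ^ (p - 1) ≤ (max b 0) ^ (p - 1) :=
    Real.rpow_le_rpow (le_max_right _ _) (max_le_max_right _ hab) h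
  have h2 : (max (-b) 0) ^ (p - 1) ≤ (max (-a) 0) ^ (p - 1) :=
    Real.rpow_le_rpow (le_max_right _ _) (max_le_max_right _ (by linarith)) h
  linarith

lemma abs_score (hp : 1 < p) (u : ℝ) : |score p u| = |u| ^ (p - 1) := by
  rcases eq_or_ne u 0 with h | h
  · simp [h, score, Real.zero_rpow (show p - 1 ≠ 0 by linarith)]
  · rw [score, abs_mul, abs_of_nonneg (by positivity), show p - 1 = (p - 2) + 1 by ring,
      Real.rpow_add_one (by positivity)]

lemma score_sq (hp : 1 < p) (u : ℝ) : score p u ^ 2 = |u| ^ (2 * p - 2) := by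
  rw [← sq_abs, abs_score hp, ← Real.rpow_natCast, ← Real.rpow_mul (abs_nonneg u)]
  congr 1
  push_cast
  ring

lemma score_eq_sign (u : ℝ) : |u| ^ (p - 1) * Real.sign u = score p u := by
  have h : p - 1 = (p - 2) + 1 := by ring
  rcases lt_trichotomy u 0 with hu | hu | hu
  · rw [Real.sign_of_neg hu, score, h, Real.rpow_add_one (abs_pos.2 hu.ne).ne', abs_of_neg hu]; ring
  · simp [hu, score]
  · rw [Real.sign_of_pos hu, score, h, Real.rpow_add_one (by positivity), abs_of_pos hu]; ring

lemma score_of_pos {u : ℝ} (hu : 0 < u) : score p u = u ^ (p - 1) := by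
  rw [score, abs_of_pos hu, show p - 1 = (p - 2) + 1 by ring, Real.rpow_add_one hu.ne']

lemma score_mul (a b : ℝ) : score p (a * b) = |a| ^ (p - 2) * a * score p b := by
  rw [score, score, abs_mul, Real.mul_rpow (abs_nonneg _) (abs_nonneg _)]
  ring

/-- On |τ| ≤ 1/2 the base 1 - τ stays away from the singularity at 0, so the derivative of the power
is Lipschitz there. -/
lemma abs_one_sub_rpow_linearization (q : ℝ) : ∃ C : ℝ, 0 ≤ C ∧ ∀ τ : ℝ, |τ| ≤ 1 / 2 →
    |(1 - τ) ^ q - 1 + q * τ| ≤ C * |τ| ^ 2 := by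
  -- a bound for the second derivative on `[-1/2, 1/2]`
  obtain ⟨B, hB⟩ : ∃ B, ∀ s ∈ Icc (1 / 2 : ℝ) (3 / 2), |s ^ (q - 2)| ≤ B := by
    have : ContinuousOn (fun s : ℝ => s ^ (q - 2)) (Icc (1 / 2 : ℝ) (3 / 2)) := fun s hs =>
      (Real.continuousAt_rpow_const _ _ (Or.inl (by linarith [hs.1]))).continuousWithinAt
    obtain ⟨B, hB⟩ := isCompact_Icc.exists_bound_of_continuousOn this
    exact ⟨B, hB⟩
  have hB0 : 0 ≤ B := (abs_nonneg _).trans (hB 1 (by norm_num))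
  have hq : ∀ (r : ℝ) (τ : ℝ), |τ| ≤ 1 / 2 →
      HasDerivAt (fun τ : ℝ => (1 - τ) ^ r) (-(r * (1 - τ) ^ (r - 1))) τ := by
    intro r τ hτ
    have h1 : HasDerivAt (fun τ : ℝ => 1 - τ) (-1) τ := by
      simpa using (hasDerivAt_id τ).const_sub 1
    have := h1.rpow_const (p := r) (Or.inl (by rw [abs_le] at hτ; linarith [hτ.2]))
    convert! this using 1
    ring
  have hfirst : ∀ τ : ℝ, |τ| ≤ 1 / 2 → |(1 - τ) ^ (q - 1) - 1| ≤ |q - 1| * B * |τ| := by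
    intro τ hτ
    have := (convex_Icc (-(1 / 2) : ℝ) (1 / 2)).norm_image_sub_le_of_norm_hasDerivWithin_le
      (f := fun τ : ℝ => (1 - τ) ^ (q - 1)) (C := |q - 1| * B) (x := 0) (y := τ)
      (fun t ht => (hq (q - 1) t (abs_le.2 ht)).hasDerivWithinAt) (fun t ht => by
        rw [norm_neg, norm_mul, Real.norm_eq_abs, Real.norm_eq_abs,
          show q - 1 - 1 = q - 2 by ring]
        exact mul_le_mul_of_nonneg_left (hB _ ⟨by linarith [ht.2], by linarith [ht.1]⟩)
          (abs_nonneg _)) (mem_Icc.2 (by norm_num)) (mem_Icc.2 (abs_le.1 hτ))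
    simpa using this
  refine ⟨|q| * (|q - 1| * B), by positivity, fun τ hτ => ?_⟩
  have := abs_sub_linear_le_of_hasDerivAt (g := fun τ : ℝ => (1 - τ) ^ q) (x := 0)
    (g' := fun s => -(q * (1 - s) ^ (q - 1))) (r := 1 / 2) (C := |q| * (|q - 1| * B))
    (by positivity) (fun s hs => by rw [zero_add]; exact hq q s hs) (fun s hs => by
      rw [show -(q * (1 - s) ^ (q - 1)) - -(q * (1 - 0) ^ (q - 1)) =
        -(q * ((1 - s) ^ (q - 1) - 1)) by rw [sub_zero, Real.one_rpow]; ring, abs_neg, abs_mul,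
        mul_assoc]
      exact mul_le_mul_of_nonneg_left (hfirst s hs) (abs_nonneg _)) hτ
  simp only [zero_add, sub_zero, Real.one_rpow, mul_one, neg_mul, sub_neg_eq_add] at this
  rwa [sq_abs]

/-- For small τ this is Taylor's formula. For |τ| > 1/2 no cancellation is needed: the minimum is at
least 1/2, and each of the three terms is O(|τ|), except that |1 - τ|^(p-1) needs the term |τ|^(p-2)
when p > 2. -/
lemma exists_abs_score_one_sub_le (hp : 1 < p) : ∃ C : ℝ, 0 ≤ C ∧ ∀ τ : ℝ,
    |score p (1 - τ) - 1 + (p - 1) * τ| ≤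
      C * |τ| * (min 1 |τ| + if 2 < p then |τ| ^ (p - 2) else 0) := by
  obtain ⟨C₁, hC₁, h₁⟩ := abs_one_sub_rpow_linearization (p - 1)
  -- The factor 2 undoes the lower bound 1/2 for the minimum. Since |τ| > 1/2, one has |1 - τ| ≤
  -- 3|τ| and 1 ≤ 2|τ|; this gives the summands 3 (for p ≤ 2) and 2, and p - 1 is the linear term.
  set C₂ : ℝ := 2 * (3 + 2 + (p - 1)) with hC₂
  set C₃ : ℝ := 3 ^ (p - 1) with hC₃
  have hC₃0 : 0 ≤ C₃ := by positivity
  have hC₂0 : 0 ≤ C₂ := by linarith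
  refine ⟨C₁ + C₂ + C₃, by positivity, fun τ => ?_⟩
  have hif : 0 ≤ (if 2 < p then |τ| ^ (p - 2) else 0) := by split_ifs <;> positivity
  by_cases hτ : |τ| ≤ 1 / 2
  · have hpos : 0 < 1 - τ := by rw [abs_le] at hτ; linarith [hτ.2]
    rw [score_of_pos hpos]
    refine (h₁ τ hτ).trans ?_
    rw [min_eq_right (by linarith)]
    calc C₁ * |τ| ^ 2 = C₁ * |τ| * |τ| := by ring
      _ ≤ (C₁ + C₂ + C₃) * |τ| * (|τ| + if 2 < p then |τ| ^ (p - 2) else 0) := by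
        gcongr
        · linarith
        · linarith
  · push Not at hτ
    have hτ0 : 0 < |τ| := by linarith
    have hmin : 1 / 2 ≤ min 1 |τ| := le_min (by norm_num) hτ.le
    have hs : |score p (1 - τ)| ≤ (3 * |τ|) ^ (p - 1) := by
      rw [abs_score hp]
      refine Real.rpow_le_rpow (abs_nonneg _) ?_ (by linarith)
      have := abs_sub (1 : ℝ) τ
      rw [abs_one] at this
      linarith
    have htri : |score p (1 - τ) - 1 + (p - 1) * τ| ≤ (3 * |τ|) ^ (p - 1) + 2 * |τ| +
        (p - 1) * |τ| := by
      have h3 := abs_add_le (score p (1 - τ) - 1) ((p - 1) * τ)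
      have h4 := abs_sub (score p (1 - τ)) 1
      rw [abs_mul, abs_of_pos (show 0 < p - 1 by linarith)] at h3
      rw [abs_one] at h4
      linarith
    refine htri.trans ?_
    by_cases h2 : 2 < p
    · rw [if_pos h2, Real.mul_rpow (by norm_num) hτ0.le, show p - 1 = (p - 2) + 1 by ring,
        Real.rpow_add_one hτ0.ne' (p - 2), show p - 2 + 1 = p - 1 by ring, ← hC₃]
      have e1 : C₃ * (|τ| ^ (p - 2) * |τ|) ≤ (C₁ + C₂ + C₃) * |τ| * |τ| ^ (p - 2) := by
        rw [show C₃ * (|τ| ^ (p - 2) * |τ|) = C₃ * |τ| * |τ| ^ (p - 2) by ring]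
        gcongr
        linarith
      have e2 : 2 * |τ| + (p - 1) * |τ| ≤ (C₁ + C₂ + C₃) * |τ| * min 1 |τ| := by
        calc 2 * |τ| + (p - 1) * |τ| ≤ C₂ * |τ| * (1 / 2) := by rw [hC₂]; nlinarith
          _ ≤ _ := by gcongr; linarith
      rw [mul_add]
      linarith
    · rw [if_neg h2, add_zero]
      have e3 : (3 * |τ|) ^ (p - 1) ≤ 3 * |τ| := by
        have : 1 ≤ 3 * |τ| := by linarith
        calc (3 * |τ|) ^ (p - 1) ≤ (3 * |τ|) ^ (1 : ℝ) :=
              Real.rpow_le_rpow_of_exponent_le this (by linarith)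
          _ = 3 * |τ| := Real.rpow_one _
      calc _ ≤ C₂ * |τ| * (1 / 2) := by rw [hC₂]; nlinarith
        _ ≤ _ := by gcongr; linarith

/-- Linearization of the score function at a point `e`, with an explicit error bound. -/
lemma exists_abs_score_sub_le (hp : 1 < p) : ∃ C : ℝ, 0 ≤ C ∧ ∀ e t : ℝ, (p < 2 → e ≠ 0) →
    |score p (e - t) - score p e + (p - 1) * |e| ^ (p - 2) * t| ≤
      C * |t| * scoreModulus p e |t| := by
  obtain ⟨C, hC, h⟩ := exists_abs_score_one_sub_le hp
  -- The extra 1 covers e = 0 with p > 2, where the left side is exactly |t|^(p-1).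
  refine ⟨C + 1, by positivity, fun e t het => ?_⟩
  rcases eq_or_ne p 2 with rfl | hp2
  · have : score 2 (e - t) - score 2 e + (2 - 1) * |e| ^ ((2 : ℝ) - 2) * t = 0 := by
      simp [score]
      ring
    rw [this]
    simp [scoreModulus]
  rcases eq_or_ne e 0 with rfl | he
  · have h2 : 2 ≤ p := not_lt.1 fun h => het h rfl
    rcases h2.eq_or_lt with h2 | h2
    · exact absurd h2.symm hp2
    · have h0 : (0 : ℝ) ^ (p - 2) = 0 := Real.zero_rpow (by linarith)
      simp only [zero_sub, abs_zero, h0, mul_zero, zero_mul, add_zero, scoreModulus, if_pos h2, if_neg hp2,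
        zero_add]
      have : score p 0 = 0 := by simp [score]
      rw [this, sub_zero, abs_score hp, abs_neg]
      rcases eq_or_ne t 0 with rfl | ht
      · simp [Real.zero_rpow (show p - 1 ≠ 0 by linarith)]
      · rw [show p - 1 = (p - 2) + 1 by ring, Real.rpow_add_one (by positivity)]
        nlinarith [show 0 ≤ C * (|t| ^ (p - 2) * |t|) by positivity]
  -- By homogeneity of the score, the case e ≠ 0 reduces to e = 1 with increment t / e.
  · have hτ : e - t = e * (1 - t / e) := by field_simp
    have h1 : score p e = |e| ^ (p - 2) * e := rfl
    have h2 : score p (e - t) - score p e + (p - 1) * |e| ^ (p - 2) * t =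
        |e| ^ (p - 2) * e * (score p (1 - t / e) - 1 + (p - 1) * (t / e)) := by
      rw [hτ, score_mul, h1]
      field_simp
    rw [h2, abs_mul, abs_mul, abs_of_nonneg (by positivity : 0 ≤ |e| ^ (p - 2))]
    have he0 : 0 < |e| := abs_pos.2 he
    calc |e| ^ (p - 2) * |e| * |score p (1 - t / e) - 1 + (p - 1) * (t / e)|
        ≤ |e| ^ (p - 2) * |e| * (C * |t / e| *
            (min 1 |t / e| + if 2 < p then |t / e| ^ (p - 2) else 0)) := by
          gcongr
          exact h _
      _ = C * |t| * scoreModulus p e |t| := by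
          rw [scoreModulus, abs_div, if_neg hp2]
          split_ifs with h3
          · rw [Real.div_rpow (abs_nonneg _) (abs_nonneg _)]
            field_simp
          · field_simp
            ring
      _ ≤ (C + 1) * |t| * scoreModulus p e |t| := by
          have : 0 ≤ scoreModulus p e |t| := by
            rw [scoreModulus]; split_ifs <;> positivity
          gcongr
          linarith

lemma scoreModulus_nonneg {e η : ℝ} (hη : 0 ≤ η) : 0 ≤ scoreModulus p e η := by
  rw [scoreModulus]; split_ifs <;> positivity

lemma scoreModulus_mono {e η η' : ℝ} (hη : 0 ≤ η) (h : η ≤ η') :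
    scoreModulus p e η ≤ scoreModulus p e η' := by
  rw [scoreModulus, scoreModulus]
  have h1 : min 1 (η / |e|) ≤ min 1 (η' / |e|) := by gcongr
  refine add_le_add ?_ ?_
  · split_ifs
    · exact le_rfl
    · gcongr
  · split_ifs with h2
    · exact Real.rpow_le_rpow hη h (by linarith)
    · exact le_rfl

/-- The dominating function for every later limit of the modulus; it is integrable because
E|ε|^(p-2) is finite. -/
lemma scoreModulus_le {e η : ℝ} (hη : 0 ≤ η) (h1 : η ≤ 1) :
    scoreModulus p e η ≤ |e| ^ (p - 2) + 1 := by
  rw [scoreModulus]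
  have h2 : |e| ^ (p - 2) * min 1 (η / |e|) ≤ |e| ^ (p - 2) :=
    mul_le_of_le_one_right (by positivity) (min_le_left _ _)
  refine add_le_add ?_ ?_
  · split_ifs
    · positivity
    · exact h2
  · split_ifs with h3
    · exact Real.rpow_le_one hη h1 (by linarith)
    · exact zero_le_one

lemma measurable_scoreModulus (η : ℝ) : Measurable fun e => scoreModulus p e η := by
  unfold scoreModulus
  split_ifs <;> fun_prop

/-- No exception is needed at e = 0: there η / |e| is 0 by convention. -/
lemma tendsto_scoreModulus {α : Type*} {l : Filter α} {η : α → ℝ} (hη : Tendsto η l (𝓝 0))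
    (e : ℝ) : Tendsto (fun n => scoreModulus p e (η n)) l (𝓝 0) := by
  have h1 : Tendsto (fun n => |e| ^ (p - 2) * min 1 (η n / |e|)) l (𝓝 0) := by
    have := ((tendsto_const_nhds (x := (1 : ℝ))).min (hη.div_const |e|)).const_mul (|e| ^ (p - 2))
    simpa using this
  have h2 : Tendsto (fun n => if 2 < p then η n ^ (p - 2) else 0) l (𝓝 0) := by
    split_ifs with h2
    · have := (Real.continuousAt_rpow_const 0 (p - 2) (Or.inr (by linarith))).tendsto.comp hη
      rwa [Real.zero_rpow (by linarith)] at this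
    · exact tendsto_const_nhds
  have h3 : Tendsto (fun n => if p = 2 then 0 else |e| ^ (p - 2) * min 1 (η n / |e|)) l (𝓝 0) := by
    split_ifs
    · exact tendsto_const_nhds
    · exact h1
  unfold scoreModulus
  simpa only [add_zero] using h3.add h2

/-- The first order condition satisfied by minimizers of `∑ |r_i - t c_i|^p k_i`. -/
lemma sum_score_eq_zero_of_isMin (hp : 1 < p) {α : Type*} (s : Finset α) (r c k : α → ℝ)
    (h : ∀ t : ℝ, ∑ i ∈ s, |r i| ^ p * k i ≤ ∑ i ∈ s, |r i - t * c i| ^ p * k i) :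
    ∑ i ∈ s, k i * c i * score p (r i) = 0 := by
  have hd : HasDerivAt (fun t : ℝ => ∑ i ∈ s, |r i - t * c i| ^ p * k i)
      (∑ i ∈ s, (p * |r i - 0 * c i| ^ (p - 2) * (r i - 0 * c i)) * (-(1 * c i)) * k i) 0 := by
    refine HasDerivAt.fun_sum fun i _ => ?_
    have h1 : HasDerivAt (fun t : ℝ => r i - t * c i) (-(1 * c i)) 0 :=
      ((hasDerivAt_id (0 : ℝ)).mul_const (c i)).const_sub (r i)
    exact ((hasDerivAt_abs_rpow (r i - 0 * c i) hp).comp (0 : ℝ) h1).mul_const (k i)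
  have hmin : IsLocalMin (fun t : ℝ => ∑ i ∈ s, |r i - t * c i| ^ p * k i) 0 :=
    Filter.Eventually.of_forall fun t => by simpa using h t
  have h0 := hmin.hasDerivAt_eq_zero hd
  have h1 : -p * ∑ i ∈ s, k i * c i * score p (r i) = 0 := by
    rw [← h0, Finset.mul_sum]
    refine Finset.sum_congr rfl fun i _ => ?_
    simp only [zero_mul, sub_zero, score]
    ring
  exact (mul_eq_zero.1 h1).resolve_left (by linarith)

end Score

/-! ### Independence, convergence in probability, and i.i.d. samples -/

section Probability

variable {Ω : Type*} [MeasurableSpace Ω] {P : Measure Ω}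

/-- If two sequences of independent random variables are independent of each other, then the
pairs of their terms are independent. -/
lemma iIndepFun_prodMk_of_indepFun [IsProbabilityMeasure P] {S T : Type*} [MeasurableSpace S]
    [MeasurableSpace T] {ι : Type*} {X : ι → Ω → S} {Y : ι → Ω → T} (hX : ∀ i, Measurable (X i))
    (hY : ∀ i, Measurable (Y i)) (hXi : iIndepFun X P) (hYi : iIndepFun Y P)
    (h : IndepFun (fun ω i => X i ω) (fun ω i => Y i ω) P) :
    iIndepFun (fun i ω => (X i ω, Y i ω)) P := by
  have hpair : ∀ i, Measurable fun ω => (X i ω, Y i ω) := fun i => (hX i).prodMk (hY i)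
  rw [iIndepFun_iff_iIndep]
  -- Rectangles form a π-system generating the product σ-algebra, so the product formula is only
  -- needed for preimages of rectangles.
  refine iIndepSets.iIndep (fun i => (hpair i).comap_le)
    (fun i => preimage (fun ω => (X i ω, Y i ω)) ''
      image2 (· ×ˢ ·) {s : Set S | MeasurableSet s} {t : Set T | MeasurableSet t})
    (fun i => ?_) (fun i => ?_) ?_
  · have := (isPiSystem_prod (α := S) (β := T)).comap (fun ω => (X i ω, Y i ω))
    exact this
  · rw [← MeasurableSpace.comap_generateFrom, generateFrom_prod]
  · rw [iIndepSets_iff]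
    intro s F hF
    choose! G hG hGF using hF
    choose! A hA B hB hAB using hG
    simp only [mem_ofPred_eq] at hA hB
    have hF' : ∀ i ∈ s, F i = X i ⁻¹' A i ∩ Y i ⁻¹' B i := by
      intro i hi
      rw [← hGF i hi, ← hAB i hi]
      rfl
    have hone : ∀ i ∈ s, P (F i) = P (X i ⁻¹' A i) * P (Y i ⁻¹' B i) := by
      intro i hi
      have hi' : IndepFun (X i) (Y i) P := h.comp (measurable_pi_apply i) (measurable_pi_apply i)
      rw [hF' i hi, hi'.measure_inter_preimage_eq_mul _ _ (hA i hi) (hB i hi)]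
    -- Regrouping the intersection into one event for all of X and one for all of Y brings in the
    -- independence of the two sequences; the independence within each sequence then splits the
    -- factors.
    have hinter : ⋂ i ∈ s, F i =
        ((fun ω i => X i ω) ⁻¹' ⋂ i ∈ s, (fun y : ι → S => y i) ⁻¹' A i) ∩
          ((fun ω i => Y i ω) ⁻¹' ⋂ i ∈ s, (fun y : ι → T => y i) ⁻¹' B i) := by
      rw [iInter₂_congr hF']
      ext ω
      simp only [mem_iInter, mem_inter_iff, mem_preimage]
      exact ⟨fun h => ⟨fun i hi => (h i hi).1, fun i hi => (h i hi).2⟩,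
        fun h i hi => ⟨h.1 i hi, h.2 i hi⟩⟩
    rw [hinter, h.measure_inter_preimage_eq_mul _ _
      (Finset.measurableSet_biInter s fun i hi => measurable_pi_apply i (hA i hi))
      (Finset.measurableSet_biInter s fun i hi => measurable_pi_apply i (hB i hi)),
      Finset.prod_congr rfl hone, Finset.prod_mul_distrib,
      ← hXi.measure_inter_preimage_eq_mul s hA, ← hYi.measure_inter_preimage_eq_mul s hB]
    congr 2
    · ext ω; simp
    · ext ω; simp

/-- Convergence to zero in probability of a sequence of real random variables. -/
def TendstoZeroInProb (P : Measure Ω) (Z : ℕ → Ω → ℝ) : Prop :=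
  ∀ η : ℝ, 0 < η → Tendsto (fun n => P {ω | η ≤ |Z n ω|}) atTop (𝓝 0)

namespace TendstoZeroInProb

lemma of_abs_le {Z Z' : ℕ → Ω → ℝ} (h : TendstoZeroInProb P Z')
    (hZ : ∀ᶠ n in atTop, ∀ᵐ ω ∂P, |Z n ω| ≤ |Z' n ω|) : TendstoZeroInProb P Z := by
  intro η hη
  refine tendsto_of_tendsto_of_tendsto_of_le_of_le' tendsto_const_nhds (h η hη)
    (Eventually.of_forall fun _ => zero_le) ?_
  filter_upwards [hZ] with n hn
  refine measure_mono_ae ?_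
  filter_upwards [hn] with ω hω h1
  exact le_trans h1 hω

lemma add {Z Z' : ℕ → Ω → ℝ} (h : TendstoZeroInProb P Z) (h' : TendstoZeroInProb P Z') :
    TendstoZeroInProb P (fun n ω => Z n ω + Z' n ω) := by
  intro η hη
  have h0 := (h (η / 2) (half_pos hη)).add (h' (η / 2) (half_pos hη))
  rw [add_zero] at h0
  refine tendsto_of_tendsto_of_tendsto_of_le_of_le tendsto_const_nhds h0 (fun _ => zero_le)
    fun n => ?_
  refine (measure_mono fun ω hω => ?_).trans (measure_union_le _ _)
  simp only [mem_ofPred_eq, mem_union] at hω ⊢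
  by_contra! hc
  have := abs_add_le (Z n ω) (Z' n ω)
  linarith [hc.1, hc.2]

lemma const_mul {Z : ℕ → Ω → ℝ} (c : ℝ) (h : TendstoZeroInProb P Z) :
    TendstoZeroInProb P (fun n ω => c * Z n ω) := by
  intro η hη
  refine tendsto_of_tendsto_of_tendsto_of_le_of_le tendsto_const_nhds
    (h (η / (|c| + 1)) (by positivity)) (fun _ => zero_le) fun n => ?_
  refine measure_mono fun ω hω => ?_
  simp only [mem_ofPred_eq] at hω ⊢
  rw [abs_mul] at hω
  rw [div_le_iff₀ (by positivity)]
  nlinarith [abs_nonneg (Z n ω)]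

lemma abs {Z : ℕ → Ω → ℝ} (h : TendstoZeroInProb P Z) :
    TendstoZeroInProb P (fun n ω => |Z n ω|) :=
  h.of_abs_le (Eventually.of_forall fun _ => Eventually.of_forall fun _ => by simp)

lemma sum {ι : Type*} (s : Finset ι) {Z : ι → ℕ → Ω → ℝ}
    (h : ∀ j ∈ s, TendstoZeroInProb P (Z j)) :
    TendstoZeroInProb P (fun n ω => ∑ j ∈ s, Z j n ω) := by
  classical
  induction s using Finset.induction_on with
  | empty => intro η hη; simp [hη.not_ge]
  | insert j s hj ih =>
    simp only [Finset.sum_insert hj]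
    exact (h j (by simp)).add (ih fun k hk => h k (by simp [hk]))

lemma of_tendsto {c : ℕ → ℝ} (h : Tendsto c atTop (𝓝 0)) :
    TendstoZeroInProb P (fun n _ => c n) := by
  intro η hη
  refine tendsto_const_nhds.congr' ?_
  have := h.abs
  rw [abs_zero] at this
  filter_upwards [this.eventually_lt_const hη] with n hn
  simp [hn.not_ge]

lemma tendstoInMeasure {Z : ℕ → Ω → ℝ} (h : TendstoZeroInProb P Z) :
    TendstoInMeasure P Z atTop 0 := by
  rw [tendstoInMeasure_iff_norm]
  intro η hη
  simpa using h η hη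

end TendstoZeroInProb

/-- Boundedness in probability of a sequence of real random variables. -/
def BoundedInProb (P : Measure Ω) (Z : ℕ → Ω → ℝ) : Prop :=
  ∀ r : ENNReal, 0 < r → ∃ M : ℝ, ∀ᶠ n in atTop, P {ω | M ≤ |Z n ω|} ≤ r

lemma BoundedInProb.mul_tendsto_zero {Z : ℕ → Ω → ℝ} (h : BoundedInProb P Z) {c : ℕ → ℝ}
    (hc : Tendsto c atTop (𝓝 0)) : TendstoZeroInProb P (fun n ω => c n * Z n ω) := by
  intro η hη
  rw [ENNReal.tendsto_nhds_zero]
  intro r hr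
  obtain ⟨M, hM⟩ := h r hr
  have hc' : Tendsto (fun n => |c n| * |M|) atTop (𝓝 0) := by
    simpa using hc.abs.mul_const |M|
  filter_upwards [hM, hc'.eventually_lt_const hη] with n hn hcn
  refine (measure_mono fun ω hω => ?_).trans hn
  simp only [mem_ofPred_eq] at hω ⊢
  rw [abs_mul] at hω
  by_contra! hlt
  have : |c n| * |Z n ω| ≤ |c n| * |M| :=
    mul_le_mul_of_nonneg_left (hlt.le.trans (le_abs_self M)) (abs_nonneg _)
  linarith

lemma BoundedInProb.add_tendsto_zero {Z Z' : ℕ → Ω → ℝ} (h : BoundedInProb P Z)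
    (h' : TendstoZeroInProb P Z') : BoundedInProb P (fun n ω => Z n ω + Z' n ω) := by
  intro r hr
  obtain ⟨M, hM⟩ := h (r / 2) (ENNReal.half_pos hr.ne')
  refine ⟨M + 1, ?_⟩
  filter_upwards [hM, ENNReal.tendsto_nhds_zero.1 (h' 1 one_pos) (r / 2)
    (ENNReal.half_pos hr.ne')] with n h1 h2
  calc P {ω | M + 1 ≤ |Z n ω + Z' n ω|} ≤ P ({ω | M ≤ |Z n ω|} ∪ {ω | 1 ≤ |Z' n ω|}) := by
        refine measure_mono fun ω hω => ?_
        simp only [mem_ofPred_eq, mem_union] at hω ⊢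
        by_contra! hc
        have := abs_add_le (Z n ω) (Z' n ω)
        linarith [hc.1, hc.2]
    _ ≤ r / 2 + r / 2 := (measure_union_le _ _).trans (add_le_add h1 h2)
    _ = r := ENNReal.add_halves r

/-- `U` is a sequence of independent random variables with common law `L`. -/
structure IsIIDSample {S : Type*} [MeasurableSpace S] (P : Measure Ω) (U : ℕ → Ω → S)
    (L : Measure S) : Prop where
  measurable : ∀ i, Measurable (U i)
  indep : iIndepFun U P
  law : ∀ i, P.map (U i) = L

namespace IsIIDSample

variable {S : Type*} [MeasurableSpace S] {U : ℕ → Ω → S} {L : Measure S}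

lemma map {S' : Type*} [MeasurableSpace S'] (h : IsIIDSample P U L) {φ : S → S'}
    (hφ : Measurable φ) : IsIIDSample P (fun i ω => φ (U i ω)) (L.map φ) where
  measurable i := hφ.comp (h.measurable i)
  indep := h.indep.comp (fun _ => φ) fun _ => hφ
  law i := by
    rw [← h.law i, Measure.map_map hφ (h.measurable i)]
    rfl

/-- Markov's inequality, without any use of independence. -/
lemma measure_le_abs_sum_le_lintegral (h : IsIIDSample P U L) {g : S → ℝ} (hg : Measurable g)
    {η : ℝ} (hη : 0 < η) (n : ℕ) :
    P {ω | η ≤ |∑ i ∈ Finset.range n, g (U i ω)|} ≤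
      (n * ∫⁻ q, ‖g q‖ₑ ∂L) / ENNReal.ofReal η := by
  have hηne : ENNReal.ofReal η ≠ 0 := by simpa using hη
  rw [ENNReal.le_div_iff_mul_le (Or.inl hηne) (Or.inl ENNReal.ofReal_ne_top), mul_comm]
  have hm : ∀ i, Measurable fun ω => g (U i ω) := fun i => hg.comp (h.measurable i)
  calc ENNReal.ofReal η * P {ω | η ≤ |∑ i ∈ Finset.range n, g (U i ω)|}
      ≤ ENNReal.ofReal η *
          P {ω | ENNReal.ofReal η ≤ ‖∑ i ∈ Finset.range n, g (U i ω)‖ₑ} := by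
        gcongr with ω
        intro hω
        rw [Real.enorm_eq_ofReal_abs]
        exact ENNReal.ofReal_le_ofReal hω
    _ ≤ ∫⁻ ω, ‖∑ i ∈ Finset.range n, g (U i ω)‖ₑ ∂P :=
        mul_meas_ge_le_lintegral₀
          (Finset.measurable_fun_sum _ fun i _ => hm i).enorm.aemeasurable _
    _ ≤ ∫⁻ ω, ∑ i ∈ Finset.range n, ‖g (U i ω)‖ₑ ∂P := lintegral_mono fun ω => enorm_sum_le _ _
    _ = ∑ i ∈ Finset.range n, ∫⁻ ω, ‖g (U i ω)‖ₑ ∂P :=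
        lintegral_finsetSum _ fun i _ => (hm i).enorm
    _ = ∑ i ∈ Finset.range n, ∫⁻ q, ‖g q‖ₑ ∂L := by
        refine Finset.sum_congr rfl fun i _ => ?_
        rw [← h.law i, lintegral_map hg.enorm (h.measurable i)]
    _ = n * ∫⁻ q, ‖g q‖ₑ ∂L := by simp

/-- Chebyshev's inequality: variances add by independence, and each is at most the second moment. -/
lemma measure_le_abs_sum_sub_le [IsProbabilityMeasure P] (h : IsIIDSample P U L) {g : S → ℝ}
    (hg : Measurable g) (hg2 : Integrable (fun q => g q ^ 2) L) {η : ℝ} (hη : 0 < η) (n : ℕ) :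
    P {ω | η ≤ |∑ i ∈ Finset.range n, g (U i ω) - n * ∫ q, g q ∂L|} ≤
      ENNReal.ofReal ((n * ∫ q, g q ^ 2 ∂L) / η ^ 2) := by
  have hm : ∀ i, Measurable fun ω => g (U i ω) := fun i => hg.comp (h.measurable i)
  have hL2 : ∀ i, MemLp (fun ω => g (U i ω)) 2 P := by
    intro i
    rw [memLp_two_iff_integrable_sq (hm i).aestronglyMeasurable]
    rw [← h.law i] at hg2
    exact (integrable_map_measure (by fun_prop) (h.measurable i).aemeasurable).1 hg2
  have hint : ∀ i, ∫ ω, g (U i ω) ∂P = ∫ q, g q ∂L := by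
    intro i
    rw [← h.law i, integral_map (h.measurable i).aemeasurable (by fun_prop)]
  have hint2 : ∀ i, ∫ ω, g (U i ω) ^ 2 ∂P = ∫ q, g q ^ 2 ∂L := by
    intro i
    rw [← h.law i, integral_map (h.measurable i).aemeasurable (by fun_prop)]
  have hmean : ∫ ω, ∑ i ∈ Finset.range n, g (U i ω) ∂P = n * ∫ q, g q ∂L := by
    rw [integral_finsetSum _ fun i _ => (hL2 i).integrable one_le_two]
    simp [hint]
  have hvar : variance (fun ω => ∑ i ∈ Finset.range n, g (U i ω)) P ≤ n * ∫ q, g q ^ 2 ∂L := by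
    have h1 := IndepFun.variance_sum (μ := P) (s := Finset.range n)
      (X := fun i ω => g (U i ω)) (fun i _ => hL2 i)
      (fun i _ j _ hij => (h.indep.indepFun hij).comp hg hg)
    have h2 : (fun ω => ∑ i ∈ Finset.range n, g (U i ω)) =
        ∑ i ∈ Finset.range n, fun ω => g (U i ω) := by ext; simp
    rw [h2, h1]
    calc _ ≤ ∑ i ∈ Finset.range n, ∫ q, g q ^ 2 ∂L := by
          refine Finset.sum_le_sum fun i _ => ?_
          rw [← hint2 i]
          exact variance_le_expectation_sq (hm i).aestronglyMeasurable
      _ = _ := by simp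
  have h3 := meas_ge_le_variance_div_sq (μ := P)
    (X := fun ω => ∑ i ∈ Finset.range n, g (U i ω)) (memLp_finsetSum _ fun i _ => hL2 i) hη
  rw [hmean] at h3
  refine h3.trans (ENNReal.ofReal_le_ofReal ?_)
  gcongr

lemma charFun_map_sum (h : IsIIDSample P U L) [IsProbabilityMeasure P] {g : S → ℝ}
    (hg : Measurable g) (n : ℕ) (t : ℝ) :
    charFun (P.map fun ω => ∑ i ∈ Finset.range n, g (U i ω)) t =
      (∫ q, Complex.exp (t * g q * Complex.I) ∂L) ^ n := by
  have hm : ∀ i, Measurable fun ω => g (U i ω) := fun i => hg.comp (h.measurable i)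
  have hi : iIndepFun (fun i ω => g (U i ω)) P := h.indep.comp (fun _ => g) fun _ => hg
  rw [(hi.restrict _).charFun_map_fun_finsetSum_eq_prod fun i _ => (hm i).aemeasurable]
  have : ∀ i, charFun (P.map fun ω => g (U i ω)) t =
      ∫ q, Complex.exp (t * g q * Complex.I) ∂L := by
    intro i
    have : P.map (fun ω => g (U i ω)) = L.map g := by
      rw [← h.law i, Measure.map_map hg (h.measurable i)]; rfl
    rw [this, charFun_apply_real, integral_map hg.aemeasurable (by fun_prop)]
  simp [this]

end IsIIDSample

end Probability

/-! ### The rescaled design: local averages, laws of large numbers, central limit theorem -/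

/-- The law of `((X - x) / h, e)` when `X` has density `f` and `e` is independent of `X` with
law `μ`. -/
noncomputable def localLaw (f : ℝ → ℝ) (x h : ℝ) (μ : Measure ℝ) : Measure (ℝ × ℝ) :=
  (volume.prod μ).withDensity fun q => ENNReal.ofReal (h * f (x + h * q.1))

/-- The substitution z = x + h u, whose Jacobian is the factor h in the density. -/
lemma map_prod_eq_localLaw {f : ℝ → ℝ} (hf : Measurable f) (x : ℝ) {h : ℝ} (hh : 0 < h)
    (μ : Measure ℝ) [SFinite μ] :
    ((volume.withDensity fun z => ENNReal.ofReal (f z)).prod μ).map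
      (fun q => ((q.1 - x) / h, q.2)) = localLaw f x h μ := by
  have hvol : (volume : Measure ℝ) =
      ENNReal.ofReal h • volume.map (fun u => x + h * u) := by
    have h1 : volume.map (fun u : ℝ => x + h * u) =
        (volume.map (fun u : ℝ => h * u)).map (fun u => x + u) := by
      rw [Measure.map_map (by fun_prop) (by fun_prop)]
      rfl
    rw [h1, Real.map_volume_mul_left hh.ne', Measure.map_smul, map_add_left_eq_self, smul_smul,
      abs_of_pos (inv_pos.2 hh), ← ENNReal.ofReal_mul hh.le, mul_inv_cancel₀ hh.ne',
      ENNReal.ofReal_one, one_smul]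
  have hmap : (volume.withDensity fun z => ENNReal.ofReal (f z)).map (fun z => (z - x) / h) =
      volume.withDensity fun u => ENNReal.ofReal (h * f (x + h * u)) := by
    refine Measure.ext_of_lintegral _ fun φ hφ => ?_
    rw [lintegral_map hφ (by fun_prop), lintegral_withDensity_eq_lintegral_mul _ (by fun_prop)
      (by fun_prop), lintegral_withDensity_eq_lintegral_mul _ (by fun_prop) hφ]
    conv_lhs => rw [hvol]
    rw [lintegral_smul_measure, lintegral_map (by fun_prop) (by fun_prop), smul_eq_mul,
      ← lintegral_const_mul _ (by fun_prop)]
    refine lintegral_congr fun u => ?_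
    have : (x + h * u - x) / h = u := by field_simp; ring
    simp only [Pi.mul_apply, this]
    rw [ENNReal.ofReal_mul hh.le, mul_assoc]
  have := Measure.map_prod_map (volume.withDensity fun z => ENNReal.ofReal (f z)) μ
    (f := fun z => (z - x) / h) (g := fun e : ℝ => e) (by fun_prop) (by fun_prop)
  rw [localLaw, ← prod_withDensity_left (μ := volume) (ν := μ)
    (f := fun u => ENNReal.ofReal (h * f (x + h * u))) (by fun_prop), ← hmap]
  rw [Measure.map_id'] at this
  rw [this]
  rfl

/-- The rows `V n` are samples of `((X - x) / h n, e)`, where `X` has a density that is continuous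
at `x` and `e` is independent of `X` with law `μ`. -/
structure IsLocalSample {Ω : Type*} [MeasurableSpace Ω] (P : Measure Ω) (f : ℝ → ℝ) (x : ℝ)
    (h : ℕ → ℝ) (μ : Measure ℝ) (V : ℕ → ℕ → Ω → ℝ × ℝ) : Prop where
  measurable : Measurable f
  nonneg : ∀ z, 0 ≤ f z
  continuousAt : ContinuousAt f x
  pos : ∀ n, 0 < h n
  tendsto_zero : Tendsto h atTop (𝓝 0)
  mul_tendsto_top : Tendsto (fun n : ℕ => (n : ℝ) * h n) atTop atTop
  sample : ∀ n, IsIIDSample P (V n) (localLaw f x (h n) μ)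

namespace IsLocalSample

variable {Ω : Type*} [MeasurableSpace Ω] {P : Measure Ω} {f : ℝ → ℝ} {x : ℝ}
  {h : ℕ → ℝ} {μ : Measure ℝ} {V : ℕ → ℕ → Ω → ℝ × ℝ}

/-- Kernels vanish for |u| > 1, so only a shrinking neighbourhood of x is seen, on which f is
bounded by continuity. -/
lemma eventually_density_le (H : IsLocalSample P f x h μ V) :
    ∀ᶠ n in atTop, ∀ u : ℝ, |u| ≤ 1 → f (x + h n * u) ≤ f x + 1 := by
  have h1 : ∀ᶠ z in 𝓝 x, f z < f x + 1 :=
    H.continuousAt.eventually_lt_const (lt_add_one _)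
  obtain ⟨r, hr, hball⟩ := Metric.eventually_nhds_iff.1 h1
  filter_upwards [H.tendsto_zero.eventually_lt_const hr] with n hn u hu
  refine (hball ?_).le
  rw [Real.dist_eq, add_sub_cancel_left, abs_mul, abs_of_pos (H.pos n)]
  nlinarith [H.pos n, abs_nonneg u]

lemma integral_localLaw (H : IsLocalSample P f x h μ V) {E : Type*} [NormedAddCommGroup E]
    [NormedSpace ℝ E] (g : ℝ × ℝ → E) (n : ℕ) :
    (h n)⁻¹ • ∫ q, g q ∂localLaw f x (h n) μ =
      ∫ q, f (x + h n * q.1) • g q ∂volume.prod μ := by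
  have hm := H.measurable
  rw [localLaw, integral_withDensity_eq_integral_toReal_smul (by fun_prop) (by simp),
    ← integral_smul]
  refine integral_congr_ae (Eventually.of_forall fun q => ?_)
  simp only
  rw [ENNReal.toReal_ofReal (mul_nonneg (H.pos n).le (H.nonneg _)), smul_smul, ← mul_assoc,
    inv_mul_cancel₀ (H.pos n).ne', one_mul]

lemma eventually_integrable (H : IsLocalSample P f x h μ V) {E : Type*} [NormedAddCommGroup E]
    [NormedSpace ℝ E] :
    ∀ᶠ n in atTop, ∀ g : ℝ × ℝ → E, (∀ q, 1 < |q.1| → g q = 0) →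
      Integrable g (volume.prod μ) → Integrable g (localLaw f x (h n) μ) := by
  have hm := H.measurable
  filter_upwards [H.eventually_density_le] with n hn g hg hgi
  rw [localLaw, integrable_withDensity_iff_integrable_smul' (by fun_prop) (by simp)]
  refine (hgi.norm.const_mul (h n * (f x + 1))).mono' ?_ (Eventually.of_forall fun q => ?_)
  · exact AEStronglyMeasurable.smul (Measurable.aestronglyMeasurable (by fun_prop)) hgi.aestronglyMeasurable
  · rw [ENNReal.toReal_ofReal (mul_nonneg (H.pos n).le (H.nonneg _)), norm_smul,
      Real.norm_of_nonneg (mul_nonneg (H.pos n).le (H.nonneg _))]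
    by_cases hq : 1 < |q.1|
    · simp [hg q hq]
    · gcongr
      · exact (H.pos n).le
      · exact hn _ (not_lt.1 hq)

/-- Averages over shrinking neighbourhoods of `x` converge to integrals against `f x`. -/
theorem tendsto_integral (H : IsLocalSample P f x h μ V) {E : Type*} [NormedAddCommGroup E]
    [NormedSpace ℝ E] {g : ℕ → ℝ × ℝ → E} {g' : ℝ × ℝ → E} {G : ℝ × ℝ → ℝ}
    (hgm : ∀ n, AEStronglyMeasurable (g n) (volume.prod μ)) (hG : Integrable G (volume.prod μ))
    (hbound : ∀ᶠ n in atTop, ∀ᵐ q ∂volume.prod μ, ‖g n q‖ ≤ G q)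
    (hsupp : ∀ n q, 1 < |q.1| → g n q = 0)
    (hlim : ∀ᵐ q ∂volume.prod μ, Tendsto (fun n => g n q) atTop (𝓝 (g' q))) :
    Tendsto (fun n => (h n)⁻¹ • ∫ q, g n q ∂localLaw f x (h n) μ) atTop
      (𝓝 (f x • ∫ q, g' q ∂volume.prod μ)) := by
  have hm := H.measurable
  simp_rw [H.integral_localLaw]
  rw [← integral_smul]
  refine tendsto_integral_filter_of_dominated_convergence (fun q => (f x + 1) * G q)
    (Eventually.of_forall fun n => AEStronglyMeasurable.smul
      (Measurable.aestronglyMeasurable (by fun_prop)) (hgm n)) ?_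
    (hG.const_mul _) ?_
  · filter_upwards [hbound, H.eventually_density_le] with n hn hfn
    filter_upwards [hn] with q hq
    rw [norm_smul, Real.norm_of_nonneg (H.nonneg _)]
    have hG0 : 0 ≤ G q := (norm_nonneg _).trans hq
    by_cases hq1 : 1 < |q.1|
    · rw [hsupp n q hq1, norm_zero, mul_zero]
      have := H.nonneg x
      positivity
    · exact mul_le_mul (hfn _ (not_lt.1 hq1)) hq (norm_nonneg _)
        (by have := H.nonneg x; linarith)
  · filter_upwards [hlim] with q hq
    refine Tendsto.smul (H.continuousAt.tendsto.comp ?_) hq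
    simpa using (H.tendsto_zero.mul_const q.1).const_add x

/-- Brings the expectation of a sum of n terms into the form h⁻¹ ∫ to which `tendsto_integral`
applies. -/
lemma natCast_mul_integral (H : IsLocalSample P f x h μ V) {E : Type*} [NormedAddCommGroup E]
    [NormedSpace ℝ E] (g : ℝ × ℝ → E) (n : ℕ) :
    (n : ℝ) • ∫ q, g q ∂localLaw f x (h n) μ =
      (h n)⁻¹ • ∫ q, ((n : ℝ) * h n) • g q ∂localLaw f x (h n) μ := by
  rw [integral_smul, smul_smul]
  congr 1
  field_simp [(H.pos n).ne']

/-- A law of large numbers in `L¹` with limit zero. -/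
lemma tendstoZeroInProb_of_lintegral (H : IsLocalSample P f x h μ V) {g : ℕ → ℝ × ℝ → ℝ}
    (hg : ∀ n, Measurable (g n))
    (hlim : Tendsto (fun n : ℕ => (n : ENNReal) * ∫⁻ q, ‖g n q‖ₑ ∂localLaw f x (h n) μ) atTop
      (𝓝 0)) :
    TendstoZeroInProb P fun n ω => ∑ i ∈ Finset.range n, g n (V n i ω) := by
  intro η hη
  have h0 := ENNReal.Tendsto.div_const hlim (b := ENNReal.ofReal η) (Or.inr (by simpa using hη))
  rw [ENNReal.zero_div] at h0
  exact tendsto_of_tendsto_of_tendsto_of_le_of_le tendsto_const_nhds h0 (fun _ => zero_le)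
    fun n => (H.sample n).measure_le_abs_sum_le_lintegral (hg n) hη n

/-- A law of large numbers in `L¹` with limit zero, in dominated form. -/
lemma tendstoZeroInProb_of_dominated (H : IsLocalSample P f x h μ V) {k : ℕ → ℝ × ℝ → ℝ}
    {G : ℝ × ℝ → ℝ} (hk : ∀ n, Measurable (k n)) (hG : Integrable G (volume.prod μ))
    (hbound : ∀ᶠ n in atTop, ∀ᵐ q ∂volume.prod μ, |k n q| ≤ G q)
    (hsupp : ∀ n q, 1 < |q.1| → k n q = 0)
    (hlim : ∀ᵐ q ∂volume.prod μ, Tendsto (fun n => k n q) atTop (𝓝 0)) :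
    TendstoZeroInProb P
      fun n ω => ∑ i ∈ Finset.range n, ((n : ℝ) * h n)⁻¹ * k n (V n i ω) := by
  refine H.tendstoZeroInProb_of_lintegral (g := fun n q => ((n : ℝ) * h n)⁻¹ * k n q)
    (fun n => (hk n).const_mul _) ?_
  have h1 := H.tendsto_integral (g := fun n q => |k n q|) (g' := fun _ => (0 : ℝ))
    (fun n => (hk n).norm.aestronglyMeasurable) hG (by simpa using hbound)
    (fun n q hq => by simp [hsupp n q hq]) (by
      filter_upwards [hlim] with q hq
      simpa using hq.abs)
  simp only [integral_zero, smul_zero] at h1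
  have h2 := ENNReal.tendsto_ofReal h1
  rw [ENNReal.ofReal_zero] at h2
  refine h2.congr' ?_
  filter_upwards [H.eventually_integrable (E := ℝ), hbound,
    H.mul_tendsto_top.eventually_gt_atTop 0] with n hn hb hN
  have hint : Integrable (k n) (localLaw f x (h n) μ) :=
    hn _ (hsupp n) (hG.mono' (hk n).aestronglyMeasurable (by simpa using hb))
  have hint' : Integrable (fun q => ((n : ℝ) * h n)⁻¹ * k n q) (localLaw f x (h n) μ) :=
    hint.const_mul _
  rw [← ofReal_integral_norm_eq_lintegral_enorm hint',
    ← ENNReal.ofReal_natCast, ← ENNReal.ofReal_mul (by positivity)]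
  congr 1
  have hn0 : (n : ℝ) ≠ 0 := fun h0 => by rw [h0, zero_mul] at hN; exact lt_irrefl _ hN
  have : ∀ q, ‖((n : ℝ) * h n)⁻¹ * k n q‖ = ((n : ℝ) * h n)⁻¹ * |k n q| := fun q => by
    rw [norm_mul, Real.norm_of_nonneg (inv_nonneg.2 hN.le), Real.norm_eq_abs]
  simp_rw [this, integral_const_mul, smul_eq_mul]
  have := (H.pos n).ne'
  field_simp

/-- A law of large numbers in `L²`. -/
lemma tendstoZeroInProb_of_sq_dominated [IsProbabilityMeasure P] (H : IsLocalSample P f x h μ V)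
    {g : ℕ → ℝ × ℝ → ℝ} {G : ℝ × ℝ → ℝ} {c : ℝ} (hg : ∀ n, Measurable (g n))
    (hG : Integrable G (volume.prod μ))
    (hbound : ∀ᶠ n : ℕ in atTop, ∀ᵐ q ∂volume.prod μ, (n : ℝ) * h n * g n q ^ 2 ≤ G q)
    (hsupp : ∀ n q, 1 < |q.1| → g n q = 0)
    (hlim : ∀ᵐ q ∂volume.prod μ,
      Tendsto (fun n : ℕ => (n : ℝ) * h n * g n q ^ 2) atTop (𝓝 0))
    (hmean : Tendsto (fun n : ℕ => (n : ℝ) * ∫ q, g n q ∂localLaw f x (h n) μ) atTop (𝓝 c)) :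
    TendstoZeroInProb P fun n ω => ∑ i ∈ Finset.range n, g n (V n i ω) - c := by
  have h1 := H.tendsto_integral (g := fun (n : ℕ) q => (n : ℝ) * h n * g n q ^ 2)
    (g' := fun _ => (0 : ℝ)) (fun n => by have := hg n; fun_prop) hG (by
      filter_upwards [hbound] with n hn
      filter_upwards [hn] with q hq
      rwa [Real.norm_of_nonneg (by have := (H.pos n).le; positivity)])
    (fun n q hq => by simp [hsupp n q hq]) hlim
  simp only [integral_zero, smul_zero] at h1
  have hsum : TendstoZeroInProb P fun n ω =>
      ∑ i ∈ Finset.range n, g n (V n i ω) - n * ∫ q, g n q ∂localLaw f x (h n) μ := by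
    intro η hη
    have h2 := ENNReal.tendsto_ofReal (h1.div_const (η ^ 2))
    rw [zero_div, ENNReal.ofReal_zero] at h2
    refine tendsto_of_tendsto_of_tendsto_of_le_of_le' tendsto_const_nhds h2
      (Eventually.of_forall fun _ => zero_le) ?_
    filter_upwards [H.eventually_integrable (E := ℝ), hbound,
      H.mul_tendsto_top.eventually_gt_atTop 0] with n hn hb hN
    have hint : Integrable (fun q => (n : ℝ) * h n * g n q ^ 2) (localLaw f x (h n) μ) := by
      refine hn _ (fun q hq => by simp [hsupp n q hq]) (hG.mono' (by have := hg n; fun_prop) ?_)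
      filter_upwards [hb] with q hq
      rwa [Real.norm_of_nonneg (by positivity)]
    have hint2 : Integrable (fun q => g n q ^ 2) (localLaw f x (h n) μ) := by
      refine (hint.const_mul ((n : ℝ) * h n)⁻¹).congr (Eventually.of_forall fun q => ?_)
      simp only
      rw [← mul_assoc, inv_mul_cancel₀ hN.ne', one_mul]
    refine ((H.sample n).measure_le_abs_sum_sub_le (hg n) hint2 hη n).trans
      (ENNReal.ofReal_le_ofReal (le_of_eq ?_))
    congr 1
    have := H.natCast_mul_integral (fun q => g n q ^ 2) n
    simpa only [smul_eq_mul] using this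
  have hc : Tendsto (fun n : ℕ => (n : ℝ) * ∫ q, g n q ∂localLaw f x (h n) μ - c) atTop
      (𝓝 0) := by
    simpa using hmean.sub_const c
  have := hsum.add (TendstoZeroInProb.of_tendsto hc)
  refine this.of_abs_le (Eventually.of_forall fun n => Eventually.of_forall fun ω => le_of_eq ?_)
  congr 1
  ring

variable {κ s w : ℝ → ℝ}

/-- The law of large numbers for kernel averages. -/
theorem tendstoZeroInProb_average [IsProbabilityMeasure P] [SFinite μ]
    (H : IsLocalSample P f x h μ V) (hκ : Measurable κ) (hκs : ∀ u, 1 < |u| → κ u = 0)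
    (hκ1 : Integrable κ) (hκ2 : Integrable fun u => κ u ^ 2) (hw : Measurable w)
    (hw1 : Integrable w μ) :
    TendstoZeroInProb P fun n ω =>
      ((n : ℝ) * h n)⁻¹ * ∑ i ∈ Finset.range n, κ (V n i ω).1 * w (V n i ω).2 -
        f x * ((∫ u, κ u) * ∫ e, w e ∂μ) := by
  -- Only a first moment of w is available, so w is truncated at √(nh). The truncated part obeys the
  -- L² law, since its square divided by nh is at most |w| and tends to 0. The rest vanishes in L¹.
  set B : ℕ → ℝ := fun n => √((n : ℝ) * h n) with hB
  have hBtop : Tendsto B atTop atTop := Real.tendsto_sqrt_atTop.comp H.mul_tendsto_top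
  have hBinv : Tendsto (fun n => (B n)⁻¹) atTop (𝓝 0) := tendsto_inv_atTop_zero.comp hBtop
  set wt : ℕ → ℝ → ℝ := fun n => {e | |w e| ≤ B n}.indicator w with hwt
  have hset : ∀ n, MeasurableSet {e | |w e| ≤ B n} := fun n =>
    measurableSet_le hw.norm measurable_const
  have hwtm : ∀ n, Measurable (wt n) := fun n => hw.indicator (hset n)
  have hwt_le : ∀ n e, |wt n e| ≤ |w e| := fun n e => by
    simp only [hwt, indicator]; split_ifs <;> simp
  have hwt_lim : ∀ e, ∀ᶠ n in atTop, wt n e = w e := fun e => by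
    filter_upwards [hBtop.eventually_ge_atTop |w e|] with n hn
    exact indicator_of_mem (s := {e | |w e| ≤ B n}) hn w
  have hG1 : Integrable (fun q : ℝ × ℝ => |κ q.1| * |w q.2|) (volume.prod μ) :=
    hκ1.norm.mul_prod hw1.norm
  have hG2 : Integrable (fun q : ℝ × ℝ => κ q.1 ^ 2 * |w q.2|) (volume.prod μ) :=
    hκ2.mul_prod hw1.norm
  have hmain := H.tendstoZeroInProb_of_sq_dominated
    (g := fun n q => ((n : ℝ) * h n)⁻¹ * (κ q.1 * wt n q.2))
    (G := fun q => κ q.1 ^ 2 * |w q.2|) (c := f x * ((∫ u, κ u) * ∫ e, w e ∂μ))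
    (fun n => by have := hwtm n; fun_prop) hG2 ?_ (fun n q hq => by simp [hκs _ hq]) ?_ ?_
  · have hrest := H.tendstoZeroInProb_of_dominated (k := fun n q => κ q.1 * (w q.2 - wt n q.2))
      (G := fun q => 2 * (|κ q.1| * |w q.2|)) (fun n => by have := hwtm n; fun_prop)
      (hG1.const_mul 2) (Eventually.of_forall fun n => Eventually.of_forall fun q => by
        rw [abs_mul]
        have := abs_sub (w q.2) (wt n q.2)
        nlinarith [abs_nonneg (κ q.1), hwt_le n q.2]) (fun n q hq => by simp [hκs _ hq])
      (Eventually.of_forall fun q => tendsto_const_nhds.congr' (by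
        filter_upwards [hwt_lim q.2] with n hn
        simp [hn]))
    refine (hmain.add hrest).of_abs_le
      (Eventually.of_forall fun n => Eventually.of_forall fun ω => le_of_eq ?_)
    congr 1
    rw [Finset.mul_sum, sub_add_eq_add_sub, ← Finset.sum_add_distrib]
    congr 1
    refine Finset.sum_congr rfl fun i _ => ?_
    ring
  · filter_upwards [H.mul_tendsto_top.eventually_ge_atTop 1] with n hn
    refine Eventually.of_forall fun q => ?_
    have hN : 0 < (n : ℝ) * h n := by linarith
    have hB1 : 1 ≤ B n := Real.one_le_sqrt.2 hn
    have hBN : B n ^ 2 = (n : ℝ) * h n := Real.sq_sqrt hN.le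
    -- Once nh ≥ 1, |w| ≤ B implies |w| ≤ B² = nh, hence w² ≤ nh |w|.
    have hwB : wt n q.2 ^ 2 ≤ (n : ℝ) * h n * |w q.2| := by
      simp only [hwt, indicator]
      split_ifs with h1
      · have h1' : |w q.2| ≤ B n := h1
        rw [← sq_abs, ← hBN]
        have h2 : |w q.2| ≤ B n ^ 2 := by nlinarith
        nlinarith [abs_nonneg (w q.2)]
      · simp; positivity
    have : (n : ℝ) * h n * (((n : ℝ) * h n)⁻¹ * (κ q.1 * wt n q.2)) ^ 2 =
        κ q.1 ^ 2 * (((n : ℝ) * h n)⁻¹ * wt n q.2 ^ 2) := by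
      generalize (n : ℝ) * h n = N at *
      field_simp
    rw [this]
    gcongr
    rwa [inv_mul_le_iff₀ hN]
  · refine Eventually.of_forall fun q => ?_
    have h1 : Tendsto (fun n : ℕ => ((n : ℝ) * h n)⁻¹ * (κ q.1 * w q.2) ^ 2) atTop (𝓝 0) := by
      simpa using (tendsto_inv_atTop_zero.comp H.mul_tendsto_top).mul_const ((κ q.1 * w q.2) ^ 2)
    refine h1.congr' ?_
    filter_upwards [hwt_lim q.2, H.mul_tendsto_top.eventually_gt_atTop 0] with n hn hN
    rw [hn]
    generalize (n : ℝ) * h n = N at *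
    field_simp
  · have h1 := H.tendsto_integral (g := fun n q => κ q.1 * wt n q.2)
      (g' := fun q => κ q.1 * w q.2) (G := fun q => |κ q.1| * |w q.2|)
      (fun n => by have := hwtm n; fun_prop) hG1
      (Eventually.of_forall fun n => Eventually.of_forall fun q => by
        rw [norm_mul]
        exact mul_le_mul_of_nonneg_left (hwt_le n q.2) (abs_nonneg _))
      (fun n q hq => by simp [hκs _ hq])
      (Eventually.of_forall fun q => tendsto_const_nhds.congr' (by
        filter_upwards [hwt_lim q.2] with n hn
        simp [hn]))
    rw [integral_prod_mul] at h1
    simp only [smul_eq_mul] at h1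
    refine h1.congr' ?_
    filter_upwards [H.mul_tendsto_top.eventually_gt_atTop 0] with n hN
    have hn0 : (n : ℝ) ≠ 0 := fun h0 => by rw [h0, zero_mul] at hN; exact lt_irrefl _ hN
    have := (H.pos n).ne'
    rw [integral_const_mul]
    field_simp

/-- The error integrates out first by Fubini, so the centering is exact at every n and no smoothness
of f enters. -/
lemma integral_mul_eq_zero [SFinite μ] (H : IsLocalSample P f x h μ V) (hs0 : ∫ e, s e ∂μ = 0)
    (n : ℕ) : ∫ q, κ q.1 * s q.2 ∂localLaw f x (h n) μ = 0 := by
  have h1 := H.integral_localLaw (fun q => κ q.1 * s q.2) n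
  simp only [smul_eq_mul, ← mul_assoc] at h1
  rw [integral_prod_mul (fun u => f (x + h n * u) * κ u) s, hs0, mul_zero] at h1
  exact (mul_eq_zero.1 h1).resolve_left (inv_ne_zero (H.pos n).ne')

/-- By exact centering only the variance matters; it converges, and Chebyshev's inequality gives
tightness. -/
lemma boundedInProb_sum [IsProbabilityMeasure P] [SFinite μ] (H : IsLocalSample P f x h μ V)
    (hκ : Measurable κ) (hκs : ∀ u, 1 < |u| → κ u = 0) (hκ2 : Integrable fun u => κ u ^ 2)
    (hs : Measurable s) (hs2 : Integrable (fun e => s e ^ 2) μ) (hs0 : ∫ e, s e ∂μ = 0) :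
    BoundedInProb P fun n ω =>
      (√((n : ℝ) * h n))⁻¹ * ∑ i ∈ Finset.range n, κ (V n i ω).1 * s (V n i ω).2 := by
  have hG : Integrable (fun q : ℝ × ℝ => κ q.1 ^ 2 * s q.2 ^ 2) (volume.prod μ) :=
    hκ2.mul_prod hs2
  have h1 := H.tendsto_integral (g := fun _ q => κ q.1 ^ 2 * s q.2 ^ 2)
    (fun _ => by fun_prop) hG
    (Eventually.of_forall fun _ => Eventually.of_forall fun q => by
      rw [Real.norm_of_nonneg (by positivity)])
    (fun n q hq => by simp [hκs _ hq]) (Eventually.of_forall fun q => tendsto_const_nhds)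
  set c := f x • ∫ q, κ q.1 ^ 2 * s q.2 ^ 2 ∂volume.prod μ with hc
  have hc0 : 0 ≤ c := by
    rw [hc, smul_eq_mul]
    exact mul_nonneg (H.nonneg x) (integral_nonneg fun q => by positivity)
  intro r hr
  have hM : Tendsto (fun M : ℝ => ENNReal.ofReal ((c + 1) / M ^ 2)) atTop (𝓝 0) := by
    have := ENNReal.tendsto_ofReal ((tendsto_const_nhds (x := c + 1)).div_atTop
      (tendsto_pow_atTop (α := ℝ) two_ne_zero))
    simpa using this
  obtain ⟨M, hMr, hM0⟩ := ((ENNReal.tendsto_nhds_zero.1 hM r hr).and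
    (eventually_gt_atTop (0 : ℝ))).exists
  refine ⟨M, ?_⟩
  filter_upwards [h1.eventually_lt_const (lt_add_one c), H.eventually_integrable (E := ℝ),
    H.mul_tendsto_top.eventually_gt_atTop 0] with n hn hint hN
  refine le_trans ?_ hMr
  have hint2 : Integrable (fun q => ((√((n : ℝ) * h n))⁻¹ * (κ q.1 * s q.2)) ^ 2)
      (localLaw f x (h n) μ) := by
    refine hint _ (fun q hq => by simp [hκs _ hq]) ?_
    refine (hG.const_mul (((√((n : ℝ) * h n))⁻¹) ^ 2)).congr (Eventually.of_forall fun q => ?_)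
    simp only
    ring
  have h2 := (H.sample n).measure_le_abs_sum_sub_le
    (g := fun q => (√((n : ℝ) * h n))⁻¹ * (κ q.1 * s q.2)) (by fun_prop) hint2 hM0 n
  rw [integral_const_mul, H.integral_mul_eq_zero hs0, mul_zero, mul_zero] at h2
  simp only [sub_zero, ← Finset.mul_sum] at h2
  refine h2.trans (ENNReal.ofReal_le_ofReal ?_)
  gcongr
  refine le_of_eq_of_le ?_ hn.le
  have h3 := H.natCast_mul_integral (fun q => ((√((n : ℝ) * h n))⁻¹ * (κ q.1 * s q.2)) ^ 2) n
  simp only [smul_eq_mul] at h3 ⊢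
  rw [h3]
  congr 2
  ext q
  rw [mul_pow, inv_pow, Real.sq_sqrt hN.le, mul_pow, mul_inv_cancel_left₀ hN.ne']

/-- The dominating bound for the central limit theorem: Taylor's formula for |y| ≤ 1, and the
trivial bound 2 + |y| ≤ 3y² beyond. -/
lemma norm_exp_mul_I_sub_le (y : ℝ) :
    ‖Complex.exp (y * Complex.I) - 1 - y * Complex.I‖ ≤ 3 * y ^ 2 := by
  have hnorm : ‖(y : ℂ) * Complex.I‖ = |y| := by simp
  by_cases hy : |y| ≤ 1
  · have := Complex.norm_exp_sub_one_sub_id_le (x := (y : ℂ) * Complex.I) (by rwa [hnorm])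
    rw [hnorm, sq_abs] at this
    nlinarith [sq_nonneg y]
  · push Not at hy
    calc _ ≤ ‖Complex.exp (y * Complex.I)‖ + ‖(1 : ℂ)‖ + ‖(y : ℂ) * Complex.I‖ :=
          (norm_sub_le _ _).trans (by gcongr; exact norm_sub_le _ _)
      _ = 2 + |y| := by rw [Complex.norm_exp_ofReal_mul_I, hnorm, norm_one]; ring
      _ ≤ 3 * y ^ 2 := by rw [← sq_abs]; nlinarith

/-- The pointwise limit for the central limit theorem: the cubic Taylor remainder is of order
N^(-3/2), so N times it vanishes. -/
lemma tendsto_mul_exp_sub {N : ℕ → ℝ} (hN : Tendsto N atTop atTop) (y : ℝ) :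
    Tendsto (fun n => (N n : ℂ) * (Complex.exp (((√(N n))⁻¹ * y : ℝ) * Complex.I) - 1 -
      ((√(N n))⁻¹ * y : ℝ) * Complex.I)) atTop (𝓝 (-(y ^ 2 / 2 : ℝ))) := by
  have hinv : Tendsto (fun n => (√(N n))⁻¹) atTop (𝓝 0) :=
    tendsto_inv_atTop_zero.comp (Real.tendsto_sqrt_atTop.comp hN)
  have hz : Tendsto (fun n => |(√(N n))⁻¹ * y|) atTop (𝓝 0) := by
    simpa using (hinv.mul_const y).abs
  rw [tendsto_iff_norm_sub_tendsto_zero]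
  have hb : Tendsto (fun n => |y| ^ 2 * |(√(N n))⁻¹ * y|) atTop (𝓝 0) := by
    have := hz.const_mul (|y| ^ 2)
    rwa [mul_zero] at this
  refine squeeze_zero' (Eventually.of_forall fun _ => norm_nonneg _) ?_ hb
  filter_upwards [hN.eventually_gt_atTop 0, hz.eventually_le_const one_pos] with n hn hle
  set τ : ℝ := (√(N n))⁻¹ * y with hτ
  have hτ2 : N n * τ ^ 2 = y ^ 2 := by
    rw [hτ, mul_pow, inv_pow, Real.sq_sqrt hn.le, mul_inv_cancel_left₀ hn.ne']
  have hnorm : ‖(τ : ℂ) * Complex.I‖ = |τ| := by simp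
  have h3 := Complex.exp_bound (x := (τ : ℂ) * Complex.I) (by rwa [hnorm]) (n := 3) (by norm_num)
  rw [hnorm] at h3
  have hsum : ∑ m ∈ Finset.range 3, ((τ : ℂ) * Complex.I) ^ m / (m.factorial : ℂ) =
      1 + τ * Complex.I - (τ ^ 2 / 2 : ℝ) := by
    simp [Finset.sum_range_succ, Nat.factorial, mul_pow]
    ring
  rw [hsum] at h3
  have heq : (N n : ℂ) * (Complex.exp (τ * Complex.I) - 1 - τ * Complex.I) -
      -((y ^ 2 / 2 : ℝ) : ℂ) = (N n : ℂ) * (Complex.exp (τ * Complex.I) -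
        (1 + τ * Complex.I - ((τ ^ 2 / 2 : ℝ) : ℂ))) := by
    rw [← hτ2]
    push_cast
    ring
  rw [heq, norm_mul, Complex.norm_real, Real.norm_of_nonneg hn.le, ← hτ2.trans (sq_abs y).symm]
  calc N n * ‖_‖ ≤ N n * (|τ| ^ 3 * ((Nat.succ 3 : ℕ) * ((Nat.factorial 3 : ℕ) * (3 : ℕ) : ℝ)⁻¹)) :=
        by gcongr
    _ ≤ N n * (|τ| ^ 3 * 1) := by
        gcongr
        norm_num [Nat.factorial]
    _ = N n * τ ^ 2 * |τ| := by rw [← sq_abs τ]; ring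

/-- The central limit theorem for kernel sums of centered variables. -/
theorem tendsto_charFun_sum [IsProbabilityMeasure P] [SFinite μ] (H : IsLocalSample P f x h μ V)
    (hκ : Measurable κ) (hκs : ∀ u, 1 < |u| → κ u = 0) (hκ1 : Integrable κ)
    (hκ2 : Integrable fun u => κ u ^ 2) (hs : Measurable s) (hs1 : Integrable s μ)
    (hs2 : Integrable (fun e => s e ^ 2) μ) (hs0 : ∫ e, s e ∂μ = 0) :
    Tendsto (fun n : ℕ => charFun (P.map fun ω =>
      (√((n : ℝ) * h n))⁻¹ * ∑ i ∈ Finset.range n, κ (V n i ω).1 * s (V n i ω).2) 1) atTop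
      (𝓝 (Complex.exp (-(f x * ((∫ u, κ u ^ 2) * ∫ e, s e ^ 2 ∂μ) / 2 : ℝ)))) := by
  -- The linear term has mean zero, so it can be subtracted freely, and h⁻¹ ∫ k equals n times
  -- (characteristic function of one term minus 1). Domination by 3κ²s² then takes the place of a
  -- Lindeberg condition.
  set k : ℕ → ℝ × ℝ → ℂ := fun n q => (((n : ℝ) * h n : ℝ) : ℂ) *
    (Complex.exp (((√((n : ℝ) * h n))⁻¹ * (κ q.1 * s q.2) : ℝ) * Complex.I) - 1 -
      ((√((n : ℝ) * h n))⁻¹ * (κ q.1 * s q.2) : ℝ) * Complex.I) with hk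
  have hG : Integrable (fun q : ℝ × ℝ => 3 * (κ q.1 ^ 2 * s q.2 ^ 2)) (volume.prod μ) :=
    (hκ2.mul_prod hs2).const_mul 3
  have h1 := H.tendsto_integral (g := k)
    (g' := fun q => ((-((κ q.1 * s q.2) ^ 2 / 2) : ℝ) : ℂ))
    (fun n => by
      refine Measurable.aestronglyMeasurable ?_
      simp only [hk]
      fun_prop) hG ?_
    (fun n q hq => by simp [hk, hκs _ hq])
    (Eventually.of_forall fun q => by
      have := tendsto_mul_exp_sub H.mul_tendsto_top (κ q.1 * s q.2)
      rwa [← Complex.ofReal_neg] at this)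
  · have hlim : f x • ∫ q : ℝ × ℝ, ((-((κ q.1 * s q.2) ^ 2 / 2) : ℝ) : ℂ) ∂volume.prod μ =
        (-(f x * ((∫ u, κ u ^ 2) * ∫ e, s e ^ 2 ∂μ) / 2 : ℝ)) := by
      rw [integral_complex_ofReal, ← integral_prod_mul, Complex.real_smul, ← Complex.ofReal_mul,
        ← Complex.ofReal_neg]
      congr 1
      rw [integral_neg, integral_div]
      simp_rw [mul_pow]
      ring
    rw [hlim] at h1
    have h2 : Tendsto (fun n : ℕ => (n : ℂ) * ((n : ℂ)⁻¹ * ((h n)⁻¹ •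
        ∫ q, k n q ∂localLaw f x (h n) μ))) atTop
        (𝓝 (-(f x * ((∫ u, κ u ^ 2) * ∫ e, s e ^ 2 ∂μ) / 2 : ℝ))) := by
      refine h1.congr' ?_
      filter_upwards [eventually_ne_atTop 0] with n hn
      rw [mul_inv_cancel_left₀ (Nat.cast_ne_zero.2 hn)]
    -- With a_n the limit just found, the characteristic function of the sum is (1 + a_n/n)^n.
    refine (Complex.tendsto_one_add_pow_exp_of_tendsto h2).congr' ?_
    filter_upwards [eventually_ne_atTop 0, H.eventually_integrable (E := ℝ)] with n hn hint
    have hn0 : (n : ℂ) ≠ 0 := Nat.cast_ne_zero.2 hn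
    have hprob : IsProbabilityMeasure (localLaw f x (h n) μ) := by
      rw [← (H.sample n).law 0]
      exact Measure.isProbabilityMeasure_map ((H.sample n).measurable 0).aemeasurable
    have h3 := (H.sample n).charFun_map_sum
      (g := fun q => (√((n : ℝ) * h n))⁻¹ * (κ q.1 * s q.2)) (by fun_prop) n 1
    simp only [← Finset.mul_sum] at h3
    simp only [Complex.ofReal_one, one_mul] at h3
    rw [h3]
    congr 1
    set N : ℝ := √((n : ℝ) * h n) with hN
    have hi1 : Integrable (fun q => κ q.1 * s q.2) (localLaw f x (h n) μ) :=
      hint _ (fun q hq => by simp [hκs _ hq]) (hκ1.mul_prod hs1)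
    have hi2 : Integrable (fun q => ((N⁻¹ * (κ q.1 * s q.2) : ℝ) : ℂ) * Complex.I)
        (localLaw f x (h n) μ) := ((hi1.const_mul N⁻¹).ofReal).mul_const _
    have hi3 : Integrable (fun q => Complex.exp (((N⁻¹ * (κ q.1 * s q.2) : ℝ) : ℂ) * Complex.I))
        (localLaw f x (h n) μ) := by
      refine (integrable_const (1 : ℝ)).mono' (Measurable.aestronglyMeasurable (by fun_prop))
        (Eventually.of_forall fun q => ?_)
      rw [Complex.norm_exp_ofReal_mul_I]
    have h4 : ∫ q, ((N⁻¹ * (κ q.1 * s q.2) : ℝ) : ℂ) * Complex.I ∂localLaw f x (h n) μ = 0 := by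
      rw [integral_mul_const, integral_complex_ofReal, integral_const_mul, H.integral_mul_eq_zero hs0]
      simp
    have h5 : ∫ q, k n q ∂localLaw f x (h n) μ = (((n : ℝ) * h n : ℝ) : ℂ) *
        (∫ q, Complex.exp (((N⁻¹ * (κ q.1 * s q.2) : ℝ) : ℂ) * Complex.I)
          ∂localLaw f x (h n) μ - 1) := by
      simp only [hk, ← hN]
      have e1 := integral_sub (hi3.sub (integrable_const (1 : ℂ))) hi2
      simp only [Pi.sub_apply] at e1
      rw [integral_const_mul, e1, h4, integral_sub hi3 (integrable_const 1)]
      simp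
    rw [h5, Complex.real_smul]
    have hh : ((h n : ℝ) : ℂ) ≠ 0 := Complex.ofReal_ne_zero.2 (H.pos n).ne'
    generalize ∫ q, Complex.exp (((N⁻¹ * (κ q.1 * s q.2) : ℝ) : ℂ) * Complex.I)
      ∂localLaw f x (h n) μ = J
    push_cast
    field_simp
    ring
  · filter_upwards [H.mul_tendsto_top.eventually_gt_atTop 0] with n hN
    refine Eventually.of_forall fun q => ?_
    simp only [hk]
    rw [norm_mul, Complex.norm_real, Real.norm_of_nonneg hN.le]
    refine (mul_le_mul_of_nonneg_left (norm_exp_mul_I_sub_le _) hN.le).trans (le_of_eq ?_)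
    rw [mul_pow, inv_pow, Real.sq_sqrt hN.le, mul_left_comm, mul_inv_cancel_left₀ hN.ne', mul_pow]

end IsLocalSample

/-! ### The score equation: localization of its roots and linearization -/

section Deterministic

variable {ι α : Type*} [Fintype ι] {p : ℝ}

/-- The score equation of a weighted `L_p` regression with regressors `z`, normalized by `r`. -/
noncomputable def scoreEquation (p : ℝ) (s : Finset α) (k : α → ℝ) (z : ι → α → ℝ) (y : α → ℝ)
    (r : ℝ) (j : ι) (θ : ι → ℝ) : ℝ :=
  r⁻¹ * ∑ i ∈ s, k i * z j i * score p (y i - r⁻¹ * ∑ l, θ l * z l i)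

/-- By monotonicity of the score, a solution of the score equation is close to the solution of its
linearization, if the latter is accurate in a large ball. -/
lemma abs_mul_sub_le_of_scoreEquation_eq_zero (hp : 1 < p) {s : Finset α} {k : α → ℝ}
    (hk : ∀ i, 0 ≤ k i) {z : ι → α → ℝ} {y : α → ℝ} {r : ℝ} (hr : 0 < r) {θ : ι → ℝ}
    (hθ : ∀ j, scoreEquation p s k z y r j θ = 0) {M D₀ E : ℝ} (hM : 0 < M)
    {W D : ι → ℝ} (hD : ∀ j, D₀ ≤ D j)
    (happrox : ∀ θ : ι → ℝ, ∑ j, θ j ^ 2 ≤ M ^ 2 →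
      ∀ j, |scoreEquation p s k z y r j θ - W j + D j * θ j| ≤ E)
    (hW : ∑ j, (|W j| + E) < D₀ * M) (j : ι) : |D j * θ j - W j| ≤ E := by
  by_cases hsmall : ∑ j, θ j ^ 2 ≤ M ^ 2
  · have := happrox θ hsmall j
    rw [hθ j] at this
    rwa [show D j * θ j - W j = 0 - W j + D j * θ j by ring]
  exfalso
  push Not at hsmall
  set R := √(∑ j, θ j ^ 2) with hR
  have hR2 : R ^ 2 = ∑ j, θ j ^ 2 := Real.sq_sqrt (Finset.sum_nonneg fun j _ => sq_nonneg _)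
  have hMR : M < R := by
    rw [hR]
    exact Real.lt_sqrt_of_sq_lt hsmall
  have hR0 : 0 < R := hM.trans hMR
  -- A root outside the ball is pulled back along its ray to the sphere of radius M. Monotonicity
  -- will give a nonnegative inner product with the score there, while the linearization bounds it
  -- by M ∑ (|W| + E) - D₀ M², which is negative by `hW`.
  set τ := M / R with hτ
  have hτ0 : 0 < τ := div_pos hM hR0
  have hτ1 : τ ≤ 1 := (div_le_one hR0).2 hMR.le
  set θ' : ι → ℝ := fun l => τ * θ l with hθ'
  have hnorm : ∑ j, θ' j ^ 2 = M ^ 2 := by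
    simp only [hθ', mul_pow]
    rw [← Finset.mul_sum, ← hR2, hτ]
    field_simp
  have hθ'M : ∀ j, |θ' j| ≤ M := fun j => by
    refine abs_le_of_sq_le_sq ?_ hM.le
    rw [← hnorm]
    exact Finset.single_le_sum (f := fun j => θ' j ^ 2) (fun j _ => sq_nonneg _)
      (Finset.mem_univ j)
  have hdir : ∀ ζ : ι → ℝ, ∑ j, θ j * scoreEquation p s k z y r j ζ =
      r⁻¹ * ∑ i ∈ s, k i * ((∑ l, θ l * z l i) * score p (y i - r⁻¹ * ∑ l, ζ l * z l i)) := by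
    intro ζ
    simp only [scoreEquation, Finset.mul_sum]
    rw [Finset.sum_comm]
    refine Finset.sum_congr rfl fun i _ => ?_
    rw [Finset.sum_mul, Finset.mul_sum, Finset.mul_sum]
    refine Finset.sum_congr rfl fun l _ => ?_
    ring
  -- For each observation, with S the inner product of θ and the regressors, t ↦ S ψ(y - t S / r) is
  -- nonincreasing whatever the sign of S.
  have hmono : ∑ j, θ j * scoreEquation p s k z y r j θ ≤
      ∑ j, θ j * scoreEquation p s k z y r j θ' := by
    rw [hdir, hdir]
    refine mul_le_mul_of_nonneg_left (Finset.sum_le_sum fun i _ => ?_) (inv_pos.2 hr).le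
    refine mul_le_mul_of_nonneg_left ?_ (hk i)
    have hS : ∑ l, θ' l * z l i = τ * ∑ l, θ l * z l i := by
      simp only [hθ', Finset.mul_sum, mul_assoc]
    rw [hS]
    set S := ∑ l, θ l * z l i
    have hr' := inv_pos.2 hr
    rcases le_total 0 S with hS0 | hS0
    · refine mul_le_mul_of_nonneg_left (monotone_score hp ?_) hS0
      have : r⁻¹ * (τ * S) ≤ r⁻¹ * S :=
        mul_le_mul_of_nonneg_left (mul_le_of_le_one_left hS0 hτ1) hr'.le
      linarith
    · refine mul_le_mul_of_nonpos_left (monotone_score hp ?_) hS0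
      have : r⁻¹ * S ≤ r⁻¹ * (τ * S) :=
        mul_le_mul_of_nonneg_left (by nlinarith) hr'.le
      linarith
  have hpos : 0 ≤ ∑ j, θ' j * scoreEquation p s k z y r j θ' := by
    have h0 : ∑ j, θ j * scoreEquation p s k z y r j θ = 0 := by simp [hθ]
    rw [h0] at hmono
    simp only [hθ', mul_assoc, ← Finset.mul_sum]
    exact mul_nonneg hτ0.le hmono
  have hle : ∑ j, θ' j * scoreEquation p s k z y r j θ' ≤
      ∑ j, (M * (|W j| + E) - D₀ * θ' j ^ 2) := by
    refine Finset.sum_le_sum fun j _ => ?_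
    have h1 := happrox θ' hnorm.le j
    set A := scoreEquation p s k z y r j θ'
    have h2 : θ' j * A = θ' j * (A - W j + D j * θ' j) + θ' j * W j - D j * θ' j ^ 2 := by ring
    have h3 : θ' j * (A - W j + D j * θ' j) ≤ M * E := by
      calc _ ≤ |θ' j * (A - W j + D j * θ' j)| := le_abs_self _
        _ = |θ' j| * |A - W j + D j * θ' j| := abs_mul _ _
        _ ≤ M * E := mul_le_mul (hθ'M j) h1 (abs_nonneg _) hM.le
    have h4 : θ' j * W j ≤ M * |W j| := by
      calc _ ≤ |θ' j * W j| := le_abs_self _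
        _ = |θ' j| * |W j| := abs_mul _ _
        _ ≤ M * |W j| := mul_le_mul_of_nonneg_right (hθ'M j) (abs_nonneg _)
    have h5 : D₀ * θ' j ^ 2 ≤ D j * θ' j ^ 2 :=
      mul_le_mul_of_nonneg_right (hD j) (sq_nonneg _)
    rw [h2]
    linarith
  rw [Finset.sum_sub_distrib, ← Finset.mul_sum, ← Finset.mul_sum, hnorm] at hle
  nlinarith

/-- The error in the linearization of the score equation. -/
lemma abs_scoreEquation_sub_le [DecidableEq ι] {s : Finset α} {k : α → ℝ} (hk : ∀ i, 0 ≤ k i)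
    {z : ι → α → ℝ} (hz : ∀ i, k i ≠ 0 → ∀ j, |z j i| ≤ 1) {e δ w : α → ℝ} {r M : ℝ} (hr : 0 < r)
    (hM : 0 ≤ M)
    (hw : ∀ i ∈ s, k i ≠ 0 → ∀ t, |t| ≤ Fintype.card ι * M / r →
      |score p (e i + δ i - t) - score p (e i + δ i) + (p - 1) * |e i| ^ (p - 2) * t| ≤
        r⁻¹ * w i)
    (D : ι → ℝ) (θ : ι → ℝ) (hθ : ∑ j, θ j ^ 2 ≤ M ^ 2) (j : ι) :
    |scoreEquation p s k z (fun i => e i + δ i) r j θ -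
        r⁻¹ * ∑ i ∈ s, k i * z j i * score p (e i) + D j * θ j| ≤
      |r⁻¹ * ∑ i ∈ s, k i * z j i * (score p (e i + δ i) - score p (e i))| +
        M * ∑ l, |(r ^ 2)⁻¹ * ∑ i ∈ s, k i * z j i * z l i * ((p - 1) * |e i| ^ (p - 2)) -
          if j = l then D j else 0| +
        |(r ^ 2)⁻¹ * ∑ i ∈ s, k i * w i| := by
  have hr' := inv_pos.2 hr
  have hθM : ∀ l, |θ l| ≤ M := fun l => by
    refine abs_le_of_sq_le_sq ((Finset.single_le_sum (f := fun j => θ j ^ 2)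
      (fun j _ => sq_nonneg _) (Finset.mem_univ l)).trans hθ) hM
  set S : α → ℝ := fun i => r⁻¹ * ∑ l, θ l * z l i with hS
  have hSle : ∀ i, k i ≠ 0 → |S i| ≤ Fintype.card ι * M / r := by
    intro i hi
    rw [hS, abs_mul, abs_of_pos hr', div_eq_inv_mul]
    refine mul_le_mul_of_nonneg_left ((Finset.abs_sum_le_sum_abs _ _).trans ?_) hr'.le
    calc ∑ l, |θ l * z l i| ≤ ∑ _l : ι, M := Finset.sum_le_sum fun l _ => by
          rw [abs_mul]
          have := mul_le_mul (hθM l) (hz i hi l) (abs_nonneg _) hM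
          linarith
      _ = Fintype.card ι * M := by simp
  -- Three sources of error: the effect of δ at θ = 0, the deviation of the empirical second
  -- derivative from the diagonal matrix D, and the remainder of the linearization in θ. The
  -- derivative is taken at e although the increment starts from e + δ; the envelope w absorbs the
  -- difference.
  have hdecomp : scoreEquation p s k z (fun i => e i + δ i) r j θ -
        r⁻¹ * ∑ i ∈ s, k i * z j i * score p (e i) + D j * θ j =
      r⁻¹ * ∑ i ∈ s, k i * z j i * (score p (e i + δ i) - score p (e i)) -
        ∑ l, θ l * ((r ^ 2)⁻¹ * ∑ i ∈ s, k i * z j i * z l i * ((p - 1) * |e i| ^ (p - 2)) -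
          if j = l then D j else 0) +
      r⁻¹ * ∑ i ∈ s, k i * z j i * (score p (e i + δ i - S i) - score p (e i + δ i) +
        (p - 1) * |e i| ^ (p - 2) * S i) := by
    have h1 : ∑ l, θ l * ((r ^ 2)⁻¹ * ∑ i ∈ s, k i * z j i * z l i *
        ((p - 1) * |e i| ^ (p - 2)) - if j = l then D j else 0) =
        r⁻¹ * ∑ i ∈ s, k i * z j i * ((p - 1) * |e i| ^ (p - 2) * S i) - D j * θ j := by
      simp only [mul_sub, Finset.sum_sub_distrib]
      congr 1
      · simp only [hS, Finset.mul_sum]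
        rw [Finset.sum_comm]
        refine Finset.sum_congr rfl fun i _ => Finset.sum_congr rfl fun l _ => ?_
        field_simp
      · simp [mul_comm]
    rw [h1, scoreEquation]
    simp only [mul_add, mul_sub, Finset.sum_add_distrib, Finset.sum_sub_distrib, hS]
    ring
  rw [hdecomp]
  have hA : |∑ l, θ l * ((r ^ 2)⁻¹ * ∑ i ∈ s, k i * z j i * z l i *
      ((p - 1) * |e i| ^ (p - 2)) - if j = l then D j else 0)| ≤
      M * ∑ l, |(r ^ 2)⁻¹ * ∑ i ∈ s, k i * z j i * z l i * ((p - 1) * |e i| ^ (p - 2)) -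
          if j = l then D j else 0| := by
    refine (Finset.abs_sum_le_sum_abs _ _).trans ?_
    rw [Finset.mul_sum]
    refine Finset.sum_le_sum fun l _ => ?_
    rw [abs_mul]
    exact mul_le_mul_of_nonneg_right (hθM l) (abs_nonneg _)
  have hB : |r⁻¹ * ∑ i ∈ s, k i * z j i * (score p (e i + δ i - S i) - score p (e i + δ i) +
        (p - 1) * |e i| ^ (p - 2) * S i)| ≤ |(r ^ 2)⁻¹ * ∑ i ∈ s, k i * w i| := by
    refine le_trans ?_ (le_abs_self _)
    rw [abs_mul, abs_of_pos hr']
    calc _ ≤ r⁻¹ * ∑ i ∈ s, k i * (r⁻¹ * w i) := by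
          refine mul_le_mul_of_nonneg_left ((Finset.abs_sum_le_sum_abs _ _).trans ?_) hr'.le
          refine Finset.sum_le_sum fun i hi => ?_
          rw [abs_mul, abs_mul, abs_of_nonneg (hk i)]
          by_cases hki : k i = 0
          · simp [hki]
          · rw [mul_assoc]
            refine mul_le_mul_of_nonneg_left ?_ (hk i)
            refine (mul_le_of_le_one_left (abs_nonneg _) (hz i hki j)).trans ?_
            exact hw i hi hki _ (hSle i hki)
      _ = (r ^ 2)⁻¹ * ∑ i ∈ s, k i * w i := by
          simp only [Finset.mul_sum]
          refine Finset.sum_congr rfl fun i _ => ?_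
          field_simp
  refine (abs_add_le _ _).trans (add_le_add ((abs_sub _ _).trans ?_) hB)
  exact add_le_add le_rfl hA

end Deterministic

/-! ### Integrability of weighted kernels -/

section Kernel

variable {K : ℝ → ℝ} {z : ℝ → ℝ}

lemma IsSmoothingKernel.integrable_sq_mul (hK : IsSmoothingKernel K) (hz : Measurable z)
    (hz1 : ∀ u, |u| ≤ 1 → |z u| ≤ 1) : Integrable fun u => (K u * z u) ^ 2 := by
  have hm := hK.measurable
  refine hK.sq_integrable.integrable_sq.mono' (by fun_prop) (Eventually.of_forall fun u => ?_)
  rw [Real.norm_of_nonneg (sq_nonneg _), mul_pow]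
  by_cases hu : 1 < |u|
  · simp [hK.support u hu]
  · have := hz1 u (not_lt.1 hu)
    have h2 : z u ^ 2 ≤ 1 := by rw [← sq_abs]; nlinarith [abs_nonneg (z u)]
    nlinarith [sq_nonneg (K u)]

/-- A nonintegrable function has integral 0 by convention, not 1. -/
lemma IsSmoothingKernel.integrable (hK : IsSmoothingKernel K) : Integrable K :=
  (by_contra fun h => by simpa [integral_undef h] using hK.integral_eq_one)

lemma IsSmoothingKernel.integrable_mul (hK : IsSmoothingKernel K) (hz : Measurable z)
    (hz1 : ∀ u, |u| ≤ 1 → |z u| ≤ 1) : Integrable fun u => K u * z u := by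
  have hm := hK.measurable
  refine hK.integrable.mono' (by fun_prop) (Eventually.of_forall fun u => ?_)
  rw [norm_mul, Real.norm_of_nonneg (hK.nonneg u)]
  by_cases hu : 1 < |u|
  · simp [hK.support u hu]
  · exact mul_le_of_le_one_right (hK.nonneg u) (hz1 u (not_lt.1 hu))

end Kernel

/-! ### Asymptotic linearity of local regression estimators -/

section Linearization

variable {Ω : Type*} [MeasurableSpace Ω] {P : Measure Ω}

lemma BoundedInProb.sum_abs {ι : Type*} (s : Finset ι) {Z : ι → ℕ → Ω → ℝ}
    (h : ∀ j ∈ s, BoundedInProb P (Z j)) :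
    BoundedInProb P (fun n ω => ∑ j ∈ s, |Z j n ω|) := by
  classical
  induction s using Finset.induction_on with
  | empty =>
    intro r _
    exact ⟨1, Eventually.of_forall fun n => by simp [zero_lt_one.not_ge]⟩
  | insert j s hj ih =>
    intro r hr
    have hr2 := ENNReal.half_pos hr.ne'
    obtain ⟨M, hM⟩ := h j (by simp) (r / 2) hr2
    obtain ⟨M', hM'⟩ := ih (fun k hk => h k (by simp [hk])) (r / 2) hr2
    refine ⟨M + M', ?_⟩
    filter_upwards [hM, hM'] with n h1 h2
    calc _ ≤ P ({ω | M ≤ |Z j n ω|} ∪ {ω | M' ≤ abs (∑ l ∈ s, |Z l n ω|)}) := by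
          refine measure_mono fun ω hω => ?_
          have hs : 0 ≤ ∑ l ∈ s, |Z l n ω| := Finset.sum_nonneg fun l _ => abs_nonneg _
          simp only [mem_ofPred_eq, mem_union, Finset.sum_insert hj] at hω ⊢
          rw [abs_of_nonneg (add_nonneg (abs_nonneg _) hs)] at hω
          rw [abs_of_nonneg hs]
          by_contra! hc
          linarith [hc.1, hc.2]
      _ ≤ r / 2 + r / 2 := (measure_union_le _ _).trans (add_le_add h1 h2)
      _ = r := ENNReal.add_halves r

variable {f : ℝ → ℝ} {x : ℝ} {h : ℕ → ℝ} {μ : Measure ℝ} {V : ℕ → ℕ → Ω → ℝ × ℝ}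

lemma IsLocalSample.ae_of_ae_prod (H : IsLocalSample P f x h μ V) {q : ℝ × ℝ → Prop}
    (hq : ∀ᵐ v ∂volume.prod μ, q v) (n : ℕ) : ∀ᵐ ω ∂P, ∀ i, q (V n i ω) := by
  refine ae_all_iff.2 fun i => ?_
  refine ae_of_ae_map ((H.sample n).measurable i).aemeasurable ?_
  rw [(H.sample n).law i]
  exact (withDensity_absolutelyContinuous _ _).ae_le hq

/-- Local `L_p` regression estimators are asymptotically linear. -/
theorem IsLocalSample.tendstoZeroInProb_estimator [IsProbabilityMeasure P] [SFinite μ]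
    (H : IsLocalSample P f x h μ V) (hfx : 0 < f x) {p : ℝ} (hp : 1 < p) {K : ℝ → ℝ}
    (hK : IsSmoothingKernel K) {ι : Type*} [Fintype ι] {z : ι → ℝ → ℝ}
    (hz : ∀ j, Measurable (z j)) (hz1 : ∀ j u, |u| ≤ 1 → |z j u| ≤ 1)
    (horth : ∀ j l, j ≠ l → ∫ u, K u * (z j u * z l u) = 0)
    (hpos : ∀ j, 0 < ∫ u, K u * (z j u * z j u))
    (hv : Integrable (fun e => |e| ^ (p - 2)) μ) (hv0 : 0 < ∫ e, |e| ^ (p - 2) ∂μ)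
    (hs2 : Integrable (fun e => score p e ^ 2) μ) (hs0 : ∫ e, score p e ∂μ = 0)
    {δ : ℕ → ℝ → ℝ} {Θ : ι → ℕ → Ω → ℝ}
    (hΘ : ∀ᶠ n : ℕ in atTop, ∀ᵐ ω ∂P, ∀ j, scoreEquation p (Finset.range n)
      (fun i => K (V n i ω).1) (fun l i => z l (V n i ω).1)
      (fun i => (V n i ω).2 + δ n (V n i ω).1) (√(n * h n)) j (fun l => Θ l n ω) = 0)
    (hbias : ∀ j, TendstoZeroInProb P fun n ω => (√(n * h n))⁻¹ * ∑ i ∈ Finset.range n,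
      K (V n i ω).1 * z j (V n i ω).1 *
        (score p ((V n i ω).2 + δ n (V n i ω).1) - score p (V n i ω).2))
    (henv : ∀ M : ℝ, 0 < M → ∃ w : ℕ → ℝ × ℝ → ℝ,
      (∀ᶠ n : ℕ in atTop, ∀ᵐ q ∂volume.prod μ, |q.1| ≤ 1 → ∀ t, |t| ≤ M / √(n * h n) →
        |score p (q.2 + δ n q.1 - t) - score p (q.2 + δ n q.1) + (p - 1) * |q.2| ^ (p - 2) * t| ≤
          (√(n * h n))⁻¹ * w n q) ∧
      TendstoZeroInProb P fun n ω => ((n : ℝ) * h n)⁻¹ * ∑ i ∈ Finset.range n,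
        K (V n i ω).1 * w n (V n i ω)) (j : ι) :
    TendstoZeroInProb P fun n ω =>
      f x * ((∫ u, K u * (z j u * z j u)) * ((p - 1) * ∫ e, |e| ^ (p - 2) ∂μ)) * Θ j n ω -
        (√(n * h n))⁻¹ * ∑ i ∈ Finset.range n, (K (V n i ω).1 * z j (V n i ω).1) *
          score p (V n i ω).2 := by
  classical
  set D : ι → ℝ := fun j => f x * ((∫ u, K u * (z j u * z j u)) *
    ((p - 1) * ∫ e, |e| ^ (p - 2) ∂μ)) with hD
  have hDpos : ∀ j, 0 < D j := fun j =>
    mul_pos hfx (mul_pos (hpos j) (mul_pos (by linarith) hv0))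
  -- The limiting matrix is diagonal, so its smallest eigenvalue is the least D j.
  obtain ⟨D₀, hD₀, hDle⟩ : ∃ D₀ > 0, ∀ j, D₀ ≤ D j := by
    have : Nonempty ι := ⟨j⟩
    obtain ⟨j₀, hj₀⟩ := Finite.exists_min D
    exact ⟨D j₀, hDpos j₀, hj₀⟩
  set W : ι → ℕ → Ω → ℝ := fun j n ω => (√(n * h n))⁻¹ * ∑ i ∈ Finset.range n,
    (K (V n i ω).1 * z j (V n i ω).1) * score p (V n i ω).2 with hW
  have hKm := hK.measurable
  have hsm : Measurable (score p) := (continuous_score hp).measurable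
  have hWb : BoundedInProb P fun n ω => ∑ j, |W j n ω| :=
    BoundedInProb.sum_abs _ fun j _ => H.boundedInProb_sum (κ := fun u => K u * z j u)
      (hKm.mul (hz j)) (fun u hu => by simp [hK.support u hu])
      (hK.integrable_sq_mul (hz j) (hz1 j)) hsm hs2 hs0
  -- the matrix of second derivatives
  have hhess : ∀ j l, TendstoZeroInProb P fun n ω => ((n : ℝ) * h n)⁻¹ *
      ∑ i ∈ Finset.range n, K (V n i ω).1 * z j (V n i ω).1 * z l (V n i ω).1 *
        ((p - 1) * |(V n i ω).2| ^ (p - 2)) - if j = l then D j else 0 := by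
    intro j l
    have hzz : ∀ u, |u| ≤ 1 → |z j u * z l u| ≤ 1 := fun u hu => by
      rw [abs_mul]
      exact mul_le_one₀ (hz1 j u hu) (abs_nonneg _) (hz1 l u hu)
    have h1 := H.tendstoZeroInProb_average (κ := fun u => K u * (z j u * z l u))
      (w := fun e => (p - 1) * |e| ^ (p - 2)) (hKm.mul ((hz j).mul (hz l)))
      (fun u hu => by simp [hK.support u hu]) (hK.integrable_mul ((hz j).mul (hz l)) hzz)
      (hK.integrable_sq_mul ((hz j).mul (hz l)) hzz) (by fun_prop) (hv.const_mul _)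
    refine h1.of_abs_le (Eventually.of_forall fun n => Eventually.of_forall fun ω => le_of_eq ?_)
    congr 1
    congr 1
    · simp only [mul_assoc]
    · rw [integral_const_mul]
      split_ifs with hjl
      · subst hjl; rfl
      · simp [horth j l hjl]
  intro η hη
  rw [ENNReal.tendsto_nhds_zero]
  intro r hr
  have hr2 := ENNReal.half_pos hr.ne'
  obtain ⟨B, hB⟩ := hWb (r / 2) hr2
  set d : ℝ := (Fintype.card ι : ℝ) with hd
  -- On the event where the sum of |W j| is below B and E is below 1, the sum of |W j| + E is less
  -- than |B| + d + 1 = D₀ M. This is what the localization needs; M must be fixed before the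
  -- envelope, which depends on it.
  set M : ℝ := (|B| + d + 1) / D₀ with hM
  have hM0 : 0 < M := by positivity
  -- In the ball of radius M the increments are at most d M / √(nh); the added 1 only secures
  -- positivity.
  obtain ⟨w, hw, hwlim⟩ := henv (d * M + 1) (by positivity)
  -- A single error bound that does not depend on θ or on the coordinate, obtained by summing over
  -- all coordinates.
  set E : ℕ → Ω → ℝ := fun n ω =>
    ∑ j, |(√(n * h n))⁻¹ * ∑ i ∈ Finset.range n, K (V n i ω).1 * z j (V n i ω).1 *
        (score p ((V n i ω).2 + δ n (V n i ω).1) - score p (V n i ω).2)| +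
      M * ∑ j, ∑ l, |((n : ℝ) * h n)⁻¹ * ∑ i ∈ Finset.range n, K (V n i ω).1 *
        z j (V n i ω).1 * z l (V n i ω).1 * ((p - 1) * |(V n i ω).2| ^ (p - 2)) -
          if j = l then D j else 0| +
      |((n : ℝ) * h n)⁻¹ * ∑ i ∈ Finset.range n, K (V n i ω).1 * w n (V n i ω)| with hE
  have hElim : TendstoZeroInProb P E :=
    ((TendstoZeroInProb.sum _ fun j _ => (hbias j).abs).add
      ((TendstoZeroInProb.sum _ fun j _ =>
        TendstoZeroInProb.sum _ fun l _ => (hhess j l).abs).const_mul M)).add hwlim.abs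
  -- The bound η is for the conclusion, the bound 1 for the localization.
  have hmin : 0 < min η 1 := lt_min hη one_pos
  filter_upwards [hB, ENNReal.tendsto_nhds_zero.1 (hElim _ hmin) (r / 2) hr2, hw, hΘ,
    H.mul_tendsto_top.eventually_gt_atTop 0] with n h1 h2 hwn hΘn hN
  have hr0 : 0 < √((n : ℝ) * h n) := Real.sqrt_pos.2 hN
  calc _ ≤ P ({ω | B ≤ abs (∑ j, |W j n ω|)} ∪ {ω | min η 1 ≤ |E n ω|}) := by
        refine measure_mono_ae ?_
        filter_upwards [hΘn, H.ae_of_ae_prod hwn n] with ω hω hwω hmem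
        by_contra hc
        change ¬ (B ≤ abs (∑ j, |W j n ω|) ∨ min η 1 ≤ |E n ω|) at hc
        change η ≤ |D j * Θ j n ω - W j n ω| at hmem
        push Not at hc
        obtain ⟨hc1, hc2⟩ := hc
        have hE0 : 0 ≤ E n ω := by simp only [hE]; positivity
        rw [abs_of_nonneg hE0] at hc2
        rw [abs_of_nonneg (Finset.sum_nonneg fun l _ => abs_nonneg _)] at hc1
        have hconcl := abs_mul_sub_le_of_scoreEquation_eq_zero (M := M) (E := E n ω)
          (W := fun j => W j n ω) hp (fun i => hK.nonneg _) hr0 hω hM0 hDle ?_ ?_ j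
        · linarith [min_le_left η 1]
        · intro θ hθ l
          have hlin := abs_scoreEquation_sub_le (p := p) (s := Finset.range n)
            (k := fun i => K (V n i ω).1) (fun i => hK.nonneg _)
            (z := fun l i => z l (V n i ω).1) (fun i hi j => hz1 j _ (by
              by_contra hgt
              exact hi (hK.support _ (not_le.1 hgt))))
            (e := fun i => (V n i ω).2) (δ := fun i => δ n (V n i ω).1)
            (w := fun i => w n (V n i ω)) hr0 hM0.le (fun i _ hi t ht => hwω i (by
              by_contra hgt
              exact hi (hK.support _ (not_le.1 hgt))) t (ht.trans (by gcongr; linarith)))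
            D θ hθ l
          refine hlin.trans ?_
          rw [Real.sq_sqrt hN.le]
          simp only [hE]
          refine add_le_add (add_le_add ?_ (mul_le_mul_of_nonneg_left ?_ hM0.le)) le_rfl
          · exact Finset.single_le_sum (f := fun j => |(√(n * h n))⁻¹ * ∑ i ∈ Finset.range n,
              K (V n i ω).1 * z j (V n i ω).1 *
                (score p ((V n i ω).2 + δ n (V n i ω).1) - score p (V n i ω).2)|)
              (fun j _ => abs_nonneg _) (Finset.mem_univ l)
          · exact Finset.single_le_sum (f := fun j => ∑ l, |((n : ℝ) * h n)⁻¹ *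
              ∑ i ∈ Finset.range n, K (V n i ω).1 * z j (V n i ω).1 * z l (V n i ω).1 *
                ((p - 1) * |(V n i ω).2| ^ (p - 2)) - if j = l then D j else 0|)
              (fun j _ => Finset.sum_nonneg fun l _ => abs_nonneg _) (Finset.mem_univ l)
        · rw [Finset.sum_add_distrib, hM, mul_div_cancel₀ _ hD₀.ne']
          simp only [Finset.sum_const, Finset.card_univ, nsmul_eq_mul, ← hd]
          have hd0 : 0 ≤ d := by positivity
          nlinarith [le_abs_self B, min_le_right η 1]
    _ ≤ r / 2 + r / 2 := (measure_union_le _ _).trans (add_le_add h1 h2)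
    _ = r := ENNReal.add_halves r

end Linearization

/-! ### Moments of the errors and the law of the score -/

section Moments

variable {Ω : Type*} [MeasurableSpace Ω] {P : Measure Ω} {Z : Ω → ℝ} {q : ℝ}

/-- In the extended nonnegative reals a negative power of 0 is ∞, so a finite moment excludes an
atom at 0. -/
lemma ae_ne_zero_of_eAbsMoment_lt_top (hZ : AEMeasurable Z P) (hq : q < 0)
    (h : eAbsMoment P Z q < ⊤) : ∀ᵐ ω ∂P, Z ω ≠ 0 := by
  filter_upwards [ae_lt_top' (hZ.enorm.pow_const q) h.ne] with ω hω h0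
  rw [h0, enorm_zero, ENNReal.zero_rpow_of_neg hq] at hω
  exact lt_irrefl _ hω

/-- Real and extended powers differ only at 0 with a negative exponent, which is a null event when
the moment is finite. -/
lemma ae_enorm_rpow_eq (hZ : AEMeasurable Z P) (h : eAbsMoment P Z q < ⊤) :
    ∀ᵐ ω ∂P, ‖Z ω‖ₑ ^ q = ENNReal.ofReal (|Z ω| ^ q) := by
  rcases lt_or_ge q 0 with hq | hq
  · filter_upwards [ae_ne_zero_of_eAbsMoment_lt_top hZ hq h] with ω hω
    rw [Real.enorm_eq_ofReal_abs, ENNReal.ofReal_rpow_of_pos (abs_pos.2 hω)]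
  · refine Eventually.of_forall fun ω => ?_
    rw [Real.enorm_eq_ofReal_abs, ENNReal.ofReal_rpow_of_nonneg (abs_nonneg _) hq]

lemma integrable_abs_rpow_of_eAbsMoment_lt_top (hZ : AEMeasurable Z P)
    (h : eAbsMoment P Z q < ⊤) : Integrable (fun ω => |Z ω| ^ q) P := by
  refine ⟨AEMeasurable.aestronglyMeasurable (by fun_prop), ?_⟩
  rw [hasFiniteIntegral_iff_ofReal (Eventually.of_forall fun ω => by positivity),
    ← lintegral_congr_ae (ae_enorm_rpow_eq hZ h)]
  exact h

lemma absMoment_eq_integral (hZ : AEMeasurable Z P) (h : eAbsMoment P Z q < ⊤) :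
    absMoment P Z q = ∫ ω, |Z ω| ^ q ∂P := by
  rw [absMoment, eAbsMoment, lintegral_congr_ae (ae_enorm_rpow_eq hZ h),
    integral_eq_lintegral_of_nonneg_ae (Eventually.of_forall fun ω => by positivity)
      (AEMeasurable.aestronglyMeasurable (by fun_prop))]

lemma eAbsMoment_lt_top_of_lt [IsFiniteMeasure P] {q' : ℝ} (hq : 0 ≤ q)
    (hqq' : q ≤ q') (h : eAbsMoment P Z q' < ⊤) : eAbsMoment P Z q < ⊤ := by
  calc eAbsMoment P Z q ≤ ∫⁻ ω, (1 + ‖Z ω‖ₑ ^ q') ∂P := by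
        refine lintegral_mono fun ω => ?_
        rcases le_total ‖Z ω‖ₑ 1 with h1 | h1
        · exact (ENNReal.rpow_le_one h1 hq).trans le_self_add
        · exact (ENNReal.rpow_le_rpow_of_exponent_le h1 hqq').trans le_add_self
    _ = P univ + eAbsMoment P Z q' := by
        rw [lintegral_add_left measurable_const]
        simp [eAbsMoment]
    _ < ⊤ := ENNReal.add_lt_top.2 ⟨measure_lt_top P _, h⟩

lemma integral_abs_rpow_pos {μ : Measure ℝ} (hi : Integrable (fun e => |e| ^ q) μ)
    (h : ¬ ∀ᵐ e ∂μ, e = 0) : 0 < ∫ e, |e| ^ q ∂μ := by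
  refine lt_of_le_of_ne (integral_nonneg fun e => by positivity) fun h0 => h ?_
  have := (integral_eq_zero_iff_of_nonneg (fun e => by positivity) hi).1 h0.symm
  filter_upwards [this] with e he
  by_contra hne
  exact (Real.rpow_pos_of_pos (abs_pos.2 hne) q).ne' he

/-- The properties of the law of the errors that are used in the asymptotic theory. -/
structure IsScoreLaw (p : ℝ) (μ : Measure ℝ) : Prop where
  integrable : Integrable (fun e => |e| ^ (p - 2)) μ
  ae_ne : p < 2 → ∀ᵐ e ∂μ, e ≠ 0
  pos : 0 < ∫ e, |e| ^ (p - 2) ∂μ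
  integrable_sq : Integrable (fun e => score p e ^ 2) μ
  sq_pos : 0 < ∫ e, score p e ^ 2 ∂μ
  mean : ∫ e, score p e ∂μ = 0

variable {ε : ℕ → Ω → ℝ} {p : ℝ}

lemma IsErrorSequence.eAbsMoment_lt_top [IsFiniteMeasure P] (hp : 1 < p)
    (hε : IsErrorSequence P ε p) : eAbsMoment P (ε 0) (2 * p - 2) < ⊤ := by
  obtain ⟨d, hd, hfin⟩ := hε.moment
  exact eAbsMoment_lt_top_of_lt (by linarith) (by nlinarith) hfin

lemma IsErrorSequence.isScoreLaw [IsFiniteMeasure P] (hp : 1 < p)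
    (hε : IsErrorSequence P ε p) : IsScoreLaw p (P.map (ε 0)) := by
  have hm := (hε.measurable 0).aemeasurable (μ := P)
  have hsm := (continuous_score hp).measurable
  have h1 : Integrable (fun e => |e| ^ (p - 2)) (P.map (ε 0)) :=
    (integrable_map_measure (Measurable.aestronglyMeasurable (by fun_prop)) hm).2
      (integrable_abs_rpow_of_eAbsMoment_lt_top hm hε.neg_moment)
  have h2 : Integrable (fun e => |e| ^ (2 * p - 2)) (P.map (ε 0)) :=
    (integrable_map_measure (Measurable.aestronglyMeasurable (by fun_prop)) hm).2
      (integrable_abs_rpow_of_eAbsMoment_lt_top hm (hε.eAbsMoment_lt_top hp))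
  have hnd : ¬ ∀ᵐ e ∂P.map (ε 0), e = 0 := fun h => hε.nondegenerate (ae_of_ae_map hm h)
  refine ⟨h1, fun hp2 => ?_, integral_abs_rpow_pos h1 hnd, ?_, ?_, ?_⟩
  · refine (ae_map_iff hm (p := fun e => e ≠ 0) (measurableSet_singleton (0 : ℝ)).compl).2 ?_
    exact ae_ne_zero_of_eAbsMoment_lt_top hm (by linarith) hε.neg_moment
  · simpa only [score_sq hp] using h2
  · simpa only [score_sq hp] using integral_abs_rpow_pos h2 hnd
  · rw [integral_map hm (by fun_prop), ← hε.score_mean]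
    simp only [score_eq_sign]

end Moments

/-! ### Residuals of smaller order than 1 / √(nh), for the local linear fit -/

namespace IsScoreLaw

variable {Ω : Type*} [MeasurableSpace Ω] {P : Measure Ω} {f : ℝ → ℝ} {x : ℝ}
  {h : ℕ → ℝ} {μ : Measure ℝ} {V : ℕ → ℕ → Ω → ℝ × ℝ} {p : ℝ} {K : ℝ → ℝ}

lemma ae_prod_ne [SFinite μ] (hμ : IsScoreLaw p μ) :
    ∀ᵐ q ∂(volume : Measure ℝ).prod μ, p < 2 → q.2 ≠ 0 := by
  by_cases hp : p < 2
  · exact (Measure.quasiMeasurePreserving_snd.ae (hμ.ae_ne hp)).mono fun q hq _ => hq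
  · exact Eventually.of_forall fun q h => absurd h hp

lemma integrable_score [IsFiniteMeasure μ] (hp : 1 < p) (hμ : IsScoreLaw p μ) :
    Integrable (score p) μ := by
  have hsm := (continuous_score hp).measurable
  exact ((memLp_two_iff_integrable_sq (by fun_prop)).2 hμ.integrable_sq).integrable one_le_two

/-- A Lipschitz bound whose constant depends on e and is integrable, even for p < 2, where the score
is not Lipschitz near 0. -/
lemma exists_abs_score_add_sub_le (hp : 1 < p) : ∃ C : ℝ, 0 ≤ C ∧ ∀ e t : ℝ, (p < 2 → e ≠ 0) →
    |t| ≤ 1 → |score p (e + t) - score p e| ≤ C * |t| * (|e| ^ (p - 2) + 1) := by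
  obtain ⟨C, hC, hR⟩ := exists_abs_score_sub_le hp
  refine ⟨C + (p - 1), by linarith, fun e t he ht => ?_⟩
  have h1 := hR e (-t) he
  rw [abs_neg, sub_neg_eq_add] at h1
  have h2 := scoreModulus_le (p := p) (e := e) (abs_nonneg t) ht
  have h3 : C * |t| * scoreModulus p e |t| ≤ C * |t| * (|e| ^ (p - 2) + 1) := by gcongr
  have h4 : |(p - 1) * |e| ^ (p - 2) * (-t)| = (p - 1) * |e| ^ (p - 2) * |t| := by
    rw [abs_mul, abs_neg, abs_of_nonneg]
    have : 0 < p - 1 := by linarith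
    positivity
  have h5 : |score p (e + t) - score p e| ≤
      |score p (e + t) - score p e + (p - 1) * |e| ^ (p - 2) * (-t)| +
        |(p - 1) * |e| ^ (p - 2) * (-t)| := by
    have := abs_sub (score p (e + t) - score p e + (p - 1) * |e| ^ (p - 2) * (-t))
      ((p - 1) * |e| ^ (p - 2) * (-t))
    rwa [add_sub_cancel_right] at this
  rw [h4] at h5
  have h6 : 0 ≤ (p - 1) * |t| := mul_nonneg (by linarith) (abs_nonneg _)
  linarith

variable {δ : ℕ → ℝ → ℝ} {a : ℕ → ℝ}

/-- Regression residuals of smaller order than `1 / √(n h)` do not contribute to the score. -/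
lemma tendstoZeroInProb_bias [IsProbabilityMeasure μ] (hp : 1 < p) (hμ : IsScoreLaw p μ)
    (H : IsLocalSample P f x h μ V) (hK : IsSmoothingKernel K) {z : ℝ → ℝ} (hz : Measurable z)
    (hz1 : ∀ u, |u| ≤ 1 → |z u| ≤ 1) (hδm : ∀ n, Measurable (δ n))
    (hδ : ∀ᶠ n in atTop, ∀ u, |u| ≤ 1 → |δ n u| ≤ a n)
    (ha : Tendsto (fun n : ℕ => √(n * h n) * a n) atTop (𝓝 0)) (ha0 : Tendsto a atTop (𝓝 0)) :
    TendstoZeroInProb P fun n ω => (√(n * h n))⁻¹ * ∑ i ∈ Finset.range n,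
      K (V n i ω).1 * z (V n i ω).1 *
        (score p ((V n i ω).2 + δ n (V n i ω).1) - score p (V n i ω).2) := by
  obtain ⟨C, hC, hR⟩ := exists_abs_score_add_sub_le hp
  have hKm := hK.measurable
  have hsm := (continuous_score hp).measurable
  have hpt : ∀ᶠ n : ℕ in atTop, ∀ q : ℝ × ℝ, (p < 2 → q.2 ≠ 0) →
      |√(n * h n) * (K q.1 * z q.1 * (score p (q.2 + δ n q.1) - score p q.2))| ≤
        (√(n * h n) * a n) * (C * (K q.1 * (|q.2| ^ (p - 2) + 1))) := by
    filter_upwards [hδ, ha0.eventually_le_const one_pos] with n hn han q hq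
    rw [abs_mul, abs_mul, abs_mul, abs_of_nonneg (Real.sqrt_nonneg _),
      abs_of_nonneg (hK.nonneg _)]
    by_cases hu : 1 < |q.1|
    · simp [hK.support _ hu]
    · rw [not_lt] at hu
      have h1 := hn q.1 hu
      have h2 := hR q.2 (δ n q.1) hq (h1.trans han)
      have hK0 := hK.nonneg q.1
      calc √(n * h n) * (K q.1 * |z q.1| * |score p (q.2 + δ n q.1) - score p q.2|)
          ≤ √(n * h n) * (K q.1 * 1 * (C * a n * (|q.2| ^ (p - 2) + 1))) := by
            gcongr
            · exact hz1 _ hu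
            · exact h2.trans (by gcongr)
        _ = _ := by ring
  -- Since (√(nh))⁻¹ = (nh)⁻¹ √(nh), the factor √(nh) a_n → 0 multiplies an integrable function, and
  -- the L¹ law suffices without any cancellation.
  have hmain := H.tendstoZeroInProb_of_dominated
    (k := fun n q => √(n * h n) * (K q.1 * z q.1 * (score p (q.2 + δ n q.1) - score p q.2)))
    (G := fun q => C * (K q.1 * (|q.2| ^ (p - 2) + 1)))
    (fun n => by have := hδm n; fun_prop)
    ((hK.integrable.mul_prod (hμ.integrable.add (integrable_const 1))).const_mul C)
    (by
      filter_upwards [hpt, ha.eventually_le_const one_pos] with n hn han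
      filter_upwards [hμ.ae_prod_ne] with q hq
      refine (hn q hq).trans (mul_le_of_le_one_left ?_ han)
      have := hK.nonneg q.1
      positivity)
    (fun n q hq => by simp [hK.support _ hq])
    (by
      filter_upwards [hμ.ae_prod_ne] with q hq
      refine squeeze_zero_norm' (hpt.mono fun n hn => hn q hq) ?_
      simpa using ha.mul_const (C * (K q.1 * (|q.2| ^ (p - 2) + 1))))
  refine hmain.of_abs_le ?_
  filter_upwards [H.mul_tendsto_top.eventually_gt_atTop 0] with n hN
  refine Eventually.of_forall fun ω => le_of_eq ?_
  congr 1
  rw [Finset.mul_sum]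
  refine Finset.sum_congr rfl fun i _ => ?_
  have h0 : √((n : ℝ) * h n) ≠ 0 := (Real.sqrt_pos.2 hN).ne'
  have h1 : (n : ℝ) * h n = √((n : ℝ) * h n) ^ 2 := (Real.sq_sqrt hN.le).symm
  rw [show ((n : ℝ) * h n)⁻¹ = (√((n : ℝ) * h n) ^ 2)⁻¹ by rw [← h1]]
  field_simp

/-- An integrable envelope for the linearization error of the score, when the regression residuals
are of smaller order than `1 / √(n h)`. -/
lemma exists_envelope [IsProbabilityMeasure μ] (hp : 1 < p) (hμ : IsScoreLaw p μ)
    (H : IsLocalSample P f x h μ V) (hK : IsSmoothingKernel K)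
    (hδ : ∀ᶠ n in atTop, ∀ u, |u| ≤ 1 → |δ n u| ≤ a n)
    (ha : Tendsto (fun n : ℕ => √(n * h n) * a n) atTop (𝓝 0)) {M : ℝ} (hM : 0 < M) :
    ∃ w : ℕ → ℝ × ℝ → ℝ,
      (∀ᶠ n : ℕ in atTop, ∀ᵐ q ∂volume.prod μ, |q.1| ≤ 1 → ∀ t, |t| ≤ M / √(n * h n) →
        |score p (q.2 + δ n q.1 - t) - score p (q.2 + δ n q.1) + (p - 1) * |q.2| ^ (p - 2) * t| ≤
          (√(n * h n))⁻¹ * w n q) ∧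
      TendstoZeroInProb P fun n ω => ((n : ℝ) * h n)⁻¹ * ∑ i ∈ Finset.range n,
        K (V n i ω).1 * w n (V n i ω) := by
  obtain ⟨C, hC, hR⟩ := exists_abs_score_sub_le hp
  have hKm := hK.measurable
  have hη : Tendsto (fun n : ℕ => (M + 1) / √((n : ℝ) * h n)) atTop (𝓝 0) :=
    tendsto_const_nhds.div_atTop (Real.tendsto_sqrt_atTop.comp H.mul_tendsto_top)
  -- In the radius (M + 1) / √(nh), M bounds the increment t and 1 bounds δ, because √(nh) a_n ≤ 1
  -- eventually. The factor 2 counts two linearizations.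
  refine ⟨fun n q => 2 * C * (M + 1) * scoreModulus p q.2 ((M + 1) / √(n * h n)), ?_, ?_⟩
  · filter_upwards [hδ, ha.eventually_le_const one_pos,
      H.mul_tendsto_top.eventually_gt_atTop 0] with n hn han hN
    have hr0 : 0 < √((n : ℝ) * h n) := Real.sqrt_pos.2 hN
    set η := (M + 1) / √((n : ℝ) * h n) with hηdef
    filter_upwards [hμ.ae_prod_ne] with q hq hu t ht
    have hδn : |δ n q.1| ≤ 1 / √((n : ℝ) * h n) := by
      rw [le_div_iff₀ hr0]
      calc |δ n q.1| * √((n : ℝ) * h n) ≤ a n * √((n : ℝ) * h n) := by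
            gcongr
            exact hn _ hu
        _ ≤ 1 := by linarith
    have hsum : M / √((n : ℝ) * h n) + 1 / √((n : ℝ) * h n) = η := by rw [hηdef]; ring
    have hM' : 0 ≤ M / √((n : ℝ) * h n) := by positivity
    have hb : ∀ τ, |τ| ≤ η → |score p (q.2 - τ) - score p q.2 + (p - 1) * |q.2| ^ (p - 2) * τ| ≤
        C * η * scoreModulus p q.2 η := by
      intro τ hτ
      refine (hR q.2 τ hq).trans ?_
      have := scoreModulus_mono (p := p) (e := q.2) (abs_nonneg τ) hτ
      have := scoreModulus_nonneg (p := p) (e := q.2) (abs_nonneg τ)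
      gcongr
    -- The increment from e + δ to e + δ - t is the difference of two increments from e, namely -(t
    -- - δ) and δ; in the difference the linear terms combine to that of t.
    have h1 := hb (t - δ n q.1) ((abs_sub _ _).trans (by linarith))
    have h2 := hb (-δ n q.1) (by rw [abs_neg]; linarith)
    have h3 := abs_sub
      (score p (q.2 - (t - δ n q.1)) - score p q.2 + (p - 1) * |q.2| ^ (p - 2) * (t - δ n q.1))
      (score p (q.2 - -δ n q.1) - score p q.2 + (p - 1) * |q.2| ^ (p - 2) * (-δ n q.1))
    rw [show q.2 - (t - δ n q.1) = q.2 + δ n q.1 - t by ring,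
      show q.2 - -δ n q.1 = q.2 + δ n q.1 by ring] at *
    calc _ = |(score p (q.2 + δ n q.1 - t) - score p q.2 +
          (p - 1) * |q.2| ^ (p - 2) * (t - δ n q.1)) -
          (score p (q.2 + δ n q.1) - score p q.2 + (p - 1) * |q.2| ^ (p - 2) * (-δ n q.1))| := by
          congr 1; ring
      _ ≤ C * η * scoreModulus p q.2 η + C * η * scoreModulus p q.2 η :=
          h3.trans (add_le_add h1 h2)
      _ = (√(n * h n))⁻¹ * (2 * C * (M + 1) * scoreModulus p q.2 η) := by rw [hηdef]; ring
  · have hmain := H.tendstoZeroInProb_of_dominated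
      (k := fun n q => K q.1 * (2 * C * (M + 1) * scoreModulus p q.2 ((M + 1) / √(n * h n))))
      (G := fun q => K q.1 * (2 * C * (M + 1) * (|q.2| ^ (p - 2) + 1)))
      (fun n => (hKm.comp measurable_fst).mul
        (((measurable_scoreModulus _).comp measurable_snd).const_mul _))
      (hK.integrable.mul_prod ((hμ.integrable.add (integrable_const 1)).const_mul _))
      (by
        filter_upwards [hη.eventually_le_const one_pos] with n hn
        refine Eventually.of_forall fun q => ?_
        have h0 : 0 ≤ (M + 1) / √((n : ℝ) * h n) := by positivity
        have h1 := hK.nonneg q.1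
        have h2 := scoreModulus_nonneg (p := p) (e := q.2) h0
        rw [abs_of_nonneg (by positivity)]
        have := scoreModulus_le (p := p) (e := q.2) h0 hn
        gcongr)
      (fun n q hq => by simp [hK.support _ hq])
      (Eventually.of_forall fun q => by
        simpa using ((tendsto_scoreModulus (p := p) hη q.2).const_mul
          (2 * C * (M + 1))).const_mul (K q.1))
    simpa only [← Finset.mul_sum] using hmain

end IsScoreLaw

/-! ### The regression function near x -/

section Regression

variable {a b x : ℝ} {m : ℝ → ℝ}

/-- Nothing is assumed of m outside the interval, so it is cut off there; almost surely this changes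
no observation. -/
lemma measurable_indicator_of_continuousOn (hm : ContinuousOn m (Ioo a b)) :
    Measurable ((Ioo a b).indicator m) := by
  rw [← piecewise_eq_indicator]
  exact hm.measurable_piecewise continuousOn_const measurableSet_Ioo

/-- The derivative of m is C¹, hence Lipschitz near x, and the tangent estimate applies. -/
lemma exists_abs_sub_linear_le (hm : ContDiffOn ℝ 2 m (Ioo a b)) (hx : x ∈ Ioo a b) :
    ∃ C : ℝ, 0 ≤ C ∧ ∃ r > 0, ∀ y, |y| ≤ r →
      x + y ∈ Ioo a b ∧ |m (x + y) - m x - deriv m x * y| ≤ C * y ^ 2 := by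
  have hd : ContDiffOn ℝ 1 (deriv m) (Ioo a b) :=
    hm.deriv_of_isOpen isOpen_Ioo (by norm_num)
  obtain ⟨L, t, ht, hL⟩ :=
    (hd.contDiffAt (isOpen_Ioo.mem_nhds hx)).exists_lipschitzOnWith
  obtain ⟨r, hr, hball⟩ := Metric.mem_nhds_iff.1 (inter_mem ht (isOpen_Ioo.mem_nhds hx))
  have hmem : ∀ y, |y| ≤ r / 2 → x + y ∈ t ∧ x + y ∈ Ioo a b := fun y hy =>
    hball (by rw [Metric.mem_ball, Real.dist_eq, add_sub_cancel_left]; linarith)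
  refine ⟨L, L.2, r / 2, half_pos hr, fun y hy => ⟨(hmem y hy).2, ?_⟩⟩
  have hxt : x ∈ t := by simpa using (hmem 0 (by simpa using (half_pos hr).le)).1
  have := abs_sub_linear_le_of_hasDerivAt (g := m) (g' := fun s => deriv m (x + s)) (x := x)
    (r := r / 2) L.2 (fun s hs => ((hm.contDiffAt (isOpen_Ioo.mem_nhds
      (hmem s hs).2)).differentiableAt (by norm_num)).hasDerivAt) (fun s hs => by
      have := hL.dist_le_mul (x + s) (hmem s hs).1 x hxt
      rw [Real.dist_eq, Real.dist_eq, add_sub_cancel_left] at this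
      rwa [add_zero]) hy
  rw [add_zero] at this
  exact this

end Regression

/-! ### The mean score and continuity of translation -/

namespace IsScoreLaw

variable {Ω : Type*} [MeasurableSpace Ω] {P : Measure Ω} {f : ℝ → ℝ} {x : ℝ}
  {h : ℕ → ℝ} {μ : Measure ℝ} {V : ℕ → ℕ → Ω → ℝ × ℝ} {p : ℝ} {K : ℝ → ℝ}

lemma integrable_add_rpow [IsFiniteMeasure μ] (hp : 1 < p) (hμ : IsScoreLaw p μ) {c : ℝ}
    (hc : 0 ≤ c) : Integrable (fun e => (|e| + c) ^ (2 * p - 2)) μ := by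
  have hq : 0 ≤ 2 * p - 2 := by linarith
  have h1 : Integrable (fun e => |e| ^ (2 * p - 2)) μ := by
    simpa only [score_sq hp] using hμ.integrable_sq
  refine ((h1.add (integrable_const (c ^ (2 * p - 2)))).const_mul ((2 : ℝ) ^ (2 * p - 2))).mono'
    (Measurable.aestronglyMeasurable (by fun_prop)) (Eventually.of_forall fun e => ?_)
  rw [Real.norm_of_nonneg (by positivity), Pi.add_apply]
  have he := abs_nonneg e
  calc (|e| + c) ^ (2 * p - 2) ≤ (2 * max |e| c) ^ (2 * p - 2) := by
        refine Real.rpow_le_rpow (by positivity) ?_ hq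
        linarith [le_max_left |e| c, le_max_right |e| c]
    _ = 2 ^ (2 * p - 2) * max |e| c ^ (2 * p - 2) :=
        Real.mul_rpow (by norm_num) (he.trans (le_max_left _ _))
    _ ≤ 2 ^ (2 * p - 2) * (|e| ^ (2 * p - 2) + c ^ (2 * p - 2)) := by
        gcongr
        rcases max_choice |e| c with h | h <;> rw [h]
        · exact le_add_of_nonneg_right (by positivity)
        · exact le_add_of_nonneg_left (by positivity)

lemma abs_score_add_le (hp : 1 < p) {e t c : ℝ} (ht : |t| ≤ c) :
    |score p (e + t)| ≤ (|e| + c) ^ (p - 1) := by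
  rw [abs_score hp]
  exact Real.rpow_le_rpow (abs_nonneg _) ((abs_add_le _ _).trans (by linarith)) (by linarith)

lemma rpow_sub_one_sq {e c : ℝ} (hc : 0 ≤ c) :
    ((|e| + c) ^ (p - 1)) ^ 2 = (|e| + c) ^ (2 * p - 2) := by
  rw [← Real.rpow_natCast, ← Real.rpow_mul (by positivity)]
  congr 1
  push_cast
  ring

lemma integrable_add_rpow_sub_one [IsFiniteMeasure μ] (hp : 1 < p) (hμ : IsScoreLaw p μ) {c : ℝ}
    (hc : 0 ≤ c) : Integrable (fun e => (|e| + c) ^ (p - 1)) μ := by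
  refine ((memLp_two_iff_integrable_sq (Measurable.aestronglyMeasurable (by fun_prop))).2
    ?_).integrable one_le_two
  simpa only [rpow_sub_one_sq hc] using hμ.integrable_add_rpow hp hc

lemma integrable_score_add [IsFiniteMeasure μ] (hp : 1 < p) (hμ : IsScoreLaw p μ) (t : ℝ) :
    Integrable (fun e => score p (e + t)) μ := by
  have hsm := (continuous_score hp).measurable
  exact (hμ.integrable_add_rpow_sub_one hp (abs_nonneg t)).mono'
    (hsm.comp (measurable_add_const t)).aestronglyMeasurable
    (Eventually.of_forall fun e => abs_score_add_le hp le_rfl)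

/-- For p < 2 the singularity of the integrand's derivative moves with t, which hinders a locally
uniform domination. Instead the linearization at the fixed point e + t is integrated: the error is
|y| times the integral of the modulus, which vanishes by dominated convergence. -/
lemma hasDerivAt_integral_score [IsFiniteMeasure μ] (hp : 1 < p) (hμ : IsScoreLaw p μ) {t : ℝ}
    (ht : Integrable (fun e => |e + t| ^ (p - 2)) μ) (hne : p < 2 → ∀ᵐ e ∂μ, e + t ≠ 0) :
    HasDerivAt (fun t => ∫ e, score p (e + t) ∂μ) ((p - 1) * ∫ e, |e + t| ^ (p - 2) ∂μ) t := by
  obtain ⟨C, hC, hR⟩ := exists_abs_score_sub_le hp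
  have hne' : ∀ᵐ e ∂μ, p < 2 → e + t ≠ 0 := by
    by_cases h : p < 2
    · exact (hne h).mono fun e he _ => he
    · exact Eventually.of_forall fun e h' => absurd h' h
  have hI : Tendsto (fun y : ℝ => ∫ e, scoreModulus p (e + t) |y| ∂μ) (𝓝 0) (𝓝 0) := by
    have := tendsto_integral_filter_of_dominated_convergence (μ := μ) (l := 𝓝 (0 : ℝ))
      (F := fun y e => scoreModulus p (e + t) |y|) (f := fun _ => (0 : ℝ))
      (fun e => |e + t| ^ (p - 2) + 1)
      (Eventually.of_forall fun y => ((measurable_scoreModulus _).comp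
        (measurable_add_const t)).aestronglyMeasurable) ?_ (ht.add (integrable_const 1))
      (Eventually.of_forall fun e => tendsto_scoreModulus (by simpa using
        (tendsto_id (α := ℝ) (x := 𝓝 0)).abs) _)
    · simpa using this
    · have : ∀ᶠ y : ℝ in 𝓝 0, |y| ≤ 1 := by
        have := (continuous_abs (G := ℝ)).tendsto 0
        rw [abs_zero] at this
        exact this.eventually_le_const one_pos
      filter_upwards [this] with y hy
      refine Eventually.of_forall fun e => ?_
      rw [Real.norm_of_nonneg (scoreModulus_nonneg (abs_nonneg _))]
      exact scoreModulus_le (abs_nonneg _) hy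
  rw [hasDerivAt_iff_isLittleO_nhds_zero, isLittleO_iff]
  intro c hc
  have hCI := hI.const_mul C
  rw [mul_zero] at hCI
  have h1 : ∀ᶠ y : ℝ in 𝓝 0, |y| ≤ 1 := by
    have := (continuous_abs (G := ℝ)).tendsto 0
    rw [abs_zero] at this
    exact this.eventually_le_const one_pos
  filter_upwards [hCI.eventually_le_const hc, h1] with y hy hy1
  have hi1 := hμ.integrable_score_add hp (t + y)
  have hi2 := hμ.integrable_score_add hp t
  have hi3 : Integrable (fun e => score p (e + (t + y)) - score p (e + t)) μ := hi1.sub hi2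
  rw [smul_eq_mul, ← integral_const_mul, ← integral_const_mul, ← integral_sub hi1 hi2,
    ← integral_sub hi3 ((ht.const_mul _).const_mul _)]
  have hmod : Integrable (fun e => scoreModulus p (e + t) |y|) μ := by
    refine (ht.add (integrable_const 1)).mono' ((measurable_scoreModulus _).comp
        (measurable_add_const t)).aestronglyMeasurable (Eventually.of_forall fun e => ?_)
    rw [Real.norm_of_nonneg (scoreModulus_nonneg (abs_nonneg _))]
    exact scoreModulus_le (abs_nonneg _) hy1
  refine (norm_integral_le_of_norm_le (hmod.const_mul (C * |y|)) ?_).trans ?_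
  · filter_upwards [hne'] with e he
    have := hR (e + t) (-y) he
    rw [abs_neg] at this
    rw [Real.norm_eq_abs]
    refine le_of_eq_of_le ?_ this
    congr 1
    ring_nf
  · rw [integral_const_mul, Real.norm_eq_abs]
    calc C * |y| * ∫ e, scoreModulus p (e + t) |y| ∂μ
        = (C * ∫ e, scoreModulus p (e + t) |y| ∂μ) * |y| := by ring
      _ ≤ c * |y| := by gcongr

/-- A quadratic expansion of the mean score. -/
lemma exists_abs_integral_score_le [IsFiniteMeasure μ] (hp : 1 < p) (hμ : IsScoreLaw p μ)
    (hreg : ∀ᶠ t in 𝓝 (0 : ℝ), Integrable (fun e => |e + t| ^ (p - 2)) μ ∧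
      (p < 2 → ∀ᵐ e ∂μ, e + t ≠ 0))
    (hO : (fun t : ℝ => ∫ e, |e + t| ^ (p - 2) ∂μ - ∫ e, |e| ^ (p - 2) ∂μ) =O[𝓝 0] fun t => t) :
    ∃ C : ℝ, 0 ≤ C ∧ ∃ r > 0, ∀ t, |t| ≤ r →
      |∫ e, score p (e + t) ∂μ - (p - 1) * (∫ e, |e| ^ (p - 2) ∂μ) * t| ≤ C * t ^ 2 := by
  obtain ⟨C, hC, hCO⟩ := hO.exists_nonneg
  obtain ⟨r, hr, hball⟩ := Metric.eventually_nhds_iff.1 (hreg.and hCO.bound)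
  have hmem : ∀ t, |t| ≤ r / 2 → dist t 0 < r := fun t ht => by
    rw [Real.dist_eq, sub_zero]
    linarith
  refine ⟨(p - 1) * C, mul_nonneg (by linarith) hC, r / 2, half_pos hr, fun t ht => ?_⟩
  -- The derivative at s is (p-1) E|ε + s|^(p-2), and `hO` says that it differs from its value at 0
  -- by O(s).
  have := abs_sub_linear_le_of_hasDerivAt (g := fun t => ∫ e, score p (e + t) ∂μ) (x := 0)
    (g' := fun t => (p - 1) * ∫ e, |e + t| ^ (p - 2) ∂μ) (r := r / 2) (C := (p - 1) * C)
    (mul_nonneg (by linarith) hC) (fun s hs => by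
      obtain ⟨⟨h1, h2⟩, -⟩ := hball (hmem s hs)
      rw [zero_add]
      exact hμ.hasDerivAt_integral_score hp h1 h2) (fun s hs => by
      obtain ⟨-, h3⟩ := hball (hmem s hs)
      rw [Real.norm_eq_abs, Real.norm_eq_abs] at h3
      simp only [add_zero]
      rw [← mul_sub, abs_mul, abs_of_pos (show 0 < p - 1 by linarith), mul_assoc]
      exact mul_le_mul_of_nonneg_left h3 (by linarith)) ht
  simpa only [zero_add, add_zero, hμ.mean, sub_zero] using this

lemma tendsto_abs_add_rpow {e : ℝ} (he : p < 2 → e ≠ 0) {α : Type*} {l : Filter α} {t : α → ℝ}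
    (ht : Tendsto t l (𝓝 0)) :
    Tendsto (fun n => |e + t n| ^ (p - 2)) l (𝓝 (|e| ^ (p - 2))) := by
  have h1 : Tendsto (fun n => |e + t n|) l (𝓝 |e|) := by
    simpa using (ht.const_add e).abs
  refine (Real.continuousAt_rpow_const _ _ ?_).tendsto.comp h1
  by_cases h : p < 2
  · exact Or.inl (abs_pos.2 (he h)).ne'
  · exact Or.inr (by linarith)

/-- Continuity of translation, from convergence of the norms. -/
lemma tendsto_lintegral_sub (hμ : IsScoreLaw p μ)
    (hreg : ∀ᶠ t in 𝓝 (0 : ℝ), Integrable (fun e => |e + t| ^ (p - 2)) μ)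
    (hlim : Tendsto (fun t : ℝ => ∫ e, |e + t| ^ (p - 2) ∂μ) (𝓝 0) (𝓝 (∫ e, |e| ^ (p - 2) ∂μ))) :
    Tendsto (fun t : ℝ => ∫⁻ e, ‖|e + t| ^ (p - 2) - |e| ^ (p - 2)‖ₑ ∂μ) (𝓝 0) (𝓝 0) := by
  have hne : ∀ᵐ e ∂μ, p < 2 → e ≠ 0 := by
    by_cases h : p < 2
    · exact (hμ.ae_ne h).mono fun e he _ => he
    · exact Eventually.of_forall fun e h' => absurd h' h
  -- Scheffé's argument: |A - B| = (A - B) + 2 (B - A)⁺ with B = |e|^(p-2). The first term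
  -- integrates to a null sequence by `hlim`, and the positive part is dominated by B.
  have hpos : Tendsto (fun t : ℝ => ∫ e, max (|e| ^ (p - 2) - |e + t| ^ (p - 2)) 0 ∂μ)
      (𝓝 0) (𝓝 0) := by
    have := tendsto_integral_filter_of_dominated_convergence (μ := μ) (l := 𝓝 (0 : ℝ))
      (F := fun t e => max (|e| ^ (p - 2) - |e + t| ^ (p - 2)) 0) (f := fun _ => (0 : ℝ))
      (fun e => |e| ^ (p - 2))
      (Eventually.of_forall fun t => Measurable.aestronglyMeasurable (by fun_prop))
      (Eventually.of_forall fun t => Eventually.of_forall fun e => by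
        rw [Real.norm_of_nonneg (le_max_right _ _)]
        have h1 : 0 ≤ |e + t| ^ (p - 2) := by positivity
        have h2 : 0 ≤ |e| ^ (p - 2) := by positivity
        exact max_le (by linarith) h2) hμ.integrable (by
        filter_upwards [hne] with e he
        have := ((tendsto_abs_add_rpow he (tendsto_id (x := 𝓝 (0 : ℝ)))).const_sub
          (|e| ^ (p - 2))).max (tendsto_const_nhds (x := (0 : ℝ)))
        simpa using this)
    simpa using this
  have hsum := (hlim.sub_const (∫ e, |e| ^ (p - 2) ∂μ)).add (hpos.const_mul 2)
  rw [sub_self, mul_zero, add_zero] at hsum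
  have := ENNReal.tendsto_ofReal hsum
  rw [ENNReal.ofReal_zero] at this
  refine this.congr' ?_
  filter_upwards [hreg] with t ht
  have hmax : Integrable (fun e => max (|e| ^ (p - 2) - |e + t| ^ (p - 2)) 0) μ :=
    (hμ.integrable.sub ht).pos_part
  have hd : Integrable (fun e => |e + t| ^ (p - 2) - |e| ^ (p - 2)) μ := ht.sub hμ.integrable
  rw [← ofReal_integral_norm_eq_lintegral_enorm hd,
    ← integral_sub ht hμ.integrable, ← integral_const_mul,
    ← integral_add hd (hmax.const_mul 2)]
  congr 1
  refine integral_congr_ae (Eventually.of_forall fun e => ?_)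
  simp only [Real.norm_eq_abs]
  rcases le_total (|e| ^ (p - 2)) (|e + t| ^ (p - 2)) with hle | hle
  · rw [abs_of_nonneg (sub_nonneg.2 hle), max_eq_right (sub_nonpos.2 hle)]; ring
  · rw [abs_of_nonpos (sub_nonpos.2 hle), max_eq_left (sub_nonneg.2 hle)]; ring

end IsScoreLaw

/-! ### A law of large numbers from conditional means -/

namespace IsLocalSample

variable {Ω : Type*} [MeasurableSpace Ω] {P : Measure Ω} {f : ℝ → ℝ} {x : ℝ}
  {h : ℕ → ℝ} {μ : Measure ℝ} {V : ℕ → ℕ → Ω → ℝ × ℝ} {κ : ℝ → ℝ}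

/-- A law of large numbers in `L¹` with limit zero, from bounds for the conditional means. -/
lemma tendstoZeroInProb_of_lintegral_le [SFinite μ] (H : IsLocalSample P f x h μ V)
    {k : ℕ → ℝ × ℝ → ℝ} {c : ℕ → ENNReal} (hk : ∀ n, Measurable (k n)) (hκ : Integrable κ)
    (hc : Tendsto c atTop (𝓝 0)) (hsupp : ∀ n q, 1 < |q.1| → k n q = 0)
    (hbound : ∀ᶠ n in atTop, ∀ u, |u| ≤ 1 → ∫⁻ e, ‖k n (u, e)‖ₑ ∂μ ≤ ‖κ u‖ₑ * c n) :
    TendstoZeroInProb P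
      fun n ω => ∑ i ∈ Finset.range n, ((n : ℝ) * h n)⁻¹ * k n (V n i ω) := by
  have hfm := H.measurable
  refine H.tendstoZeroInProb_of_lintegral (g := fun n q => ((n : ℝ) * h n)⁻¹ * k n q)
    (fun n => (hk n).const_mul _) ?_
  set A : ENNReal := ENNReal.ofReal (f x + 1) * ∫⁻ u, ‖κ u‖ₑ with hA
  have hAtop : A ≠ ⊤ := ENNReal.mul_ne_top ENNReal.ofReal_ne_top hκ.2.ne
  have hlim : Tendsto (fun n => A * c n) atTop (𝓝 0) := by
    simpa using ENNReal.Tendsto.const_mul hc (Or.inr hAtop)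
  refine tendsto_of_tendsto_of_tendsto_of_le_of_le' tendsto_const_nhds hlim
    (Eventually.of_forall fun _ => zero_le) ?_
  filter_upwards [hbound, H.eventually_density_le, H.mul_tendsto_top.eventually_gt_atTop 0]
    with n hb hf hN
  have hh := H.pos n
  have hn : (n : ℝ) ≠ 0 := fun h0 => by rw [h0, zero_mul] at hN; exact lt_irrefl _ hN
  rw [localLaw, lintegral_withDensity_eq_lintegral_mul _ (by fun_prop)
    (((hk n).const_mul _).enorm), ← lintegral_const_mul _ (by have := hk n; fun_prop)]
  calc _ = ∫⁻ q, ENNReal.ofReal (f (x + h n * q.1)) * ‖k n q‖ₑ ∂volume.prod μ := by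
        refine lintegral_congr fun q => ?_
        simp only [Pi.mul_apply]
        rw [enorm_mul, ENNReal.ofReal_mul hh.le, Real.enorm_eq_ofReal (inv_pos.2 hN).le]
        calc _ = ((n : ENNReal) * ENNReal.ofReal (h n) * ENNReal.ofReal ((n : ℝ) * h n)⁻¹) *
              (ENNReal.ofReal (f (x + h n * q.1)) * ‖k n q‖ₑ) := by ring
          _ = _ := by
            rw [← ENNReal.ofReal_natCast, ← ENNReal.ofReal_mul (by positivity),
              ← ENNReal.ofReal_mul hN.le, mul_inv_cancel₀ hN.ne', ENNReal.ofReal_one, one_mul]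
    -- Integrating over the error first uses the conditional bound; the density is then bounded on
    -- |u| ≤ 1.
    _ = ∫⁻ u, ∫⁻ e, ENNReal.ofReal (f (x + h n * u)) * ‖k n (u, e)‖ₑ ∂μ :=
        lintegral_prod _ (by have := hk n; fun_prop)
    _ ≤ ∫⁻ u, ENNReal.ofReal (f x + 1) * (‖κ u‖ₑ * c n) := by
        refine lintegral_mono fun u => ?_
        rw [lintegral_const_mul _ (by have := hk n; fun_prop)]
        by_cases hu : 1 < |u|
        · have h0 : ∀ e, k n (u, e) = 0 := fun e => hsupp n (u, e) hu
          simp [h0]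
        · rw [not_lt] at hu
          gcongr
          · exact hf u hu
          · exact hb u hu
    _ = A * c n := by
        rw [lintegral_const_mul'' _ (by have := hκ.1; fun_prop), lintegral_mul_const'' _
          hκ.1.enorm, hA, mul_assoc]

end IsLocalSample

/-! ### Residuals of order h, for the local constant fit -/

namespace IsScoreLaw

variable {Ω : Type*} [MeasurableSpace Ω] {P : Measure Ω} {f : ℝ → ℝ} {x : ℝ}
  {h : ℕ → ℝ} {μ : Measure ℝ} {V : ℕ → ℕ → Ω → ℝ × ℝ} {p : ℝ} {K : ℝ → ℝ}
  {δ : ℕ → ℝ → ℝ} {a : ℕ → ℝ}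

/-- Lets the score be linearized at e + δ when p < 2. By Fubini it is enough to treat each u, where
δ is a fixed small shift. -/
lemma ae_prod_add_ne [SFinite μ]
    (hreg : ∀ᶠ t in 𝓝 (0 : ℝ), p < 2 → ∀ᵐ e ∂μ, e + t ≠ 0) (hδm : ∀ n, Measurable (δ n))
    (hδ : ∀ᶠ n in atTop, ∀ u, |u| ≤ 1 → |δ n u| ≤ a n) (ha : Tendsto a atTop (𝓝 0)) :
    ∀ᶠ n in atTop, ∀ᵐ q ∂(volume : Measure ℝ).prod μ, |q.1| ≤ 1 → p < 2 →
      q.2 + δ n q.1 ≠ 0 := by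
  by_cases hp : p < 2
  swap
  · exact Eventually.of_forall fun n => Eventually.of_forall fun q _ h => absurd h hp
  obtain ⟨r, hr, hball⟩ := Metric.eventually_nhds_iff.1 hreg
  filter_upwards [hδ, ha.eventually_lt_const hr] with n hn han
  have hdm := hδm n
  have hset : MeasurableSet {q : ℝ × ℝ | |q.1| ≤ 1 → p < 2 → q.2 + δ n q.1 ≠ 0} := by
    have h1 : MeasurableSet {q : ℝ × ℝ | |q.1| ≤ 1} :=
      measurableSet_le (by fun_prop) measurable_const
    have h2 : MeasurableSet {q : ℝ × ℝ | q.2 + δ n q.1 = 0} :=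
      measurableSet_eq_fun (by fun_prop) measurable_const
    have : {q : ℝ × ℝ | |q.1| ≤ 1 → p < 2 → q.2 + δ n q.1 ≠ 0} =
        {q : ℝ × ℝ | |q.1| ≤ 1}ᶜ ∪ {q : ℝ × ℝ | q.2 + δ n q.1 = 0}ᶜ := by
      ext q
      simp only [mem_ofPred_eq, mem_union, mem_compl_iff]
      tauto
    rw [this]
    exact h1.compl.union h2.compl
  refine (Measure.ae_prod_iff_ae_ae hset).2 (Eventually.of_forall fun u => ?_)
  by_cases hu : |u| ≤ 1
  · refine (hball (y := δ n u) ?_ hp).mono fun e he _ _ => he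
    rw [Real.dist_eq, sub_zero]
    exact (hn u hu).trans_lt han
  · exact Eventually.of_forall fun e h' => absurd h' hu

/-- Separates a part dominated by |e|^(p-2) + 1 for η ≤ 1 from the change of |e|^(p-2) under
translation, which for p < 2 is controlled only in L¹. -/
lemma scoreModulus_add_le {e t η : ℝ} (hη : 0 ≤ η) : scoreModulus p (e + t) η ≤
    (if p = 2 then 0 else |e| ^ (p - 2) * min 1 (η / |e + t|)) +
      (if 2 < p then η ^ (p - 2) else 0) + abs (|e + t| ^ (p - 2) - |e| ^ (p - 2)) := by
  have h0 : 0 ≤ min 1 (η / |e + t|) := le_min zero_le_one (by positivity)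
  have h1 := min_le_left 1 (η / |e + t|)
  have h2 := le_abs_self (|e + t| ^ (p - 2) - |e| ^ (p - 2))
  have h3 := abs_nonneg (|e + t| ^ (p - 2) - |e| ^ (p - 2))
  unfold scoreModulus
  split_ifs
  · linarith
  · linarith
  · nlinarith
  · nlinarith

/-- An integrable envelope for the linearization error of the score, when the regression residuals
tend to zero and `E|ε + t|^(p-2)` is continuous at `t = 0`. -/
lemma exists_envelope_of_tendsto_integral [IsProbabilityMeasure μ] (hp : 1 < p)
    (hμ : IsScoreLaw p μ) (H : IsLocalSample P f x h μ V) (hK : IsSmoothingKernel K)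
    (hreg : ∀ᶠ t in 𝓝 (0 : ℝ), Integrable (fun e => |e + t| ^ (p - 2)) μ ∧
      (p < 2 → ∀ᵐ e ∂μ, e + t ≠ 0))
    (hlim : Tendsto (fun t : ℝ => ∫ e, |e + t| ^ (p - 2) ∂μ) (𝓝 0) (𝓝 (∫ e, |e| ^ (p - 2) ∂μ)))
    (hδm : ∀ n, Measurable (δ n)) (hδ : ∀ᶠ n in atTop, ∀ u, |u| ≤ 1 → |δ n u| ≤ a n)
    (ha : Tendsto a atTop (𝓝 0)) {M : ℝ} (hM : 0 < M) :
    ∃ w : ℕ → ℝ × ℝ → ℝ,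
      (∀ᶠ n : ℕ in atTop, ∀ᵐ q ∂volume.prod μ, |q.1| ≤ 1 → ∀ t, |t| ≤ M / √(n * h n) →
        |score p (q.2 + δ n q.1 - t) - score p (q.2 + δ n q.1) + (p - 1) * |q.2| ^ (p - 2) * t| ≤
          (√(n * h n))⁻¹ * w n q) ∧
      TendstoZeroInProb P fun n ω => ((n : ℝ) * h n)⁻¹ * ∑ i ∈ Finset.range n,
        K (V n i ω).1 * w n (V n i ω) := by
  obtain ⟨C, hC, hR⟩ := exists_abs_score_sub_le hp
  have hKm := hK.measurable
  have hp1 : 0 ≤ p - 1 := by linarith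
  have hη : Tendsto (fun n : ℕ => M / √((n : ℝ) * h n)) atTop (𝓝 0) :=
    tendsto_const_nhds.div_atTop (Real.tendsto_sqrt_atTop.comp H.mul_tendsto_top)
  -- The part B of the envelope goes to 0 by dominated convergence. The part D goes to 0 through its
  -- conditional mean given u, by continuity of translation in L¹.
  set B : ℕ → ℝ × ℝ → ℝ := fun n q =>
    (if p = 2 then 0 else |q.2| ^ (p - 2) * min 1 ((M / √(n * h n)) / |q.2 + δ n q.1|)) +
      (if 2 < p then (M / √(n * h n)) ^ (p - 2) else 0) with hB
  set D : ℕ → ℝ × ℝ → ℝ := fun n q =>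
    abs (|q.2 + δ n q.1| ^ (p - 2) - |q.2| ^ (p - 2)) with hD
  have hBm : ∀ n, Measurable (B n) := fun n => by
    have := hδm n
    simp only [hB]
    split_ifs <;> fun_prop
  have hDm : ∀ n, Measurable (D n) := fun n => by
    have := hδm n
    simp only [hD]
    exact Measurable.abs (by fun_prop)
  refine ⟨fun n q => M * C * B n q + M * (C + (p - 1)) * D n q, ?_, ?_⟩
  · filter_upwards [ae_prod_add_ne (hreg.mono fun t ht => ht.2) hδm hδ ha,
      H.mul_tendsto_top.eventually_gt_atTop 0] with n hn hN
    have hr0 : 0 < √((n : ℝ) * h n) := Real.sqrt_pos.2 hN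
    filter_upwards [hn] with q hq hu t ht
    set η := M / √((n : ℝ) * h n) with hηdef
    have hη0 : 0 ≤ η := by positivity
    have h1 := hR (q.2 + δ n q.1) t (hq hu)
    have h2 : scoreModulus p (q.2 + δ n q.1) |t| ≤ B n q + D n q :=
      (scoreModulus_mono (abs_nonneg t) ht).trans (scoreModulus_add_le hη0)
    have h2' := scoreModulus_nonneg (p := p) (e := q.2 + δ n q.1) (abs_nonneg t)
    have hD0 : 0 ≤ D n q := abs_nonneg _
    have h3 : |(p - 1) * (|q.2| ^ (p - 2) - |q.2 + δ n q.1| ^ (p - 2)) * t| =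
        (p - 1) * D n q * |t| := by
      rw [abs_mul, abs_mul, abs_of_nonneg hp1, abs_sub_comm]
    calc _ = |(score p (q.2 + δ n q.1 - t) - score p (q.2 + δ n q.1) +
          (p - 1) * |q.2 + δ n q.1| ^ (p - 2) * t) +
          (p - 1) * (|q.2| ^ (p - 2) - |q.2 + δ n q.1| ^ (p - 2)) * t| := by
          congr 1; ring
      _ ≤ C * |t| * scoreModulus p (q.2 + δ n q.1) |t| + (p - 1) * D n q * |t| :=
          (abs_add_le _ _).trans (add_le_add h1 h3.le)
      _ ≤ C * η * (B n q + D n q) + (p - 1) * D n q * η := by gcongr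
      _ = (√(n * h n))⁻¹ * (M * C * B n q + M * (C + (p - 1)) * D n q) := by
          rw [hηdef]; ring
  · have h1 := H.tendstoZeroInProb_of_dominated (k := fun n q => K q.1 * B n q)
      (G := fun q => K q.1 * (|q.2| ^ (p - 2) + 1))
      (fun n => (hKm.comp measurable_fst).mul (hBm n))
      (hK.integrable.mul_prod (hμ.integrable.add (integrable_const 1)))
      (by
        filter_upwards [hη.eventually_le_const one_pos] with n hn
        refine Eventually.of_forall fun q => ?_
        have hη0 : 0 ≤ M / √((n : ℝ) * h n) := by positivity
        have h0 : 0 ≤ min 1 ((M / √((n : ℝ) * h n)) / |q.2 + δ n q.1|) :=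
          le_min zero_le_one (by positivity)
        have h1 : 0 ≤ |q.2| ^ (p - 2) := by positivity
        have hB0 : 0 ≤ B n q := by
          simp only [hB]
          split_ifs <;> positivity
        rw [abs_of_nonneg (mul_nonneg (hK.nonneg _) hB0)]
        refine mul_le_mul_of_nonneg_left ?_ (hK.nonneg _)
        refine add_le_add ?_ ?_
        · split_ifs
          · exact h1
          · exact mul_le_of_le_one_right h1 (min_le_left _ _)
        · split_ifs with h3
          · exact Real.rpow_le_one hη0 hn (by linarith)
          · exact zero_le_one)
      (fun n q hq => by simp [hK.support _ hq])
      (by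
        filter_upwards [hμ.ae_prod_ne] with q hq
        by_cases hu : 1 < |q.1|
        · simp [hK.support _ hu]
        rw [not_lt] at hu
        have hδ0 : Tendsto (fun n => δ n q.1) atTop (𝓝 0) :=
          squeeze_zero_norm' (hδ.mono fun n hn => hn _ hu) ha
        have hB1 : Tendsto (fun n : ℕ => if p = 2 then 0 else
            |q.2| ^ (p - 2) * min 1 ((M / √(n * h n)) / |q.2 + δ n q.1|)) atTop (𝓝 0) := by
          split_ifs with hp2
          · exact tendsto_const_nhds
          by_cases he : q.2 = 0
          · have : p - 2 ≠ 0 := sub_ne_zero.2 hp2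
            simp [he, Real.zero_rpow this]
          · have h4 : Tendsto (fun n => |q.2 + δ n q.1|) atTop (𝓝 |q.2|) := by
              simpa using (hδ0.const_add q.2).abs
            have h5 := hη.div h4 (abs_pos.2 he).ne'
            have := ((tendsto_const_nhds (x := (1 : ℝ))).min h5).const_mul (|q.2| ^ (p - 2))
            simpa using this
        have hB2 : Tendsto (fun n : ℕ => if 2 < p then (M / √((n : ℝ) * h n)) ^ (p - 2) else 0)
            atTop (𝓝 0) := by
          split_ifs with h2
          · have := (Real.continuousAt_rpow_const 0 (p - 2)
              (Or.inr (by linarith))).tendsto.comp hη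
            rwa [Real.zero_rpow (by linarith)] at this
          · exact tendsto_const_nhds
        have := (hB1.add hB2).const_mul (K q.1)
        rw [add_zero, mul_zero] at this
        exact this)
    set Φ : ℝ → ENNReal := fun t => ∫⁻ e, ‖|e + t| ^ (p - 2) - |e| ^ (p - 2)‖ₑ ∂μ with hΦ
    have hΦ0 : Tendsto Φ (𝓝 0) (𝓝 0) := hμ.tendsto_lintegral_sub (hreg.mono fun t ht => ht.1) hlim
    -- All shifts δ(u) with |u| ≤ 1 are at most a_n, so the supremum of the L¹ modulus over that
    -- range bounds every conditional mean.
    have hc : Tendsto (fun n => ⨆ t ∈ {t : ℝ | |t| ≤ a n}, Φ t) atTop (𝓝 0) := by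
      rw [ENNReal.tendsto_nhds_zero]
      intro r hr
      obtain ⟨s, hs, hball⟩ := Metric.eventually_nhds_iff.1 (ENNReal.tendsto_nhds_zero.1 hΦ0 r hr)
      filter_upwards [ha.eventually_lt_const hs] with n hn
      refine iSup₂_le fun t ht => hball ?_
      rw [Real.dist_eq, sub_zero]
      exact lt_of_le_of_lt ht hn
    have h2 := H.tendstoZeroInProb_of_lintegral_le (k := fun n q => K q.1 * D n q)
      (fun n => (hKm.comp measurable_fst).mul (hDm n)) hK.integrable hc
      (fun n q hq => by simp [hK.support _ hq]) (by
        filter_upwards [hδ] with n hn u hu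
        simp only [enorm_mul]
        have hDu : Measurable fun e => ‖D n (u, e)‖ₑ :=
          ((hDm n).comp measurable_prodMk_left).enorm
        rw [lintegral_const_mul _ hDu]
        gcongr
        refine le_trans (le_of_eq ?_) (le_iSup₂ (f := fun t (_ : t ∈ {t : ℝ | |t| ≤ a n}) => Φ t)
          (δ n u) (hn u hu))
        simp only [hΦ, hD]
        refine lintegral_congr fun e => ?_
        rw [← Real.norm_eq_abs, enorm_norm])
    refine ((h1.const_mul (M * C)).add (h2.const_mul (M * (C + (p - 1))))).of_abs_le
      (Eventually.of_forall fun n => Eventually.of_forall fun ω => le_of_eq ?_)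
    congr 1
    simp only [Finset.mul_sum, ← Finset.sum_add_distrib]
    refine Finset.sum_congr rfl fun i _ => ?_
    ring

/-- The regression residuals of a local constant fit do not contribute to the score, when they are
asymptotically linear and the bias terms of order `h²` are negligible. -/
lemma tendstoZeroInProb_bias_of_linear [IsProbabilityMeasure P] [IsProbabilityMeasure μ]
    (hp : 1 < p) (hμ : IsScoreLaw p μ) (H : IsLocalSample P f x h μ V)
    (hK : IsSmoothingKernel K) {C r : ℝ} (hC : 0 ≤ C) (hr : 0 < r)
    (hexp : ∀ t, |t| ≤ r →
      |∫ e, score p (e + t) ∂μ - (p - 1) * (∫ e, |e| ^ (p - 2) ∂μ) * t| ≤ C * t ^ 2)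
    (hδm : ∀ n, Measurable (δ n)) {A A' L F : ℝ}
    (hδ : ∀ᶠ n in atTop, ∀ u, |u| ≤ 1 → |δ n u| ≤ A * h n)
    (hδ' : ∀ᶠ n in atTop, ∀ u, |u| ≤ 1 → |δ n u - L * (h n * u)| ≤ A' * h n ^ 2)
    (hf : ∀ᶠ n in atTop, ∀ u, |u| ≤ 1 → |f (x + h n * u) - f x| ≤ F * h n)
    (hh : Tendsto (fun n : ℕ => √(n * h n) * h n ^ 2) atTop (𝓝 0)) :
    TendstoZeroInProb P fun n ω => (√(n * h n))⁻¹ * ∑ i ∈ Finset.range n,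
      K (V n i ω).1 * (score p ((V n i ω).2 + δ n (V n i ω).1) - score p (V n i ω).2) := by
  have hKm := hK.measurable
  have hsm := (continuous_score hp).measurable
  have hA : Tendsto (fun n => A * h n) atTop (𝓝 0) := by
    simpa using H.tendsto_zero.const_mul A
  have hfm := H.measurable
  set c : ℝ := (p - 1) * ∫ e, |e| ^ (p - 2) ∂μ with hc
  have hc0 : 0 ≤ c := mul_nonneg (by linarith) hμ.pos.le
  clear_value c
  have hbd : ∀ᶠ n in atTop, ∀ q : ℝ × ℝ, |K q.1 * (score p (q.2 + δ n q.1) - score p q.2)| ≤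
      K q.1 * (2 * (|q.2| + 1) ^ (p - 1)) := by
    filter_upwards [hδ, hA.eventually_le_const one_pos] with n hn han q
    rw [abs_mul, abs_of_nonneg (hK.nonneg _)]
    by_cases hu : 1 < |q.1|
    · simp [hK.support _ hu]
    · refine mul_le_mul_of_nonneg_left ((abs_sub _ _).trans ?_) (hK.nonneg _)
      have h1 := abs_score_add_le hp (e := q.2) ((hn q.1 (not_lt.1 hu)).trans han)
      have h2 := abs_score_add_le hp (e := q.2) (t := 0) (c := 1) (by simp)
      rw [add_zero] at h2
      linarith
  have hbint : Integrable (fun q : ℝ × ℝ => K q.1 * (2 * (|q.2| + 1) ^ (p - 1)))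
      (volume.prod μ) :=
    hK.integrable.mul_prod ((hμ.integrable_add_rpow_sub_one hp zero_le_one).const_mul 2)
  -- Although δ is only O(h), the second moment of the score difference tends to 0 by continuity of
  -- the score. Hence the fluctuations vanish, and only the mean requires an expansion.
  have hmain := H.tendstoZeroInProb_of_sq_dominated
    (g := fun n q => (√(n * h n))⁻¹ * (K q.1 * (score p (q.2 + δ n q.1) - score p q.2)))
    (G := fun q => K q.1 ^ 2 * (4 * (|q.2| + 1) ^ (2 * p - 2))) (c := 0)
    (fun n => by have := hδm n; fun_prop)
    (hK.sq_integrable.integrable_sq.mul_prod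
      ((hμ.integrable_add_rpow hp zero_le_one).const_mul 4))
    (by
      filter_upwards [hbd, H.mul_tendsto_top.eventually_gt_atTop 0] with n hn hN
      refine Eventually.of_forall fun q => ?_
      have h1 := sq_le_sq' (neg_le_of_abs_le (hn q)) (le_of_abs_le (hn q))
      rw [mul_pow, inv_pow, Real.sq_sqrt hN.le, ← mul_assoc, mul_inv_cancel₀ hN.ne', one_mul]
      refine h1.trans (le_of_eq ?_)
      rw [mul_pow, mul_pow, rpow_sub_one_sq zero_le_one]
      norm_num)
    (fun n q hq => by simp [hK.support _ hq])
    (by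
      refine Eventually.of_forall fun q => ?_
      have h0 : Tendsto (fun n => (K q.1 * (score p (q.2 + δ n q.1) - score p q.2)) ^ 2) atTop
          (𝓝 0) := by
        by_cases hu : 1 < |q.1|
        · simp [hK.support _ hu]
        rw [not_lt] at hu
        have hδ0 : Tendsto (fun n => δ n q.1) atTop (𝓝 0) :=
          squeeze_zero_norm' (hδ.mono fun n hn => hn _ hu) hA
        have h1 : Tendsto (fun n => score p (q.2 + δ n q.1)) atTop (𝓝 (score p q.2)) := by
          have := (continuous_score hp).continuousAt (x := q.2)
          exact this.tendsto.comp (by simpa using hδ0.const_add q.2)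
        simpa using ((h1.sub_const (score p q.2)).const_mul (K q.1)).pow 2
      refine h0.congr' ?_
      filter_upwards [H.mul_tendsto_top.eventually_gt_atTop 0] with n hN
      rw [mul_pow (√((n : ℝ) * h n))⁻¹, inv_pow, Real.sq_sqrt hN.le, ← mul_assoc,
        mul_inv_cancel₀ hN.ne', one_mul])
    (by
      -- C A² comes from the quadratic error of the mean score, c A' from the part of δ beyond its
      -- linear term, and F c |L| from the variation of the density against that linear term. Each
      -- carries a factor h².
      set C' : ℝ := (f x + 1) * (C * A ^ 2 + c * A') + F * (c * |L|) with hC'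
      have hlim : Tendsto (fun n : ℕ => C' * (√(n * h n) * h n ^ 2)) atTop (𝓝 0) := by
        simpa using hh.const_mul C'
      refine squeeze_zero_norm' ?_ hlim
      filter_upwards [hbd, H.mul_tendsto_top.eventually_gt_atTop 0, hδ, hδ', hf,
        hA.eventually_le_const hr, H.eventually_density_le] with n hn hN hd hd' hfn hAr hfle
      have hr0 : 0 < √((n : ℝ) * h n) := Real.sqrt_pos.2 hN
      have hdm := hδm n
      have hF : Integrable (fun q : ℝ × ℝ =>
          f (x + h n * q.1) * (K q.1 * (score p (q.2 + δ n q.1) - score p q.2)))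
          (volume.prod μ) := by
        refine (hbint.const_mul (f x + 1)).mono'
          (Measurable.aestronglyMeasurable (by fun_prop)) (Eventually.of_forall fun q => ?_)
        rw [norm_mul, Real.norm_of_nonneg (H.nonneg _), Real.norm_eq_abs]
        by_cases hu : 1 < |q.1|
        · simp [hK.support _ hu]
        · exact mul_le_mul (hfle _ (not_lt.1 hu)) (hn q) (abs_nonneg _)
            (add_nonneg (H.nonneg _) zero_le_one)
      have hmean : (n : ℝ) * ∫ q, (√(n * h n))⁻¹ *
          (K q.1 * (score p (q.2 + δ n q.1) - score p q.2)) ∂localLaw f x (h n) μ =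
          √(n * h n) * ∫ u, ∫ e, f (x + h n * u) *
            (K u * (score p (e + δ n u) - score p e)) ∂μ := by
        have h1 := H.natCast_mul_integral (fun q => (√(n * h n))⁻¹ *
          (K q.1 * (score p (q.2 + δ n q.1) - score p q.2))) n
        rw [smul_eq_mul] at h1
        rw [h1, H.integral_localLaw, ← integral_prod _ hF, ← integral_const_mul]
        refine integral_congr_ae (Eventually.of_forall fun q => ?_)
        simp only [smul_eq_mul]
        have h2 : (n : ℝ) * h n = √((n : ℝ) * h n) * √((n : ℝ) * h n) :=
          (Real.mul_self_sqrt hN.le).symm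
        have h3 : (n : ℝ) * h n * (√((n : ℝ) * h n))⁻¹ = √((n : ℝ) * h n) := by
          rw [div_eq_mul_inv .. |>.symm, Real.div_sqrt]
        rw [← mul_assoc ((n : ℝ) * h n), h3]
        ring
      have hinner : ∀ u, ∫ e, f (x + h n * u) * (K u * (score p (e + δ n u) - score p e)) ∂μ =
          f (x + h n * u) * (K u * ∫ e, score p (e + δ n u) ∂μ) := fun u => by
        rw [integral_const_mul, integral_const_mul, integral_sub
          (hμ.integrable_score_add hp _) (hμ.integrable_score hp), hμ.mean, sub_zero]
      have hL1 : Integrable (fun u => f (x + h n * u) * (K u * ∫ e, score p (e + δ n u) ∂μ)) := by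
        have := hF.integral_prod_left
        simpa only [hinner] using this
      have hKu : Integrable (fun u => K u * u) := hK.integrable_mul measurable_id fun u hu => hu
      have hsymm : ∫ u, K u * u = 0 := by
        have h1 := integral_neg_eq_self (fun u => K u * u) volume
        simp only [hK.symm, mul_neg, integral_neg] at h1
        linarith
      -- The subtracted term is the whole contribution of order h; it is odd in u and integrates to
      -- 0.
      have hsub : ∫ u, f (x + h n * u) * (K u * ∫ e, score p (e + δ n u) ∂μ) =
          ∫ u, (f (x + h n * u) * (K u * ∫ e, score p (e + δ n u) ∂μ) -
            f x * c * L * h n * (K u * u)) := by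
        rw [integral_sub hL1 (hKu.const_mul _), integral_const_mul, hsymm, mul_zero, sub_zero]
      have hbound : |∫ u, f (x + h n * u) * (K u * ∫ e, score p (e + δ n u) ∂μ)| ≤
          C' * h n ^ 2 := by
        rw [hsub]
        have h1 := norm_integral_le_of_norm_le (hK.integrable.const_mul (C' * h n ^ 2))
          (f := fun u => f (x + h n * u) * (K u * ∫ e, score p (e + δ n u) ∂μ) -
            f x * c * L * h n * (K u * u)) (Eventually.of_forall fun u => ?_)
        · rwa [integral_const_mul, hK.integral_eq_one, mul_one] at h1
        by_cases hu : 1 < |u|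
        · simp [hK.support _ hu]
        rw [not_lt] at hu
        have hhn := H.pos n
        have hK0 := hK.nonneg u
        have e1 := hexp (δ n u) ((hd u hu).trans hAr)
        set J := ∫ e, score p (e + δ n u) ∂μ
        have e2 : C * δ n u ^ 2 ≤ C * (A * h n) ^ 2 := by
          refine mul_le_mul_of_nonneg_left ?_ hC
          exact sq_le_sq' (neg_le_of_abs_le (hd u hu)) (le_of_abs_le (hd u hu))
        have e3 := hd' u hu
        have e4 : |J - c * (L * (h n * u))| ≤ (C * A ^ 2 + c * A') * h n ^ 2 := by
          calc |J - c * (L * (h n * u))|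
              = |(J - c * δ n u) + c * (δ n u - L * (h n * u))| := by congr 1; ring
            _ ≤ C * (A * h n) ^ 2 + c * (A' * h n ^ 2) := by
              refine (abs_add_le _ _).trans (add_le_add (e1.trans e2) ?_)
              rw [abs_mul, abs_of_nonneg hc0]
              gcongr
            _ = _ := by ring
        have e5 : |c * (L * (h n * u))| ≤ c * |L| * h n := by
          rw [abs_mul, abs_mul, abs_mul, abs_of_nonneg hc0, abs_of_pos hhn]
          calc c * (|L| * (h n * |u|)) ≤ c * (|L| * (h n * 1)) := by gcongr
            _ = _ := by ring
        rw [Real.norm_eq_abs]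
        calc _ = |K u * (f (x + h n * u) * (J - c * (L * (h n * u))) +
              (f (x + h n * u) - f x) * (c * (L * (h n * u))))| := by congr 1; ring
          _ ≤ K u * ((f x + 1) * ((C * A ^ 2 + c * A') * h n ^ 2) +
              F * h n * (c * |L| * h n)) := by
            rw [abs_mul, abs_of_nonneg hK0]
            refine mul_le_mul_of_nonneg_left ((abs_add_le _ _).trans (add_le_add ?_ ?_)) hK0
            · rw [abs_mul, abs_of_nonneg (H.nonneg _)]
              exact mul_le_mul (hfle u hu) e4 (abs_nonneg _)
                (add_nonneg (H.nonneg _) zero_le_one)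
            · rw [abs_mul]
              exact mul_le_mul (hfn u hu) e5 (abs_nonneg _) ((abs_nonneg _).trans (hfn u hu))
          _ = C' * h n ^ 2 * K u := by rw [hC']; ring
      rw [hmean, Real.norm_eq_abs, abs_mul, abs_of_pos hr0]
      simp only [hinner]
      calc _ ≤ √(n * h n) * (C' * h n ^ 2) := by gcongr
        _ = _ := by ring)
  simpa only [sub_zero, ← Finset.mul_sum] using hmain

end IsScoreLaw

/-! ### The Cramér–Wold device and Slutsky's lemma -/

section Limits

variable {Ω : Type*} [MeasurableSpace Ω] {P : Measure Ω}

/-- The Cramér–Wold device for convergence to a pair of independent standard normal variables. -/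
lemma tendstoInDistribution_prod_of_tendsto_charFun [IsProbabilityMeasure P] {W W' : ℕ → Ω → ℝ}
    (hW : ∀ n, AEMeasurable (W n) P) (hW' : ∀ n, AEMeasurable (W' n) P)
    (h : ∀ s t : ℝ, Tendsto (fun n => charFun (P.map fun ω => s * W n ω + t * W' n ω) 1) atTop
      (𝓝 (Complex.exp (-((s ^ 2 + t ^ 2) / 2) : ℝ)))) :
    TendstoInDistribution (fun n ω => (W n ω, W' n ω)) atTop id (fun _ => P)
      ((gaussianReal 0 1).prod (gaussianReal 0 1)) := by
  have hm : ∀ n, AEMeasurable (fun ω => WithLp.toLp 2 (W n ω, W' n ω)) P := fun n =>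
    (WithLp.measurable_toLp 2 (ℝ × ℝ)).comp_aemeasurable ((hW n).prodMk (hW' n))
  -- Characteristic functions require an inner product, so the pair is moved to the Euclidean plane
  -- and back by a continuous map.
  have key : TendstoInDistribution (fun n ω => WithLp.toLp 2 (W n ω, W' n ω)) atTop
      (WithLp.toLp 2) (fun _ => P) ((gaussianReal 0 1).prod (gaussianReal 0 1)) := by
    refine ⟨hm, (WithLp.measurable_toLp 2 (ℝ × ℝ)).aemeasurable, ?_⟩
    refine ProbabilityMeasure.tendsto_iff_tendsto_charFun.2 fun t => ?_
    simp only [ProbabilityMeasure.coe_mk]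
    rw [charFun_prod, charFun_gaussianReal, charFun_gaussianReal, ← Complex.exp_add]
    convert! h t.ofLp.1 t.ofLp.2 using 2 with n
    · have hl : AEMeasurable (fun ω => t.ofLp.1 * W n ω + t.ofLp.2 * W' n ω) P :=
        ((hW n).const_mul _).add ((hW' n).const_mul _)
      rw [charFun_apply, charFun_apply_real, integral_map (hm n) (by fun_prop),
        integral_map hl (by fun_prop)]
      refine integral_congr_ae (Eventually.of_forall fun ω => ?_)
      simp [WithLp.prod_inner_apply]
    · congr 1
      push_cast
      ring
  have := key.continuous_comp (WithLp.prod_continuous_ofLp 2 ℝ ℝ)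
  exact this

lemma TendstoZeroInProb.prodMk_tendstoInMeasure {Z Z' : ℕ → Ω → ℝ} (h : TendstoZeroInProb P Z)
    (h' : TendstoZeroInProb P Z') : TendstoInMeasure P (fun n ω => (Z n ω, Z' n ω)) atTop 0 := by
  rw [tendstoInMeasure_iff_norm]
  intro η hη
  have hsum := (h η hη).add (h' η hη)
  rw [add_zero] at hsum
  refine tendsto_of_tendsto_of_tendsto_of_le_of_le tendsto_const_nhds hsum (fun _ => zero_le)
    fun n => (measure_mono fun ω hω => ?_).trans (measure_union_le _ _)
  simpa [Prod.norm_def] using hω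

lemma MeasureTheory.TendstoInDistribution.fst [IsProbabilityMeasure P] {Z Z' : ℕ → Ω → ℝ}
    {ν ν' : Measure ℝ} [IsProbabilityMeasure ν] [IsProbabilityMeasure ν']
    (h : TendstoInDistribution (fun n ω => (Z n ω, Z' n ω)) atTop id (fun _ => P) (ν.prod ν')) :
    TendstoInDistribution Z atTop id (fun _ => P) ν := by
  have h1 := h.continuous_comp continuous_fst
  refine ⟨h1.forall_aemeasurable, aemeasurable_id, ?_⟩
  convert! h1.tendsto using 3
  simp [Measure.map_id]

lemma MeasureTheory.TendstoInDistribution.snd [IsProbabilityMeasure P] {Z Z' : ℕ → Ω → ℝ}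
    {ν ν' : Measure ℝ} [IsProbabilityMeasure ν] [IsProbabilityMeasure ν']
    (h : TendstoInDistribution (fun n ω => (Z n ω, Z' n ω)) atTop id (fun _ => P) (ν.prod ν')) :
    TendstoInDistribution Z' atTop id (fun _ => P) ν' := by
  have h1 := h.continuous_comp continuous_snd
  refine ⟨h1.forall_aemeasurable, aemeasurable_id, ?_⟩
  convert! h1.tendsto using 3
  simp [Measure.map_id]

/-- Slutsky's argument: the difference is σ⁻¹ (DΘ - W), plus a null sequence times the bounded DΘ,
minus √N (c - t₀) / √(N v). The centering c matters only through √N (c - t₀) → 0. -/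
lemma tendstoZeroInProb_standardized {Θ W T : ℕ → Ω → ℝ} {c v N : ℕ → ℝ} {D σ t₀ : ℝ}
    (hD : 0 < D) (hσ : 0 < σ) (hW : BoundedInProb P W)
    (hΘ : TendstoZeroInProb P fun n ω => D * Θ n ω - W n ω)
    (hΘT : ∀ n ω, Θ n ω = √(N n) * (T n ω - t₀)) (hN : ∀ᶠ n in atTop, 0 < N n)
    (hc : Tendsto (fun n => √(N n) * (c n - t₀)) atTop (𝓝 0))
    (hv : Tendsto (fun n => N n * v n) atTop (𝓝 ((σ / D) ^ 2))) :
    TendstoZeroInProb P fun n ω => standardized T c v n ω - σ⁻¹ * W n ω := by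
  have hDσ : 0 < σ / D := div_pos hσ hD
  have hsq : Tendsto (fun n => √(N n * v n)) atTop (𝓝 (σ / D)) := by
    have := (Real.continuous_sqrt.tendsto _).comp hv
    rwa [Real.sqrt_sq hDσ.le] at this
  have ha : Tendsto (fun n => (√(N n * v n))⁻¹ * D⁻¹ - σ⁻¹) atTop (𝓝 0) := by
    have := ((hsq.inv₀ hDσ.ne').mul_const D⁻¹).sub_const σ⁻¹
    rwa [inv_div, div_mul_eq_mul_div, mul_inv_cancel₀ hD.ne', one_div, sub_self] at this
  have hb : Tendsto (fun n => -(√(N n) * (c n - t₀) * (√(N n * v n))⁻¹)) atTop (𝓝 0) := by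
    simpa using (hc.mul (hsq.inv₀ hDσ.ne')).neg
  have hDΘ : BoundedInProb P fun n ω => D * Θ n ω := by
    have := hW.add_tendsto_zero hΘ
    simpa only [add_sub_cancel] using this
  refine (((hΘ.const_mul σ⁻¹).add (hDΘ.mul_tendsto_zero ha)).add
    (TendstoZeroInProb.of_tendsto hb)).of_abs_le ?_
  filter_upwards [hN, hsq.eventually_const_lt hDσ] with n hn hs
  refine Eventually.of_forall fun ω => le_of_eq ?_
  congr 1
  have hv0 : √(v n) ≠ 0 := by
    intro h0
    rw [Real.sqrt_mul hn.le, h0, mul_zero] at hs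
    exact lt_irrefl _ hs
  have hN0 : √(N n) ≠ 0 := (Real.sqrt_pos.2 hn).ne'
  rw [standardized, hΘT, Real.sqrt_mul hn.le]
  field_simp
  ring

end Limits

/-! ### Symmetry and positivity of kernel integrals -/

section Kernel

variable {K : ℝ → ℝ}

lemma integral_eq_zero_of_odd {g : ℝ → ℝ} (hg : ∀ u, g (-u) = -g u) : ∫ u, g u = 0 := by
  have h1 := integral_neg_eq_self g volume
  simp only [hg, integral_neg] at h1
  linarith

/-- If the integral were 0, K would vanish almost everywhere, against its mass 1. The point 0 is
exempted because u² K(u) vanishes there whatever K is. -/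
lemma IsSmoothingKernel.integral_pos (hK : IsSmoothingKernel K) {g : ℝ → ℝ} (hg : Integrable g)
    (hg0 : ∀ u, 0 ≤ g u) (hgK : ∀ u ≠ 0, g u = 0 → K u = 0) : 0 < ∫ u, g u := by
  refine lt_of_le_of_ne (integral_nonneg hg0) fun h0 => ?_
  have h1 := (integral_eq_zero_iff_of_nonneg hg0 hg).1 h0.symm
  have h2 : K =ᵐ[volume] fun _ => 0 := by
    filter_upwards [h1, Measure.ae_ne volume (0 : ℝ)] with u hu hu0
    exact hgK u hu0 hu
  have := integral_congr_ae h2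
  rw [hK.integral_eq_one, integral_zero] at this
  exact one_ne_zero this

end Kernel

/-! ### From the regression model to local samples -/

section Sample

variable {Ω : Type*} [MeasurableSpace Ω] {P : Measure Ω}
  {a b x p : ℝ} {f : ℝ → ℝ} {h : ℕ → ℝ} {X ε : ℕ → Ω → ℝ}

lemma IsDesignDensity.measurable (hf : IsDesignDensity a b f) : Measurable f := by
  have h1 : ContinuousOn f (Ioo a b) := fun z hz =>
    (hf.differentiable z hz).continuousAt.continuousWithinAt
  have h2 := measurable_indicator_of_continuousOn h1
  rwa [indicator_eq_self.2 fun z hz => by_contra fun h => hz (hf.support z h)] at h2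

lemma IsDesignDensity.exists_abs_sub_le (hf : IsDesignDensity a b f) (hx : x ∈ Ioo a b) :
    ∃ C : ℝ, ∃ r > 0, ∀ y, |y| ≤ r → |f (x + y) - f x| ≤ C * |y| := by
  obtain ⟨C, hC⟩ := hf.bounded_deriv
  obtain ⟨r, hr, hball⟩ := Metric.isOpen_iff.1 isOpen_Ioo x hx
  refine ⟨C, r / 2, half_pos hr, fun y hy => ?_⟩
  have := (convex_Ioo a b).norm_image_sub_le_of_norm_deriv_le hf.differentiable hC hx
    (hball (show x + y ∈ Metric.ball x r by
      rw [Metric.mem_ball, Real.dist_eq, add_sub_cancel_left]; linarith))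
  simpa only [Real.norm_eq_abs, add_sub_cancel_left] using this

/-- The same observations, rescaled by each h n, form the rows to which the local limit theorems
apply. -/
lemma isLocalSample [IsProbabilityMeasure P] (hf : IsDesignDensity a b f) (hx : x ∈ Ioo a b) (hX : IsRandomDesign P X f)
    (hε : IsErrorSequence P ε p) (hXε : IndepFun (fun ω i => X i ω) (fun ω i => ε i ω) P)
    (hh : IsBandwidth h) :
    IsLocalSample P f x h (P.map (ε 0)) fun n i ω => ((X i ω - x) / h n, ε i ω) where
  measurable := hf.measurable
  nonneg := hf.nonneg
  continuousAt := (hf.differentiable x hx).continuousAt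
  pos := hh.pos
  tendsto_zero := hh.tendsto_zero
  mul_tendsto_top := hh.mul_tendsto_top
  sample n := by
    have h1 : IsIIDSample P (fun i ω => (X i ω, ε i ω))
        ((volume.withDensity fun z => ENNReal.ofReal (f z)).prod (P.map (ε 0))) :=
      ⟨fun i => (hX.measurable i).prodMk (hε.measurable i),
        iIndepFun_prodMk_of_indepFun hX.measurable hε.measurable hX.indep hε.indep hXε,
        fun i => by
          have hi : IndepFun (X i) (ε i) P :=
            hXε.comp (measurable_pi_apply i) (measurable_pi_apply i)
          rw [(indepFun_iff_map_prod_eq_prod_map_map (hX.measurable i).aemeasurable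
            (hε.measurable i).aemeasurable).1 hi, hX.law i, (hε.identDistrib i).map_eq]⟩
    have h2 := h1.map (φ := fun q : ℝ × ℝ => ((q.1 - x) / h n, q.2)) (by fun_prop)
    have : IsProbabilityMeasure (P.map (ε 0)) :=
      Measure.isProbabilityMeasure_map (hε.measurable 0).aemeasurable
    rwa [map_prod_eq_localLaw hf.measurable x (hh.pos n)] at h2

lemma IsRandomDesign.ae_mem (hf : IsDesignDensity a b f) (hX : IsRandomDesign P X f) :
    ∀ᵐ ω ∂P, ∀ i, X i ω ∈ Ioo a b := by
  have hfm := hf.measurable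
  refine ae_all_iff.2 fun i => ae_of_ae_map (hX.measurable i).aemeasurable ?_
  rw [hX.law i, ae_withDensity_iff (by fun_prop)]
  refine Eventually.of_forall fun z hz => by_contra fun h => hz ?_
  rw [hf.support z h, ENNReal.ofReal_zero]

lemma IsErrorSequence.absMoment_eq (hε : IsErrorSequence P ε p) :
    absMoment P (ε 0) (p - 2) = ∫ e, |e| ^ (p - 2) ∂P.map (ε 0) := by
  have hm := (hε.measurable 0).aemeasurable (μ := P)
  rw [absMoment_eq_integral hm hε.neg_moment,
    integral_map hm (Measurable.aestronglyMeasurable (by fun_prop))]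

lemma IsErrorSequence.absMoment_two_mul_eq [IsProbabilityMeasure P] (hp : 1 < p) (hε : IsErrorSequence P ε p) :
    absMoment P (ε 0) (2 * p - 2) = ∫ e, score p e ^ 2 ∂P.map (ε 0) := by
  have hm := (hε.measurable 0).aemeasurable (μ := P)
  simp only [score_sq hp]
  rw [absMoment_eq_integral hm (hε.eAbsMoment_lt_top hp),
    integral_map hm (Measurable.aestronglyMeasurable (by fun_prop))]

/-- The real moment of an infinite integral is 0 by convention. The moments converge to a positive
number, so near t = 0 they are genuinely finite; this gives integrability and, for p < 2, excludes
atoms at -t. -/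
lemma IsErrorSequence.regular_of_isBigO [IsProbabilityMeasure P] (hp : 1 < p) (hε : IsErrorSequence P ε p)
    (hO : (fun t : ℝ => absMoment P (fun ω => ε 0 ω - t) (p - 2) - absMoment P (ε 0) (p - 2))
      =O[𝓝 0] fun t : ℝ => t) :
    (∀ᶠ t in 𝓝 (0 : ℝ), Integrable (fun e => |e + t| ^ (p - 2)) (P.map (ε 0)) ∧
      (p < 2 → ∀ᵐ e ∂P.map (ε 0), e + t ≠ 0)) ∧
    (fun t : ℝ => ∫ e, |e + t| ^ (p - 2) ∂P.map (ε 0) - ∫ e, |e| ^ (p - 2) ∂P.map (ε 0))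
      =O[𝓝 0] fun t : ℝ => t := by
  have hm := (hε.measurable 0).aemeasurable (μ := P)
  have hneg : Tendsto (fun t : ℝ => -t) (𝓝 0) (𝓝 0) := by
    simpa using (continuous_neg (G := ℝ)).tendsto 0
  have hO' : (fun t : ℝ => absMoment P (fun ω => ε 0 ω + t) (p - 2) - absMoment P (ε 0) (p - 2))
      =O[𝓝 0] fun t : ℝ => t := by
    have := hO.comp_tendsto hneg
    simp only [Function.comp_def, sub_neg_eq_add] at this
    exact this.neg_right.congr_right fun t => neg_neg t
  have hpos : 0 < absMoment P (ε 0) (p - 2) := by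
    rw [hε.absMoment_eq]
    exact (hε.isScoreLaw hp).pos
  have hlim : Tendsto (fun t : ℝ => absMoment P (fun ω => ε 0 ω + t) (p - 2)) (𝓝 0)
      (𝓝 (absMoment P (ε 0) (p - 2))) := by
    have := (hO'.trans_tendsto tendsto_id).add_const (absMoment P (ε 0) (p - 2))
    simpa using this
  have hfin : ∀ᶠ t : ℝ in 𝓝 0, eAbsMoment P (fun ω => ε 0 ω + t) (p - 2) < ⊤ := by
    filter_upwards [hlim.eventually_const_lt hpos] with t ht
    refine lt_top_iff_ne_top.2 fun h => ?_
    rw [absMoment, h, ENNReal.toReal_top] at ht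
    exact lt_irrefl _ ht
  have hmt : ∀ t : ℝ, AEMeasurable (fun ω => ε 0 ω + t) P := fun t => hm.add_const t
  refine ⟨?_, ?_⟩
  · filter_upwards [hfin] with t ht
    refine ⟨(integrable_map_measure (Measurable.aestronglyMeasurable (by fun_prop)) hm).2
      (integrable_abs_rpow_of_eAbsMoment_lt_top (hmt t) ht), fun hp2 => ?_⟩
    refine (ae_map_iff hm (p := fun e => e + t ≠ 0) ?_).2
      (ae_ne_zero_of_eAbsMoment_lt_top (hmt t) (by linarith) ht)
    exact (measurable_add_const t) (measurableSet_singleton (0 : ℝ)).compl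
  · refine hO'.congr' ?_ EventuallyEq.rfl
    filter_upwards [hfin] with t ht
    rw [absMoment_eq_integral (hmt t) ht, hε.absMoment_eq, integral_map hm (f := fun e =>
      |e + t| ^ (p - 2)) (Measurable.aestronglyMeasurable (by fun_prop))]

/-- The joint central limit theorem for two orthogonal kernel sums. -/
lemma IsLocalSample.tendstoInDistribution_pair [IsProbabilityMeasure P] {μ : Measure ℝ} [IsProbabilityMeasure μ]
    {V : ℕ → ℕ → Ω → ℝ × ℝ} (H : IsLocalSample P f x h μ V) (hp : 1 < p) (hμ : IsScoreLaw p μ)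
    {κ κ' : ℝ → ℝ} (hκ : Measurable κ) (hκs : ∀ u, 1 < |u| → κ u = 0) (hκ1 : Integrable κ)
    (hκ2 : Integrable fun u => κ u ^ 2) (hκ' : Measurable κ') (hκs' : ∀ u, 1 < |u| → κ' u = 0)
    (hκ1' : Integrable κ') (hκ2' : Integrable fun u => κ' u ^ 2) (horth : ∫ u, κ u * κ' u = 0)
    {σ σ' : ℝ} (hσ : σ ≠ 0) (hσ' : σ' ≠ 0)
    (hσ2 : σ ^ 2 = f x * ((∫ u, κ u ^ 2) * ∫ e, score p e ^ 2 ∂μ))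
    (hσ2' : σ' ^ 2 = f x * ((∫ u, κ' u ^ 2) * ∫ e, score p e ^ 2 ∂μ)) :
    TendstoInDistribution (fun (n : ℕ) ω =>
        (σ⁻¹ * ((√((n : ℝ) * h n))⁻¹ *
          ∑ i ∈ Finset.range n, κ (V n i ω).1 * score p (V n i ω).2),
        σ'⁻¹ * ((√((n : ℝ) * h n))⁻¹ *
          ∑ i ∈ Finset.range n, κ' (V n i ω).1 * score p (V n i ω).2)))
      atTop id (fun _ => P) ((gaussianReal 0 1).prod (gaussianReal 0 1)) := by
  have hsm := (continuous_score hp).measurable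
  have hVm : ∀ n i, Measurable (V n i) := fun n i => (H.sample n).measurable i
  have hWm : ∀ {κ : ℝ → ℝ}, Measurable κ → ∀ n : ℕ, Measurable fun ω =>
      (√((n : ℝ) * h n))⁻¹ * ∑ i ∈ Finset.range n, κ (V n i ω).1 * score p (V n i ω).2 := by
    intro κ hκ n
    refine (Finset.measurable_fun_sum _ fun i _ => ?_).const_mul _
    have := hVm n i
    fun_prop
  refine tendstoInDistribution_prod_of_tendsto_charFun
    (fun n => ((hWm hκ n).const_mul _).aemeasurable)
    (fun n => ((hWm hκ' n).const_mul _).aemeasurable) fun s t => ?_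
  have hκκ' : Integrable fun u => κ u * κ' u :=
    ((memLp_two_iff_integrable_sq hκ.aestronglyMeasurable).2 hκ2).integrable_mul
      ((memLp_two_iff_integrable_sq hκ'.aestronglyMeasurable).2 hκ2')
  have hexpand : ∀ u, (s * σ⁻¹ * κ u + t * σ'⁻¹ * κ' u) ^ 2 = (s * σ⁻¹) ^ 2 * κ u ^ 2 +
      (t * σ'⁻¹) ^ 2 * κ' u ^ 2 + 2 * (s * σ⁻¹ * (t * σ'⁻¹)) * (κ u * κ' u) := fun u => by ring
  have hi1 := hκ2.const_mul ((s * σ⁻¹) ^ 2)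
  have hi2 := hκ2'.const_mul ((t * σ'⁻¹) ^ 2)
  have hi12 : Integrable fun u => (s * σ⁻¹) ^ 2 * κ u ^ 2 + (t * σ'⁻¹) ^ 2 * κ' u ^ 2 := hi1.add hi2
  have hi3 := hκκ'.const_mul (2 * (s * σ⁻¹ * (t * σ'⁻¹)))
  -- A linear combination of the two sums is again a kernel sum, so the one-dimensional theorem at
  -- argument 1 suffices. The cross term of the squared weight integrates to 0, leaving variance s²
  -- + t².
  have h1 := H.tendsto_charFun_sum (κ := fun u => s * σ⁻¹ * κ u + t * σ'⁻¹ * κ' u)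
    (s := score p) (by fun_prop) (fun u hu => by simp [hκs u hu, hκs' u hu])
    ((hκ1.const_mul _).add (hκ1'.const_mul _))
    (by simp only [hexpand]; exact hi12.add hi3) hsm
    (hμ.integrable_score hp) hμ.integrable_sq hμ.mean
  convert! h1 using 2
  · congr 1
    refine congrArg (fun g : Ω → ℝ => P.map g) (funext fun ω => ?_)
    simp only [Finset.mul_sum, ← Finset.sum_add_distrib]
    refine Finset.sum_congr rfl fun i _ => ?_
    ring
  · simp only [hexpand]
    rw [integral_add hi12 hi3, integral_add hi1 hi2, integral_const_mul, integral_const_mul,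
      integral_const_mul, horth, mul_zero, add_zero]
    congr 3
    have e1 : f x * (((s * σ⁻¹) ^ 2 * (∫ u, κ u ^ 2) + (t * σ'⁻¹) ^ 2 * ∫ u, κ' u ^ 2) *
        ∫ e, score p e ^ 2 ∂μ) = (s * σ⁻¹) ^ 2 * σ ^ 2 + (t * σ'⁻¹) ^ 2 * σ' ^ 2 := by
      rw [hσ2, hσ2']; ring
    rw [e1, ← Complex.ofReal_neg]
    congr 1
    field_simp

end Sample

/-- The constant c stands for the factor h⁻¹ of the rescaled kernel, which does not affect the root.
-/
lemma scoreEquation_eq_zero_of_isMin {ι α : Type*} [Fintype ι] {p : ℝ} (hp : 1 < p)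
    {s : Finset α} {k : α → ℝ} {z : ι → α → ℝ} {y : α → ℝ} {R : ℝ} {j : ι} {θ : ι → ℝ}
    {r : α → ℝ} {c : ℝ} (hc : c ≠ 0) (hr : ∀ i, r i = y i - R⁻¹ * ∑ l, θ l * z l i)
    (hmin : ∀ t : ℝ, ∑ i ∈ s, |r i| ^ p * (c * k i) ≤ ∑ i ∈ s, |r i - t * z j i| ^ p * (c * k i)) :
    scoreEquation p s k z y R j θ = 0 := by
  have h1 := sum_score_eq_zero_of_isMin hp s r (z j) (fun i => c * k i) hmin
  simp only [mul_assoc] at h1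
  rw [← Finset.mul_sum] at h1
  have h2 := (mul_eq_zero.1 h1).resolve_left hc
  simp only [scoreEquation, ← hr, mul_assoc, h2, mul_zero]

/-! ### Consequences of the bandwidth conditions -/

section Bandwidth

variable {h : ℕ → ℝ}

/-- The left side is the square root of nh⁵; a bias of order h² is thus negligible at the rate
√(nh). -/
lemma IsBandwidth.tendsto_sqrt_mul (hh : IsBandwidth h) :
    Tendsto (fun n : ℕ => √(n * h n) * h n ^ 2) atTop (𝓝 0) := by
  have h1 := (Real.continuous_sqrt.tendsto _).comp hh.mul_pow_tendsto_zero
  rw [Real.sqrt_zero] at h1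
  refine h1.congr fun n => ?_
  have hn := (hh.pos n).le
  rw [Function.comp_apply, show (n : ℝ) * h n ^ 5 = n * h n * (h n ^ 2) ^ 2 by ring,
    Real.sqrt_mul (mul_nonneg n.cast_nonneg hn), Real.sqrt_sq (sq_nonneg _)]

lemma IsBandwidth.tendsto_sqrt_mul_pow_three (hh : IsBandwidth h) :
    Tendsto (fun n : ℕ => √(n * h n ^ 3) * h n ^ 2) atTop (𝓝 0) := by
  have h1 := hh.tendsto_sqrt_mul.mul hh.tendsto_zero
  rw [mul_zero] at h1
  refine h1.congr fun n => ?_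
  have hn := (hh.pos n).le
  rw [show (n : ℝ) * h n ^ 3 = n * h n * h n ^ 2 by ring,
    Real.sqrt_mul (mul_nonneg n.cast_nonneg hn) (h n ^ 2), Real.sqrt_sq hn]
  ring

/-- The coefficient B is arbitrary, since M h² → 0 makes every O(h²) shift of the centering
invisible in the limit. -/
lemma tendsto_mul_sub_of_isLittleO {M c r : ℕ → ℝ} {t₀ B : ℝ} (hpos : ∀ n, 0 < h n)
    (hM : Tendsto (fun n => M n * h n ^ 2) atTop (𝓝 0)) (hr : r =o[atTop] fun n => h n ^ 2)
    (hc : ∀ n, c n = t₀ + B * h n ^ 2 + r n) :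
    Tendsto (fun n => M n * (c n - t₀)) atTop (𝓝 0) := by
  have h1 := (hM.const_mul B).add (hM.mul hr.tendsto_div_nhds_zero)
  simp only [mul_zero, add_zero] at h1
  refine h1.congr fun n => ?_
  have := (hpos n).ne'
  rw [hc]
  field_simp
  ring

lemma tendsto_mul_of_isLittleO {N v s : ℕ → ℝ} {A : ℝ} (hN : ∀ᶠ n in atTop, 0 < N n)
    (hs : s =o[atTop] fun n => 1 / N n) (hv : ∀ n, v n = A / N n + s n) :
    Tendsto (fun n => N n * v n) atTop (𝓝 A) := by
  have h1 := hs.tendsto_div_nhds_zero.const_add A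
  rw [add_zero] at h1
  refine h1.congr' ?_
  filter_upwards [hN] with n hn
  rw [hv]
  field_simp

end Bandwidth

/-! ### Asymptotic linearity and standardization of the two estimators -/

section Main

variable {Ω : Type*} [MeasurableSpace Ω] {P : Measure Ω} [IsProbabilityMeasure P]
  {p a b x : ℝ} {f m K : ℝ → ℝ} {h : ℕ → ℝ} {X ε Y T S : ℕ → Ω → ℝ}

/-- The normalized score with weights `κ`, at the true regression function. -/
noncomputable def kernelScore (p x : ℝ) (h : ℕ → ℝ) (X ε : ℕ → Ω → ℝ) (κ : ℝ → ℝ) (n : ℕ)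
    (ω : Ω) : ℝ :=
  (√(n * h n))⁻¹ * ∑ i ∈ Finset.range n, κ ((X i ω - x) / h n) * score p (ε i ω)

/-- The only regressor is 1, so δ is m(x + hu) - m(x), of order h with linear part m'(x) h u. -/
lemma IsLocConstEstimator.tendstoZeroInProb (hp : 1 < p) (hx : x ∈ Ioo a b)
    (hY : ∀ i ω, Y i ω = m (X i ω) + ε i ω) (hε : IsErrorSequence P ε p)
    (hf : IsDesignDensity a b f) (hfx : 0 < f x) (hX : IsRandomDesign P X f)
    (hXε : IndepFun (fun ω i => X i ω) (fun ω i => ε i ω) P)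
    (hK : IsSmoothingKernel K) (hh : IsBandwidth h) (hm : ContDiffOn ℝ 2 m (Ioo a b))
    (hO : (fun t : ℝ => absMoment P (fun ω => ε 0 ω - t) (p - 2) - absMoment P (ε 0) (p - 2))
      =O[𝓝 0] fun t : ℝ => t)
    (hT : IsLocConstEstimator P p K h x X Y T) :
    TendstoZeroInProb P fun (n : ℕ) ω =>
      f x * ((p - 1) * absMoment P (ε 0) (p - 2)) * (√(n * h n) * (T n ω - m x)) -
        kernelScore p x h X ε K n ω := by
  have H := isLocalSample hf hx hX hε hXε hh
  have hμ := hε.isScoreLaw hp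
  have : IsProbabilityMeasure (P.map (ε 0)) :=
    Measure.isProbabilityMeasure_map (hε.measurable 0).aemeasurable
  obtain ⟨hreg, hO'⟩ := hε.regular_of_isBigO hp hO
  obtain ⟨C, hC, r, hr, hexp⟩ := hμ.exists_abs_integral_score_le hp hreg hO'
  have hlim : Tendsto (fun t : ℝ => ∫ e, |e + t| ^ (p - 2) ∂P.map (ε 0)) (𝓝 0)
      (𝓝 (∫ e, |e| ^ (p - 2) ∂P.map (ε 0))) := by
    have := (hO'.trans_tendsto tendsto_id).add_const (∫ e, |e| ^ (p - 2) ∂P.map (ε 0))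
    simpa using this
  obtain ⟨C₂, hC₂, r₂, hr₂, hT2⟩ := exists_abs_sub_linear_le hm hx
  obtain ⟨F, r₃, hr₃, hF⟩ := hf.exists_abs_sub_le hx
  set δ : ℕ → ℝ → ℝ := fun n u => (Ioo a b).indicator m (x + h n * u) - m x with hδ
  have hmm := measurable_indicator_of_continuousOn hm.continuousOn
  have hδm : ∀ n, Measurable (δ n) := fun n => by
    simp only [hδ]
    fun_prop
  have hhu : ∀ n u, |u| ≤ 1 → |h n * u| ≤ h n := fun n u hu => by
    rw [abs_mul, abs_of_pos (hh.pos n)]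
    exact mul_le_of_le_one_right (hh.pos n).le hu
  have hδ2 : ∀ᶠ n in atTop, ∀ u, |u| ≤ 1 → |δ n u - deriv m x * (h n * u)| ≤ C₂ * h n ^ 2 := by
    filter_upwards [hh.tendsto_zero.eventually_le_const hr₂] with n hn u hu
    obtain ⟨h1, h2⟩ := hT2 (h n * u) ((hhu n u hu).trans hn)
    simp only [hδ, indicator_of_mem h1]
    refine h2.trans (mul_le_mul_of_nonneg_left ?_ hC₂)
    exact sq_le_sq' (neg_le_of_abs_le (hhu n u hu)) (le_of_abs_le (hhu n u hu))
  have hδ1 : ∀ᶠ n in atTop, ∀ u, |u| ≤ 1 → |δ n u| ≤ (C₂ + |deriv m x|) * h n := by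
    filter_upwards [hδ2, hh.tendsto_zero.eventually_le_const one_pos] with n hn h1 u hu
    have h3 := hh.pos n
    calc |δ n u| = |(δ n u - deriv m x * (h n * u)) + deriv m x * (h n * u)| := by
          rw [sub_add_cancel]
      _ ≤ C₂ * h n ^ 2 + |deriv m x| * h n := by
          refine (abs_add_le _ _).trans (add_le_add (hn u hu) ?_)
          rw [abs_mul]
          exact mul_le_mul_of_nonneg_left (hhu n u hu) (abs_nonneg _)
      _ ≤ (C₂ + |deriv m x|) * h n := by
          rw [add_mul]
          gcongr
          nlinarith
  have hA : Tendsto (fun n => (C₂ + |deriv m x|) * h n) atTop (𝓝 0) := by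
    simpa using hh.tendsto_zero.const_mul (C₂ + |deriv m x|)
  have hfl : ∀ᶠ n in atTop, ∀ u, |u| ≤ 1 → |f (x + h n * u) - f x| ≤ |F| * h n := by
    filter_upwards [hh.tendsto_zero.eventually_le_const hr₃] with n hn u hu
    refine (hF (h n * u) ((hhu n u hu).trans hn)).trans ?_
    exact mul_le_mul (le_abs_self F) (hhu n u hu) (abs_nonneg _) (abs_nonneg _)
  have hmain := H.tendstoZeroInProb_estimator hfx hp hK (ι := Unit) (z := fun _ _ => 1)
    (Θ := fun _ n ω => √(n * h n) * (T n ω - m x)) (δ := δ) (fun _ => measurable_const)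
    (fun _ _ _ => by simp) (fun j l hjl => absurd (Subsingleton.elim j l) hjl)
    (fun _ => by simp [hK.integral_eq_one]) hμ.integrable hμ.pos hμ.integrable_sq hμ.mean
    (by
      filter_upwards [hh.mul_tendsto_top.eventually_gt_atTop 0] with n hN
      filter_upwards [hT.minimizes n, hX.ae_mem hf] with ω hω hmem _
      have hR : √((n : ℝ) * h n) ≠ 0 := (Real.sqrt_pos.2 hN).ne'
      have hn := (hh.pos n).ne'
      refine scoreEquation_eq_zero_of_isMin hp (r := fun i => Y i ω - T n ω) (inv_ne_zero hn)
        (fun i => ?_) fun t => ?_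
      · have hXi : x + h n * ((X i ω - x) / h n) = X i ω := by field_simp; ring
        simp only [hδ, hXi, indicator_of_mem (hmem i), hY, Finset.univ_unique,
          Finset.sum_singleton]
        field_simp
        ring
      · have := hω (T n ω + t)
        simpa only [locConstObjective, scaledKernel, mul_one, sub_sub] using this)
    (fun _ => by
      simpa only [mul_one] using hμ.tendstoZeroInProb_bias_of_linear hp H hK hC hr hexp hδm hδ1
        hδ2 hfl hh.tendsto_sqrt_mul)
    (fun M hM => hμ.exists_envelope_of_tendsto_integral hp H hK hreg hlim hδm hδ1 hA hM) ()
  simpa only [kernelScore, mul_one, hK.integral_eq_one, one_mul, ← hε.absMoment_eq] using hmain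

/-- The fitted line removes the linear part of m, so δ is a second order Taylor remainder and is
O(h²). -/
lemma IsLocLinEstimator.tendstoZeroInProb (hp : 1 < p) (hx : x ∈ Ioo a b)
    (hY : ∀ i ω, Y i ω = m (X i ω) + ε i ω) (hε : IsErrorSequence P ε p)
    (hf : IsDesignDensity a b f) (hfx : 0 < f x) (hX : IsRandomDesign P X f)
    (hXε : IndepFun (fun ω i => X i ω) (fun ω i => ε i ω) P)
    (hK : IsSmoothingKernel K) (hh : IsBandwidth h) (hm : ContDiffOn ℝ 2 m (Ioo a b))
    (hT : IsLocLinEstimator P p K h x X Y T S) :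
    TendstoZeroInProb P (fun (n : ℕ) ω =>
      f x * ((p - 1) * absMoment P (ε 0) (p - 2)) * (√(n * h n) * (T n ω - m x)) -
        kernelScore p x h X ε K n ω) ∧
    TendstoZeroInProb P (fun (n : ℕ) ω =>
      f x * (kernelMoment K 2 * ((p - 1) * absMoment P (ε 0) (p - 2))) *
        (√(n * h n ^ 3) * (S n ω - deriv m x)) -
        kernelScore p x h X ε (fun u => K u * u) n ω) := by
  have H := isLocalSample hf hx hX hε hXε hh
  have hμ := hε.isScoreLaw hp
  have : IsProbabilityMeasure (P.map (ε 0)) :=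
    Measure.isProbabilityMeasure_map (hε.measurable 0).aemeasurable
  obtain ⟨C₂, hC₂, r₂, hr₂, hT2⟩ := exists_abs_sub_linear_le hm hx
  set δ : ℕ → ℝ → ℝ := fun n u =>
    (Ioo a b).indicator m (x + h n * u) - m x - deriv m x * (h n * u) with hδ
  have hmm := measurable_indicator_of_continuousOn hm.continuousOn
  have hδm : ∀ n, Measurable (δ n) := fun n => by
    simp only [hδ]
    fun_prop
  have hδ2 : ∀ᶠ n in atTop, ∀ u, |u| ≤ 1 → |δ n u| ≤ C₂ * h n ^ 2 := by
    filter_upwards [hh.tendsto_zero.eventually_le_const hr₂] with n hn u hu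
    have hhu : |h n * u| ≤ h n := by
      rw [abs_mul, abs_of_pos (hh.pos n)]
      exact mul_le_of_le_one_right (hh.pos n).le hu
    obtain ⟨h1, h2⟩ := hT2 (h n * u) (hhu.trans hn)
    simp only [hδ, indicator_of_mem h1]
    refine h2.trans (mul_le_mul_of_nonneg_left ?_ hC₂)
    exact sq_le_sq' (neg_le_of_abs_le hhu) (le_of_abs_le hhu)
  have ha0 : Tendsto (fun n => C₂ * h n ^ 2) atTop (𝓝 0) := by
    simpa using (hh.tendsto_zero.pow 2).const_mul C₂
  have ha : Tendsto (fun n : ℕ => √(n * h n) * (C₂ * h n ^ 2)) atTop (𝓝 0) := by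
    have := hh.tendsto_sqrt_mul.const_mul C₂
    rw [mul_zero] at this
    exact this.congr fun n => by ring
  -- In the coordinate u the slope error is multiplied by h, hence its rate √(nh) h = √(nh³). The
  -- two regressors are orthogonal under K because uK(u) is odd.
  set z : Fin 2 → ℝ → ℝ := ![fun _ => 1, fun u => u] with hz
  have hzm : ∀ j, Measurable (z j) := by
    intro j
    fin_cases j
    · exact measurable_const
    · exact measurable_id
  have hz1 : ∀ j u, |u| ≤ 1 → |z j u| ≤ 1 := by
    intro j u hu
    fin_cases j
    · simp [hz]
    · exact hu
  have hodd : ∫ u, K u * u = 0 := integral_eq_zero_of_odd fun u => by rw [hK.symm]; ring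
  have hmain := H.tendstoZeroInProb_estimator hfx hp hK (z := z)
    (Θ := ![fun n ω => √(n * h n) * (T n ω - m x),
      fun n ω => √(n * h n ^ 3) * (S n ω - deriv m x)]) (δ := δ) hzm hz1
    (fun j l hjl => by fin_cases j <;> fin_cases l <;> simp_all)
    (fun j => by
      refine hK.integral_pos (hK.integrable_mul ((hzm j).mul (hzm j)) fun u hu => ?_)
        (fun u => mul_nonneg (hK.nonneg u) (mul_self_nonneg _)) fun u hu h0 => ?_
      · rw [abs_mul]
        exact mul_le_one₀ (hz1 j u hu) (abs_nonneg _) (hz1 j u hu)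
      · refine (mul_eq_zero.1 h0).resolve_right (mul_self_ne_zero.2 ?_)
        fin_cases j
        · exact one_ne_zero
        · exact hu)
    hμ.integrable hμ.pos hμ.integrable_sq hμ.mean
    (by
      filter_upwards [hh.mul_tendsto_top.eventually_gt_atTop 0] with n hN
      filter_upwards [hT.minimizes n, hX.ae_mem hf] with ω hω hmem
      have hR : √((n : ℝ) * h n) ≠ 0 := (Real.sqrt_pos.2 hN).ne'
      have hn := (hh.pos n).ne'
      have hXi : ∀ i, x + h n * ((X i ω - x) / h n) = X i ω := fun i => by field_simp; ring
      have hsq : √((n : ℝ) * h n ^ 3) = √((n : ℝ) * h n) * h n := by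
        rw [show (n : ℝ) * h n ^ 3 = n * h n * h n ^ 2 by ring, Real.sqrt_mul hN.le,
          Real.sqrt_sq (hh.pos n).le]
      have hres : ∀ i, Y i ω - T n ω - S n ω * (X i ω - x) =
          ε i ω + δ n ((X i ω - x) / h n) - (√(n * h n))⁻¹ * ∑ l,
            (![fun n ω => √(n * h n) * (T n ω - m x),
              fun n ω => √(n * h n ^ 3) * (S n ω - deriv m x)] : Fin 2 → ℕ → Ω → ℝ) l n ω *
              z l ((X i ω - x) / h n) := by
        intro i
        simp only [hδ, hXi, indicator_of_mem (hmem i), hY, Fin.sum_univ_two, hz,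
          Matrix.cons_val_zero, Matrix.cons_val_one, hsq]
        generalize √((n : ℝ) * h n) = R at hR ⊢
        field_simp
        ring
      intro j
      refine scoreEquation_eq_zero_of_isMin hp (inv_ne_zero hn) hres fun t => ?_
      fin_cases j
      · have := hω (T n ω + t, S n ω)
        simp only [locLinObjective, scaledKernel] at this
        refine this.trans (le_of_eq (Finset.sum_congr rfl fun i _ => ?_))
        congr 3
        simp [hz]
        ring
      -- Changing the slope by t / h changes the residual by -t u, the direction of the second
      -- regressor.
      · have := hω (T n ω, S n ω + t / h n)
        simp only [locLinObjective, scaledKernel] at this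
        refine this.trans (le_of_eq (Finset.sum_congr rfl fun i _ => ?_))
        congr 3
        simp [hz]
        field_simp
        ring)
    (fun j => hμ.tendstoZeroInProb_bias hp H hK (hzm j) (hz1 j) hδm hδ2 ha ha0)
    (fun M hM => hμ.exists_envelope hp H hK hδ2 ha hM)
  have hmom : ∫ u, K u * (u * u) = kernelMoment K 2 :=
    integral_congr_ae (Eventually.of_forall fun u => by ring)
  refine ⟨?_, ?_⟩
  · simpa only [kernelScore, hz, Matrix.cons_val_zero, mul_one, hK.integral_eq_one, one_mul,
      ← hε.absMoment_eq] using hmain 0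
  · simpa only [kernelScore, hz, Matrix.cons_val_one, Matrix.cons_val_zero, hmom, ← hε.absMoment_eq] using hmain 1

lemma IsErrorSequence.absMoment_pos (hp : 1 < p)
    (hε : IsErrorSequence P ε p) :
    0 < absMoment P (ε 0) (p - 2) ∧ 0 < absMoment P (ε 0) (2 * p - 2) := by
  rw [hε.absMoment_eq, hε.absMoment_two_mul_eq hp]
  exact ⟨(hε.isScoreLaw hp).pos, (hε.isScoreLaw hp).sq_pos⟩

lemma IsSmoothingKernel.kernelRoughness_pos (hK : IsSmoothingKernel K) : 0 < kernelRoughness K :=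
  hK.integral_pos hK.sq_integrable.integrable_sq (fun _ => sq_nonneg _) fun _ _ h0 =>
    pow_eq_zero_iff two_ne_zero |>.1 h0

lemma IsSmoothingKernel.kernelSqMoment_pos (hK : IsSmoothingKernel K) :
    0 < kernelSqMoment K 2 := by
  have h1 := hK.integrable_sq_mul measurable_id fun u hu => hu
  simp only [mul_pow, mul_comm (K _ ^ 2)] at h1
  refine hK.integral_pos h1 (fun u => by positivity) fun u hu h0 => ?_
  exact pow_eq_zero_iff two_ne_zero |>.1
    ((mul_eq_zero.1 h0).resolve_left (pow_ne_zero 2 hu))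

lemma IsSmoothingKernel.kernelMoment_pos (hK : IsSmoothingKernel K) : 0 < kernelMoment K 2 := by
  have h1 := hK.integrable_mul (z := fun u => u ^ 2) (by fun_prop) fun u hu => by
    rw [abs_pow]
    exact pow_le_one₀ (abs_nonneg u) hu
  simp only [mul_comm (K _)] at h1
  refine hK.integral_pos h1 (fun u => mul_nonneg (sq_nonneg u) (hK.nonneg u)) fun u hu h0 => ?_
  exact (mul_eq_zero.1 h0).resolve_left (pow_ne_zero 2 hu)

/-- The scores with weights `K u` and `u K u` are asymptotically normal and independent. -/
lemma tendstoInDistribution_kernelScore (hp : 1 < p) (hx : x ∈ Ioo a b)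
    (hε : IsErrorSequence P ε p)
    (hf : IsDesignDensity a b f) (hfx : 0 < f x) (hX : IsRandomDesign P X f)
    (hXε : IndepFun (fun ω i => X i ω) (fun ω i => ε i ω) P)
    (hK : IsSmoothingKernel K) (hh : IsBandwidth h) :
    TendstoInDistribution (fun n ω =>
      ((√(f x * (kernelRoughness K * absMoment P (ε 0) (2 * p - 2))))⁻¹ *
          kernelScore p x h X ε K n ω,
        (√(f x * (kernelSqMoment K 2 * absMoment P (ε 0) (2 * p - 2))))⁻¹ *
          kernelScore p x h X ε (fun u => K u * u) n ω))
      atTop id (fun _ => P) ((gaussianReal 0 1).prod (gaussianReal 0 1)) := by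
  have H := isLocalSample hf hx hX hε hXε hh
  have : IsProbabilityMeasure (P.map (ε 0)) :=
    Measure.isProbabilityMeasure_map (hε.measurable 0).aemeasurable
  have hE := (hε.absMoment_pos hp).2
  have hR := hK.kernelRoughness_pos
  have hR' := hK.kernelSqMoment_pos
  have hKm := hK.measurable
  -- Orthogonality of the two weights, the source of the asymptotic independence.
  have hodd : ∫ u, K u * (K u * u) = 0 :=
    integral_eq_zero_of_odd fun u => by rw [hK.symm]; ring
  refine H.tendstoInDistribution_pair hp (hε.isScoreLaw hp) hKm hK.support hK.integrable
    hK.sq_integrable.integrable_sq (by fun_prop) (fun u hu => by simp [hK.support u hu])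
    (hK.integrable_mul measurable_id fun u hu => hu)
    (hK.integrable_sq_mul measurable_id fun u hu => hu) hodd
    (Real.sqrt_pos.2 (by positivity)).ne' (Real.sqrt_pos.2 (by positivity)).ne' ?_ ?_
  · rw [Real.sq_sqrt (by positivity), hε.absMoment_two_mul_eq hp, kernelRoughness]
  · rw [Real.sq_sqrt (by positivity), hε.absMoment_two_mul_eq hp, kernelSqMoment]
    congr 2
    exact integral_congr_ae (Eventually.of_forall fun u => by simp only [id]; ring)

/-- Standardization of a level estimator that is asymptotically linear. -/
lemma tendstoZeroInProb_standardized_level (hp : 1 < p) (hx : x ∈ Ioo a b)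
    (hε : IsErrorSequence P ε p)
    (hf : IsDesignDensity a b f) (hfx : 0 < f x) (hX : IsRandomDesign P X f)
    (hXε : IndepFun (fun ω i => X i ω) (fun ω i => ε i ω) P)
    (hK : IsSmoothingKernel K) (hh : IsBandwidth h) {t₀ B : ℝ}
    (hT : TendstoZeroInProb P fun (n : ℕ) ω =>
      f x * ((p - 1) * absMoment P (ε 0) (p - 2)) * (√(n * h n) * (T n ω - t₀)) -
        kernelScore p x h X ε K n ω)
    {c v r s : ℕ → ℝ} (hr : r =o[atTop] fun n => h n ^ 2)
    (hs : s =o[atTop] fun n : ℕ => 1 / ((n : ℝ) * h n))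
    (hc : ∀ n, c n = t₀ + B * h n ^ 2 + r n)
    (hv : ∀ n : ℕ, v n = kernelRoughness K * absMoment P (ε 0) (2 * p - 2) /
      (n * h n * f x * (p - 1) ^ 2 * absMoment P (ε 0) (p - 2) ^ 2) + s n) :
    TendstoZeroInProb P fun n ω => standardized T c v n ω -
      (√(f x * (kernelRoughness K * absMoment P (ε 0) (2 * p - 2))))⁻¹ *
        kernelScore p x h X ε K n ω := by
  have H := isLocalSample hf hx hX hε hXε hh
  have : IsProbabilityMeasure (P.map (ε 0)) :=
    Measure.isProbabilityMeasure_map (hε.measurable 0).aemeasurable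
  have hμ := hε.isScoreLaw hp
  obtain ⟨hc0, hE⟩ := hε.absMoment_pos hp
  have hR := hK.kernelRoughness_pos
  have hp1 : 0 < p - 1 := by linarith
  have hN := hh.mul_tendsto_top.eventually_gt_atTop 0
  refine tendstoZeroInProb_standardized (by positivity) (Real.sqrt_pos.2 (by positivity))
    (H.boundedInProb_sum hK.measurable hK.support hK.sq_integrable.integrable_sq
      (continuous_score hp).measurable hμ.integrable_sq hμ.mean) hT (fun n ω => rfl) hN
    (tendsto_mul_sub_of_isLittleO hh.pos hh.tendsto_sqrt_mul hr hc)
    (tendsto_mul_of_isLittleO hN hs fun n => ?_)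
  rw [hv, div_pow, Real.sq_sqrt (by positivity)]
  congr 1
  have h1 : f x * (kernelRoughness K * absMoment P (ε 0) (2 * p - 2)) /
      ((f x * ((p - 1) * absMoment P (ε 0) (p - 2))) ^ 2) =
      kernelRoughness K * absMoment P (ε 0) (2 * p - 2) /
        (f x * (p - 1) ^ 2 * absMoment P (ε 0) (p - 2) ^ 2) := by
    field_simp
  rw [h1, div_div]
  congr 1
  ring

/-- Standardization of a slope estimator that is asymptotically linear. -/
lemma tendstoZeroInProb_standardized_slope (hp : 1 < p) (hx : x ∈ Ioo a b)
    (hε : IsErrorSequence P ε p)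
    (hf : IsDesignDensity a b f) (hfx : 0 < f x) (hX : IsRandomDesign P X f)
    (hXε : IndepFun (fun ω i => X i ω) (fun ω i => ε i ω) P)
    (hK : IsSmoothingKernel K) (hh : IsBandwidth h) {t₀ B : ℝ}
    (hS : TendstoZeroInProb P fun (n : ℕ) ω =>
      f x * (kernelMoment K 2 * ((p - 1) * absMoment P (ε 0) (p - 2))) *
        (√(n * h n ^ 3) * (S n ω - t₀)) - kernelScore p x h X ε (fun u => K u * u) n ω)
    {c v r s : ℕ → ℝ} (hr : r =o[atTop] fun n => h n ^ 2)
    (hs : s =o[atTop] fun n : ℕ => 1 / ((n : ℝ) * h n ^ 3))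
    (hc : ∀ n, c n = t₀ + B * h n ^ 2 + r n)
    (hv : ∀ n : ℕ, v n = kernelSqMoment K 2 * absMoment P (ε 0) (2 * p - 2) /
      (n * h n ^ 3 * f x * kernelMoment K 2 ^ 2 * (p - 1) ^ 2 *
        absMoment P (ε 0) (p - 2) ^ 2) + s n) :
    TendstoZeroInProb P fun n ω => standardized S c v n ω -
      (√(f x * (kernelSqMoment K 2 * absMoment P (ε 0) (2 * p - 2))))⁻¹ *
        kernelScore p x h X ε (fun u => K u * u) n ω := by
  have H := isLocalSample hf hx hX hε hXε hh
  have : IsProbabilityMeasure (P.map (ε 0)) :=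
    Measure.isProbabilityMeasure_map (hε.measurable 0).aemeasurable
  have hμ := hε.isScoreLaw hp
  have hKm := hK.measurable
  obtain ⟨hc0, hE⟩ := hε.absMoment_pos hp
  have hR := hK.kernelSqMoment_pos
  have hM := hK.kernelMoment_pos
  have hp1 : 0 < p - 1 := by linarith
  have hN : ∀ᶠ n : ℕ in atTop, 0 < (n : ℝ) * h n ^ 3 := by
    filter_upwards [eventually_gt_atTop 0] with n hn
    have := hh.pos n
    positivity
  refine tendstoZeroInProb_standardized (by positivity) (Real.sqrt_pos.2 (by positivity))
    (H.boundedInProb_sum (κ := fun u => K u * u) (by fun_prop)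
      (fun u hu => by simp [hK.support u hu])
      (hK.integrable_sq_mul measurable_id fun u hu => hu)
      (continuous_score hp).measurable hμ.integrable_sq hμ.mean) hS (fun n ω => rfl) hN
    (tendsto_mul_sub_of_isLittleO hh.pos hh.tendsto_sqrt_mul_pow_three hr hc)
    (tendsto_mul_of_isLittleO hN hs fun n => ?_)
  rw [hv, div_pow, Real.sq_sqrt (by positivity)]
  congr 1
  have h1 : f x * (kernelSqMoment K 2 * absMoment P (ε 0) (2 * p - 2)) /
      ((f x * (kernelMoment K 2 * ((p - 1) * absMoment P (ε 0) (p - 2)))) ^ 2) =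
      kernelSqMoment K 2 * absMoment P (ε 0) (2 * p - 2) /
        (f x * kernelMoment K 2 ^ 2 * (p - 1) ^ 2 * absMoment P (ε 0) (p - 2) ^ 2) := by
    field_simp
  rw [h1, div_div]
  congr 1
  ring

end Main

/-! ### Conclusion -/

theorem theorem1 {Ω : Type*} [MeasurableSpace Ω] (P : Measure Ω) [IsProbabilityMeasure P]
    (p : ℝ) (hp : 1 < p)
    (a b x : ℝ) (hx : x ∈ Ioo a b)
    (f m K : ℝ → ℝ) (h : ℕ → ℝ) (X ε Y : ℕ → Ω → ℝ)
    (hY : ∀ i ω, Y i ω = m (X i ω) + ε i ω)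
    (hε : IsErrorSequence P ε p)
    (hf : IsDesignDensity a b f) (hfx : 0 < f x) (hX : IsRandomDesign P X f)
    (hXε : IndepFun (fun ω i => X i ω) (fun ω i => ε i ω) P)
    (hK : IsSmoothingKernel K) (hh : IsBandwidth h) :
    -- (i) the local constant estimator of `m(x)`
    (ContDiffOn ℝ 2 m (Ioo a b) →
      (fun t : ℝ => absMoment P (fun ω => ε 0 ω - t) (p - 2) - absMoment P (ε 0) (p - 2))
        =O[𝓝 0] (fun t : ℝ => t) →
      ∀ T : ℕ → Ω → ℝ, IsLocConstEstimator P p K h x X Y T →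
      ∀ r s : ℕ → ℝ, r =o[atTop] (fun n => h n ^ 2) →
        s =o[atTop] (fun n : ℕ => 1 / ((n : ℝ) * h n)) →
      IsAsymptoticallyNormal P T
        (fun n => m x + kernelMoment K 2 * h n ^ 2 *
          (deriv m x * deriv f x / f x + iteratedDeriv 2 m x / 2) + r n)
        (fun n => kernelRoughness K * absMoment P (ε 0) (2 * p - 2) /
          (n * h n * (p - 1) ^ 2 * absMoment P (ε 0) (p - 2) ^ 2 * f x) + s n)) ∧
    -- (ii), (iii) the local linear estimators `T` of `m(x)` and `S` of `m'(x)`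
    (ContDiffOn ℝ 3 m (Ioo a b) →
      ∀ T S : ℕ → Ω → ℝ, IsLocLinEstimator P p K h x X Y T S →
      ∀ r₀ s₀ r₁ s₁ : ℕ → ℝ, r₀ =o[atTop] (fun n => h n ^ 2) →
        s₀ =o[atTop] (fun n : ℕ => 1 / ((n : ℝ) * h n)) →
        r₁ =o[atTop] (fun n => h n ^ 2) →
        s₁ =o[atTop] (fun n : ℕ => 1 / ((n : ℝ) * h n ^ 3)) →
      ∀ c₀ v₀ c₁ v₁ : ℕ → ℝ,
        (∀ n, c₀ n = m x + kernelMoment K 2 * h n ^ 2 * iteratedDeriv 2 m x / 2 + r₀ n) →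
        (∀ n, v₀ n = kernelRoughness K * absMoment P (ε 0) (2 * p - 2) /
          (n * h n * f x * (p - 1) ^ 2 * absMoment P (ε 0) (p - 2) ^ 2) + s₀ n) →
        (∀ n, c₁ n = deriv m x + kernelMoment K 4 * h n ^ 2 * iteratedDeriv 3 m x /
          ((Nat.factorial 3 : ℝ) * kernelMoment K 2) + r₁ n) →
        (∀ n, v₁ n = kernelSqMoment K 2 * absMoment P (ε 0) (2 * p - 2) /
          (n * h n ^ 3 * f x * kernelMoment K 2 ^ 2 * (p - 1) ^ 2 *
            absMoment P (ε 0) (p - 2) ^ 2) + s₁ n) →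
      IsAsymptoticallyNormal P T c₀ v₀ ∧
      IsAsymptoticallyNormal P S c₁ v₁ ∧
      AreAsymptoticallyIndepNormal P T c₀ v₀ S c₁ v₁) := by
  refine ⟨fun hm hO T hT r s hr hs => ?_, fun hm T S hTS r₀ s₀ r₁ s₁ hr₀ hs₀ hr₁ hs₁ c₀ v₀ c₁ v₁
    hc₀ hv₀ hc₁ hv₁ => ?_⟩
  · have hlin := hT.tendstoZeroInProb hp hx hY hε hf hfx hX hXε hK hh hm hO
    have hstd := tendstoZeroInProb_standardized_level hp hx hε hf hfx hX hXε hK hh hlin hr hs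
      (c := fun n => m x + kernelMoment K 2 * h n ^ 2 *
          (deriv m x * deriv f x / f x + iteratedDeriv 2 m x / 2) + r n)
      (v := fun n => kernelRoughness K * absMoment P (ε 0) (2 * p - 2) /
          (n * h n * (p - 1) ^ 2 * absMoment P (ε 0) (p - 2) ^ 2 * f x) + s n)
      -- The whole h² bias is one constant times h², as the standardization lemma requires.
      (B := kernelMoment K 2 * (deriv m x * deriv f x / f x + iteratedDeriv 2 m x / 2))
      (fun n => by ring) (fun n => by ring)
    exact tendstoInDistribution_of_tendstoInMeasure_sub _ _
      (tendstoInDistribution_kernelScore hp hx hε hf hfx hX hXε hK hh).fst hstd.tendstoInMeasure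
      fun n => ((hT.aemeasurable n).sub_const _).div_const _
  · have hm2 : ContDiffOn ℝ 2 m (Ioo a b) := hm.of_le (by norm_num)
    obtain ⟨hT, hS⟩ := hTS.tendstoZeroInProb hp hx hY hε hf hfx hX hXε hK hh hm2
    have hstdT := tendstoZeroInProb_standardized_level hp hx hε hf hfx hX hXε hK hh hT hr₀ hs₀
      (c := c₀) (v := v₀) (B := kernelMoment K 2 * iteratedDeriv 2 m x / 2)
      (fun n => by rw [hc₀]; ring) hv₀
    have hstdS := tendstoZeroInProb_standardized_slope hp hx hε hf hfx hX hXε hK hh hS hr₁ hs₁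
      (c := c₁) (v := v₁)
      (B := kernelMoment K 4 * iteratedDeriv 3 m x / ((Nat.factorial 3 : ℝ) * kernelMoment K 2))
      (fun n => by rw [hc₁]; ring) hv₁
    -- The joint limit comes first; both marginal statements are its projections.
    have hjoint : AreAsymptoticallyIndepNormal P T c₀ v₀ S c₁ v₁ :=
      tendstoInDistribution_of_tendstoInMeasure_sub _ _
        (tendstoInDistribution_kernelScore hp hx hε hf hfx hX hXε hK hh)
        (hstdT.prodMk_tendstoInMeasure hstdS) fun n =>
        (((hTS.aemeasurable_fst n).sub_const _).div_const _).prodMk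
          (((hTS.aemeasurable_snd n).sub_const _).div_const _)
    exact ⟨hjoint.fst, hjoint.snd, hjoint⟩
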